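/- Let $d\ge 1$, let $1<p<\infty$, and let $\Omega\subset\mathbb{R}^{d+1}$ be a bounded domain (open connected nonempty set) of class $C^1$. For $x,y\in\partial\Omega$ let $d_{\partial\Omega}(x,y)$ be the infimum of the lengths of the curves in $\partial\Omega$ from $x$ to $y$ ($\infty$ if there is none of finite length). A minimizing geodesic from $x$ to $y$ is a curve $\gamma:[0,1]\to\partial\Omega$ from $x$ to $y$ of length $d_{\partial\Omega}(x,y)<\infty$, parametrized proportionally to arc length. Let $\operatorname{inj}_{\partial\Omega}$ be the injectivity radius of $\partial\Omega$, that is, the supremum of all $r\in[0,\infty]$ such that any two points $x,y\in\partial\Omega$ with $d_{\partial\Omega}(x,y)<r$ are joined by exactly one minimizing geodesic. For a continuous vector field $B$ on $\partial\Omega$ and $x,y\in\partial\Omega$ joined by a minimizing geodesic $\gamma$ from $x$ to $y$, put $$I^{\partial\Omega}_{B}(x,y)=\int_0^1 B(\gamma(t))\cdot\gamma'(t)\,dt$$ (some minimizing geodesic being fixed for the pairs that are joined by several ones; $I^{\partial\Omega}_B(x,y)=0$ when there is none). There exists a constant $C_{\Omega,p}>0$, depending only on $\Omega$ and $p$, such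 that the following holds. Let $A\in C^1(\overline\Omega,\mathbb{R}^{d+1})$, viewed as a differential $1$-form, and let $\beta\ge 0$ be such that its exterior derivative satisfies $\|dA\|_{L^\infty(\Omega)}\le\beta$. Let $U\in W^{1,p}_A(\Omega)$, that is, $U\in W^{1,1}_{\mathrm{loc}}(\Omega,\mathbb{C})$, $U\in L^p(\Omega)$ and $\nabla_A U:=\nabla U+iAU\in L^p(\Omega)$, where $\nabla U$ is the weak gradient. Let $u=\operatorname{Tr}U$ be its trace on $\partial\Omega$, that is, the limit in $L^p(\partial\Omega)$ of $V_n|_{\partial\Omega}$ for functions $V_n\in C^1(\overline\Omega,\mathbb{C})$ that converge to $U$ in $W^{1,p}(\Omega)$. For $z\in\partial\Omega$ put $A^{\shortparallel}(z)=A(z)-(A(z)\cdot\nu(z))\,\nu(z)$, where $\nu(z)$ is a unit normal vector of $\partial\Omega$ at $z$. Then $$\iint\limits_{\substack{(x,y)\in\partial\Omega\times\partial\Omega\\ d_{\partial\Omega}(y,x)\le\operatorname{inj}_{\partial\Omega}}}\frac{\bigl|e^{i\,I^{\partial\Omega}_{A^{\shortparallel}}(x,y)}u(y)-u(x)\bigr|^p}{|y-x|^{d+p-1}}\,dx\,dy\;\le\;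 C_{\Omega,p}\int_\Omega|\nabla_A U|^p+\bigl(1+\beta^{p/2}\bigr)|U|^p .$$ -/

import Mathlib

open MeasureTheory Set Filter Topology
open scoped ENNReal NNReal ContDiff

noncomputable section

namespace MagneticTrace

/-- The Euclidean space of dimension `d + 1`. -/
abbrev Space (d : ℕ) : Type := EuclideanSpace ℝ (Fin (d + 1))

/-- Complex vectors with `d + 1` components: the values of gradients of complex functions. -/
abbrev CSpace (d : ℕ) : Type := EuclideanSpace ℂ (Fin (d + 1))

/-! ### Domains of class `C¹` -/

/-- A bounded domain of class `C¹`: a bounded, open, connected (nonempty) set which, near each of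
its boundary points, is the sublevel set `{ρ < 0}` of a `C¹` function `ρ` with nonzero
differential. -/
structure IsBoundedC1Domain {d : ℕ} (Ω : Set (Space d)) : Prop where
  isOpen : IsOpen Ω
  isConnected : IsConnected Ω
  isBounded : Bornology.IsBounded Ω
  boundary : ∀ z ∈ frontier Ω, ∃ (V : Set (Space d)) (ρ : Space d → ℝ),
    IsOpen V ∧ z ∈ V ∧ ContDiffOn ℝ 1 ρ V ∧ fderiv ℝ ρ z ≠ 0 ∧
      ∀ x ∈ V, (x ∈ Ω ↔ ρ x < 0)

/-- The surface measure on the boundary: the `d`-dimensional Hausdorff measure, normalized as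
Lebesgue measure, restricted to the boundary. -/
def surfaceMeasure {d : ℕ} (Ω : Set (Space d)) : Measure (Space d) :=
  (Measure.euclideanHausdorffMeasure d).restrict (frontier Ω)

/-- `n` is a unit normal vector of the boundary of `Ω` at `z`: it is a unit vector orthogonal to
all vectors that are tangent to the boundary at `z`. -/
def IsUnitNormal {d : ℕ} (Ω : Set (Space d)) (z n : Space d) : Prop :=
  ‖n‖ = 1 ∧ ∀ v ∈ tangentConeAt ℝ (frontier Ω) z, inner ℝ n v = 0

/-- The tangential part `A - (A · ν) ν` of the vector field `A`. -/
def tangentialPart {d : ℕ} (ν A : Space d → Space d) (z : Space d) : Space d :=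
  A z - (inner ℝ (A z) (ν z) : ℝ) • ν z

/-! ### Intrinsic distance, minimizing geodesics and injectivity radius -/

/-- `γ`, restricted to `[0, 1]`, is a continuous curve in `S` from `x` to `y`. -/
structure IsCurveIn {d : ℕ} (S : Set (Space d)) (γ : ℝ → Space d) (x y : Space d) : Prop where
  continuousOn : ContinuousOn γ (Icc 0 1)
  mapsTo : MapsTo γ (Icc 0 1) S
  source : γ 0 = x
  target : γ 1 = y

/-- The intrinsic (geodesic) distance on `S`: the infimum of the lengths of the curves in `S`
that join `x` to `y` (it is `∞` when there is no such curve of finite length). -/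
def intrinsicDist {d : ℕ} (S : Set (Space d)) (x y : Space d) : ℝ≥0∞ :=
  ⨅ (γ : ℝ → Space d) (_ : IsCurveIn S γ x y), eVariationOn γ (Icc 0 1)

/-- `γ : [0, 1] → S` is a minimizing geodesic of `S` from `x` to `y`, with the usual
parametrization proportional to arc length: it is a curve in `S`, and the length of its portion
over `[s, t]` is `(t - s)` times the (finite) intrinsic distance from `x` to `y`. -/
structure IsMinimizingGeodesic {d : ℕ} (S : Set (Space d)) (γ : ℝ → Space d) (x y : Space d) :
    Prop where
  curve : IsCurveIn S γ x y
  finite : intrinsicDist S x y < ⊤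
  length : ∀ s t : ℝ, 0 ≤ s → s ≤ t → t ≤ 1 →
    eVariationOn γ (Icc s t) = ENNReal.ofReal (t - s) * intrinsicDist S x y

/-- The injectivity radius of `S`: the supremum of the radii `r` such that any two points of `S`
at intrinsic distance less than `r` are joined by exactly one minimizing geodesic.
(For a compact smooth hypersurface, this is the usual injectivity radius.) -/
def injRadius {d : ℕ} (S : Set (Space d)) : ℝ≥0∞ :=
  sSup {r : ℝ≥0∞ | ∀ x ∈ S, ∀ y ∈ S, intrinsicDist S x y < r →
    ∃ γ : ℝ → Space d, IsMinimizingGeodesic S γ x y ∧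
      ∀ γ' : ℝ → Space d, IsMinimizingGeodesic S γ' x y → EqOn γ' γ (Icc 0 1)}

open Classical in
/-- The line integral `∫₀¹ B(γ(t)) · γ'(t) dt` of the vector field `B` along the minimizing
geodesic `γ` of `S` from `x` to `y`. -/
def geodesicPotential {d : ℕ} (S : Set (Space d)) (B : Space d → Space d) (x y : Space d) : ℝ :=
  if h : ∃ γ : ℝ → Space d, IsMinimizingGeodesic S γ x y then
    ∫ t in (0 : ℝ)..1, (inner ℝ (B (h.choose t)) (deriv h.choose t) : ℝ)
  else 0

/-! ### Magnetic Sobolev functions and their traces -/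

/-- The exterior derivative `dA` of `A`, seen as the differential `1`-form `v ↦ A · v`. -/
def magneticField {d : ℕ} (A : Space d → Space d) (x : Space d) :
    Space d [⋀^Fin 2]→L[ℝ] ℝ :=
  extDeriv (fun z ↦ ContinuousAlternatingMap.ofSubsingleton ℝ (Space d) ℝ (0 : Fin 1)
    (innerSL ℝ (A z))) x

/-- The classical gradient of a complex-valued function. -/
def grad {d : ℕ} (V : Space d → ℂ) (x : Space d) : CSpace d :=
  WithLp.toLp 2 fun j ↦ fderiv ℝ V x (EuclideanSpace.single j 1)

/-- `U` belongs to `W^{1,1}_loc(Ω, ℂ)` and its weak gradient on `Ω` is `G`. -/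
structure HasWeakGradient {d : ℕ} (Ω : Set (Space d)) (U : Space d → ℂ) (G : Space d → CSpace d) :
    Prop where
  locallyIntegrableOn : LocallyIntegrableOn U Ω
  locallyIntegrableOn_grad : LocallyIntegrableOn G Ω
  integral_eq : ∀ φ : Space d → ℝ, ContDiff ℝ ∞ φ → HasCompactSupport φ → tsupport φ ⊆ Ω →
    ∀ j : Fin (d + 1), ∫ x in Ω, fderiv ℝ φ x (EuclideanSpace.single j 1) • U x =
      -∫ x in Ω, φ x • G x j

/-- The covariant gradient `∇U + i A U`, where `G` stands for the weak gradient `∇U`. -/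
def covariantGradient {d : ℕ} (A : Space d → Space d) (U : Space d → ℂ) (G : Space d → CSpace d)
    (x : Space d) : CSpace d :=
  WithLp.toLp 2 fun j ↦ G x j + Complex.I * ((A x j : ℝ) : ℂ) * U x

/-- `U` belongs to the magnetic Sobolev space `W^{1,p}_A(Ω)`, with weak gradient `G`. -/
structure MemMagneticSobolev {d : ℕ} (Ω : Set (Space d)) (A : Space d → Space d) (p : ℝ)
    (U : Space d → ℂ) (G : Space d → CSpace d) : Prop where
  hasWeakGradient : HasWeakGradient Ω U G
  memLp : MemLp U (ENNReal.ofReal p) (volume.restrict Ω)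
  memLp_covariantGradient :
    MemLp (covariantGradient A U G) (ENNReal.ofReal p) (volume.restrict Ω)

/-- `u` is the trace on the boundary of the function `U` with weak gradient `G`, that is, the value
at `U` of the continuous extension to `W^{1,p}(Ω)` of the restriction operator
`V ↦ V|_{∂Ω}`, `V ∈ C¹(closure Ω)`: some sequence of functions in `C¹(closure Ω)` converges to `U`
in `W^{1,p}(Ω)` while their restrictions to the boundary converge to `u` in `L^p(∂Ω)`. -/
def IsTrace {d : ℕ} (Ω : Set (Space d)) (p : ℝ) (U : Space d → ℂ) (G : Space d → CSpace d)
    (u : Space d → ℂ) : Prop :=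
  MemLp u (ENNReal.ofReal p) (surfaceMeasure Ω) ∧
  ∃ V : ℕ → Space d → ℂ, (∀ n, ContDiffOn ℝ 1 (V n) (closure Ω)) ∧
    Tendsto (fun n ↦ eLpNorm (fun x ↦ V n x - U x) (ENNReal.ofReal p) (volume.restrict Ω))
      atTop (𝓝 0) ∧
    Tendsto (fun n ↦ eLpNorm (fun x ↦ grad (V n) x - G x) (ENNReal.ofReal p) (volume.restrict Ω))
      atTop (𝓝 0) ∧
    Tendsto (fun n ↦ eLpNorm (fun x ↦ V n x - u x) (ENNReal.ofReal p) (surfaceMeasure Ω))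
      atTop (𝓝 0)

/-- The magnetic Gagliardo integral on the boundary
`∬ |e^{i I(x, y)} u(y) - u(x)|^p / |y - x|^{d + p - 1} dx dy`, over the pairs of boundary points
whose intrinsic distance is at most the injectivity radius, where `I(x, y)` is the line integral
of `B` along the minimizing geodesic of the boundary from `x` to `y`. -/
def boundaryGagliardo {d : ℕ} (Ω : Set (Space d)) (p : ℝ) (B : Space d → Space d)
    (u : Space d → ℂ) : ℝ≥0∞ :=
  ∫⁻ x, ∫⁻ y in {y | intrinsicDist (frontier Ω) y x ≤ injRadius (frontier Ω)},
    ‖Complex.exp (Complex.I * (geodesicPotential (frontier Ω) B x y : ℂ)) * u y - u x‖ₑ ^ p /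
      ‖y - x‖ₑ ^ ((d : ℝ) + p - 1) ∂(surfaceMeasure Ω) ∂(surfaceMeasure Ω)

end MagneticTrace

end

open MagneticTrace

/-!
Why the inequality holds. Only three facts about the boundary are used: it is compact, near each of
its points it is the graph of a `1`-Lipschitz function with `Ω` above it (`LipschitzChart`, from the
uniform interior cone condition `exists_interior_cone`), and below the injectivity radius two
points are joined by a minimizing geodesic.

For smooth `V`, the heart is a pointwise estimate at two close boundary points `x` and `y`
(`LipschitzChart.enorm_geodesicTransport_sub_le`). Draw from each of them a ray, straight in
the coordinates that flatten the boundary; the two rays meet at a point of `Ω` above the middle of `x` and `y`, at a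
height proportional to `|y - x|`. Parallel transport along a ray changes `V` by at most the integral
of `|∇_A V|` over the ray (`enorm_parallelTransport_sub_le`). The two rays and the geodesic from `x`
to `y` form a closed curve of size `|y - x|`, so that the phases differ by its magnetic flux, which
is at most a constant times `β |y - x|²`. The flux bound does not need Stokes' theorem on a surface:
the region is star-shaped about the meeting point, and there the line integral of `A` along the rays
from that point is a potential whose differential is `A` up to `β` times the distance to the point
(`abs_fderiv_radialPotential_sub_le`). As a velocity of a curve in the boundary is orthogonal to the
normal, the line integral of the tangential part of `A` is that of `A`
(`exists_curve_geodesicPotential_eq`).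

It remains to integrate. The rays contribute at most `∫ |∇_A V|^p`, by Hölder's inequality with a
power weight and polar coordinates (`exists_lintegral_ray_le`). The flux contributes
`min 2 (β |y - x|²)` times `|V(y)|`; its integral in `x` scales like `β ^ ((p - 1) / 2)`
(`exists_lintegral_min_rpow_le`), and what is left is a boundary integral of `|V|^p`, which the
trace inequality at the magnetic scale `β ^ (-1/2)` turns into the right-hand side
(`LipschitzChart.exists_rpow_mul_lintegral_F_le_magneticEnergy`). Distant pairs are controlled by
the trace inequality alone.

The passage from smooth functions to `U` uses Fatou's lemma on the boundary. The integrand of the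
Gagliardo integral is not known to be measurable, since nothing is known about the dependence of the
geodesics on their end points; for this reason it is always replaced by a measurable majorant
(`exists_gagliardoIntegrand_majorant`).
-/

noncomputable section

namespace MagneticTrace

/-! ### Lipschitz curves -/

/-- A form of the fundamental theorem of calculus for Lipschitz curves: the increment is bounded by
the integral of any bound for the derivative, which exists almost everywhere. -/
theorem enorm_sub_le_lintegral_of_lipschitzOnWith {F : Type*} [NormedAddCommGroup F]
    [InnerProductSpace ℝ F] [FiniteDimensional ℝ F] {f : ℝ → F} {K : ℝ≥0} {a b : ℝ} (hab : a ≤ b)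
    (hf : LipschitzOnWith K f (Icc a b)) {g : ℝ → ℝ≥0∞}
    (hg : ∀ᵐ t, t ∈ Ioo a b → ∀ f', HasDerivAt f f' t → ‖f'‖ₑ ≤ g t) :
    ‖f b - f a‖ₑ ≤ ∫⁻ t in Ioo a b, g t := by
  by_cases h0 : f b - f a = 0
  · simp [h0]
  set u : F := ‖f b - f a‖⁻¹ • (f b - f a) with hu
  have hu1 : ‖u‖ = 1 := by
    rw [hu, norm_smul, norm_inv, norm_norm, inv_mul_cancel₀ (norm_ne_zero_iff.2 h0)]
  set φ : ℝ → ℝ := fun t ↦ inner ℝ u (f t) with hφ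
  have hφL : LipschitzOnWith K φ (uIcc a b) := by
    rw [uIcc_of_le hab]
    refine LipschitzOnWith.of_dist_le_mul fun x hx y hy ↦ ?_
    rw [Real.dist_eq, hφ, ← inner_sub_right]
    refine (abs_real_inner_le_norm _ _).trans ?_
    rw [hu1, one_mul, ← dist_eq_norm]
    exact hf.dist_le_mul x hx y hy
  have h1 := hφL.absolutelyContinuousOnInterval.integral_deriv_eq_sub
  have h2 : φ b - φ a = ‖f b - f a‖ := by
    rw [hφ, ← inner_sub_right, hu, real_inner_smul_left, real_inner_self_eq_norm_sq]
    field_simp [norm_ne_zero_iff.2 h0]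
  have h3 : ‖f b - f a‖ₑ = ‖∫ t in a..b, deriv φ t‖ₑ := by
    rw [h1, h2]; simp
  rw [h3, intervalIntegral.integral_of_le hab, integral_Ioc_eq_integral_Ioo]
  refine (enorm_integral_le_lintegral_enorm _).trans ?_
  refine lintegral_mono_ae ?_
  rw [ae_restrict_iff' measurableSet_Ioo]
  filter_upwards [hg, hf.ae_differentiableWithinAt_of_mem] with t ht htd hmem
  have hd : DifferentiableAt ℝ f t :=
    (htd (Ioo_subset_Icc_self hmem)).differentiableAt (Icc_mem_nhds hmem.1 hmem.2)
  have hderiv : HasDerivAt φ (inner ℝ u (deriv f t)) t := by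
    have := (innerSL ℝ u).hasFDerivAt.comp_hasDerivAt t hd.hasDerivAt
    simpa [hφ, Function.comp_def] using this
  rw [hderiv.deriv]
  refine le_trans ?_ (ht hmem _ hd.hasDerivAt)
  rw [enorm_le_iff_norm_le, Real.norm_eq_abs]
  refine (abs_real_inner_le_norm _ _).trans ?_
  rw [hu1, one_mul]

/-- Composition of a Lipschitz curve on a compact interval with a function that is Lipschitz near
each point of the curve. -/
theorem exists_lipschitzOnWith_comp {X Y : Type*} [PseudoMetricSpace X] [PseudoMetricSpace Y]
    {c : ℝ → X} {Φ : X → Y} {K : ℝ≥0} {a b : ℝ} (hc : LipschitzOnWith K c (Icc a b))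
    (hΦ : ∀ t ∈ Icc a b, ∃ L : ℝ≥0, ∃ s ∈ 𝓝 (c t), LipschitzOnWith L Φ s) :
    ∃ K', LipschitzOnWith K' (Φ ∘ c) (Icc a b) := by
  apply LocallyLipschitzOn.exists_lipschitzOnWith_of_compact isCompact_Icc
  intro t ht
  obtain ⟨L, s, hs, hL⟩ := hΦ t ht
  refine ⟨L * K, c ⁻¹' s ∩ Icc a b, ?_, ?_⟩
  · exact inter_mem ((hc.continuousOn t ht) hs) self_mem_nhdsWithin
  · exact hL.comp (hc.mono inter_subset_right) fun x hx ↦ hx.1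

/-- The velocity of a Lipschitz curve is bounded by the Lipschitz constant. -/
theorem norm_deriv_le_of_lipschitzOnWith_Icc {F : Type*} [NormedAddCommGroup F] [NormedSpace ℝ F]
    {f : ℝ → F} {K : ℝ≥0} {a b t : ℝ} (hf : LipschitzOnWith K f (Icc a b)) (ht : t ∈ Ioo a b) :
    ‖deriv f t‖ ≤ K :=
  norm_deriv_le_of_lipschitzOn (Icc_mem_nhds ht.1 ht.2) hf

/-- The velocity pairing `B(γ(t)) · γ'(t)` along a Lipschitz curve is integrable. -/
theorem intervalIntegrable_inner_deriv {d : ℕ} {S : Set (Space d)} {B : Space d → Space d}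
    {γ : ℝ → Space d} {K : ℝ≥0} {a b : ℝ} (hab : a ≤ b) (hB : ContinuousOn B S)
    (hγ : LipschitzOnWith K γ (Icc a b)) (hmaps : MapsTo γ (Icc a b) S) :
    IntervalIntegrable (fun t ↦ (inner ℝ (B (γ t)) (deriv γ t) : ℝ)) volume a b := by
  have hc : ContinuousOn (fun t ↦ B (γ t)) (Icc a b) := hB.comp hγ.continuousOn hmaps
  obtain ⟨M, hM⟩ := isCompact_Icc.exists_bound_of_continuousOn hc
  rw [intervalIntegrable_iff_integrableOn_Ioo_of_le hab]
  refine Integrable.of_bound ?_ (M * K) ?_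
  · exact ((hc.mono Ioo_subset_Icc_self).aestronglyMeasurable measurableSet_Ioo).inner (𝕜 := ℝ)
      (stronglyMeasurable_deriv γ).aestronglyMeasurable
  · rw [ae_restrict_iff' measurableSet_Ioo]
    refine Eventually.of_forall fun t ht ↦ ?_
    refine (norm_inner_le_norm (𝕜 := ℝ) _ _).trans ?_
    have := hM t (Ioo_subset_Icc_self ht)
    exact mul_le_mul this (norm_deriv_le_of_lipschitzOnWith_Icc hγ ht) (norm_nonneg _)
      ((norm_nonneg _).trans this)

/-- The line integral of a continuous field along a Lipschitz curve is a Lipschitz function of the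
upper bound. -/
theorem exists_lipschitzOnWith_integral_inner_deriv {d : ℕ} {S : Set (Space d)}
    {B : Space d → Space d} {γ : ℝ → Space d} {K : ℝ≥0} {a b : ℝ} (hab : a ≤ b)
    (hB : ContinuousOn B S) (hγ : LipschitzOnWith K γ (Icc a b))
    (hmaps : MapsTo γ (Icc a b) S) :
    ∃ L : ℝ≥0, LipschitzOnWith L
      (fun s ↦ ∫ t in a..s, (inner ℝ (B (γ t)) (deriv γ t) : ℝ)) (Icc a b) := by
  have hc : ContinuousOn (fun t ↦ B (γ t)) (Icc a b) := hB.comp hγ.continuousOn hmaps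
  obtain ⟨M, hM⟩ := isCompact_Icc.exists_bound_of_continuousOn hc
  have hM0 : 0 ≤ M := (norm_nonneg _).trans (hM a (left_mem_Icc.2 hab))
  have hint := intervalIntegrable_inner_deriv hab hB hγ hmaps
  refine ⟨(M * K).toNNReal, LipschitzOnWith.of_dist_le_mul fun x hx y hy ↦ ?_⟩
  have hix : IntervalIntegrable (fun t ↦ (inner ℝ (B (γ t)) (deriv γ t) : ℝ)) volume a x :=
    hint.mono_set (by rw [uIcc_of_le hab, uIcc_of_le hx.1]; exact Icc_subset_Icc_right hx.2)
  have hiy : IntervalIntegrable (fun t ↦ (inner ℝ (B (γ t)) (deriv γ t) : ℝ)) volume a y :=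
    hint.mono_set (by rw [uIcc_of_le hab, uIcc_of_le hy.1]; exact Icc_subset_Icc_right hy.2)
  rw [Real.dist_eq, intervalIntegral.integral_interval_sub_left hix hiy,
    Real.coe_toNNReal _ (by positivity), Real.dist_eq, ← Real.norm_eq_abs]
  refine intervalIntegral.norm_integral_le_of_norm_le_const_ae ?_
  have hne : ∀ᵐ t : ℝ, t ≠ b := by simp [ae_iff]
  filter_upwards [hne] with t htb ht
  have ht1 : t ∈ Ioo a b := by
    rw [uIoc, mem_Ioc] at ht
    refine ⟨lt_of_le_of_lt (le_min hy.1 hx.1) ht.1, lt_of_le_of_ne ?_ htb⟩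
    exact ht.2.trans (max_le hy.2 hx.2)
  refine (norm_inner_le_norm (𝕜 := ℝ) _ _).trans ?_
  exact mul_le_mul (hM t (Ioo_subset_Icc_self ht1)) (norm_deriv_le_of_lipschitzOnWith_Icc hγ ht1)
      (norm_nonneg _) hM0

/-! ### Parallel transport along curves -/

/-- The derivative of `V` paired with `v`, plus `i (A · v) V`, is the pairing of the covariant
gradient with `v`. -/
theorem norm_fderiv_add_mul_le {d : ℕ} (A : Space d → Space d) (V : Space d → ℂ) (x v : Space d) :
    ‖fderiv ℝ V x v + Complex.I * ((inner ℝ (A x) v : ℝ) : ℂ) * V x‖ ≤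
      ‖covariantGradient A V (grad V) x‖ * ‖v‖ := by
  set v' : CSpace d := WithLp.toLp 2 fun j ↦ ((v j : ℝ) : ℂ) with hv'
  have hn : ‖v'‖ = ‖v‖ := by
    simp [EuclideanSpace.norm_eq, hv']
  have hv : v = ∑ j, v j • EuclideanSpace.single j (1 : ℝ) := by
    ext i
    simp [Finset.sum_apply, Pi.single_apply]
  have h1 : fderiv ℝ V x v = ∑ j, ((v j : ℝ) : ℂ) * fderiv ℝ V x (EuclideanSpace.single j 1) := by
    conv_lhs => rw [hv]
    rw [map_sum]
    simp
  have h2 : (inner ℝ (A x) v : ℝ) = ∑ j, v j * A x j := by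
    simp [PiLp.inner_apply]
  have h3 : fderiv ℝ V x v + Complex.I * ((inner ℝ (A x) v : ℝ) : ℂ) * V x =
      inner ℂ v' (covariantGradient A V (grad V) x) := by
    rw [h1, h2, PiLp.inner_apply]
    simp only [covariantGradient, grad, hv', RCLike.inner_apply, Complex.conj_ofReal]
    push_cast
    rw [Finset.mul_sum, Finset.sum_mul, ← Finset.sum_add_distrib]
    refine Finset.sum_congr rfl fun j _ ↦ ?_
    ring
  rw [h3, mul_comm, ← hn]
  exact norm_inner_le_norm _ _

/-- Along a Lipschitz curve that starts in the closure of `Ω` and stays in `Ω` afterwards, the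
parallel transport of the final value of `V` differs from the initial one by at most the integral
of the covariant gradient. -/
theorem enorm_parallelTransport_sub_le {d : ℕ} {Ω : Set (Space d)} (hΩ : IsOpen Ω)
    {A : Space d → Space d} (hA : ContinuousOn A (closure Ω)) {V : Space d → ℂ}
    (hV : ContDiffOn ℝ 1 V Ω) (hVc : ContinuousOn V (closure Ω)) {γ : ℝ → Space d} {K : ℝ≥0}
    (hγ : LipschitzOnWith K γ (Icc 0 1)) (h0 : γ 0 ∈ closure Ω) (hmaps : MapsTo γ (Ioc 0 1) Ω) :
    ‖Complex.exp (Complex.I * ((∫ t in (0 : ℝ)..1, (inner ℝ (A (γ t)) (deriv γ t) : ℝ) : ℝ) : ℂ)) *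
        V (γ 1) - V (γ 0)‖ₑ ≤
      K * ∫⁻ t in Ioo (0 : ℝ) 1, ‖covariantGradient A V (grad V) (γ t)‖ₑ := by
  have hmc : MapsTo γ (Icc 0 1) (closure Ω) := fun t ht ↦ by
    rcases ht.1.eq_or_lt with rfl | h
    · exact h0
    · exact subset_closure (hmaps ⟨h, ht.2⟩)
  set ψ : ℝ → ℝ := fun t ↦ inner ℝ (A (γ t)) (deriv γ t) with hψ
  set θ : ℝ → ℝ := fun s ↦ ∫ t in (0 : ℝ)..s, ψ t with hθ
  have hint : IntervalIntegrable ψ volume 0 1 :=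
    intervalIntegrable_inner_deriv zero_le_one hA hγ hmc
  obtain ⟨L, hL⟩ : ∃ L : ℝ≥0, LipschitzOnWith L θ (Icc 0 1) :=
    exists_lipschitzOnWith_integral_inner_deriv zero_le_one hA hγ hmc
  set Φ : ℝ × Space d → ℂ := fun z ↦ Complex.exp (Complex.I * (z.1 : ℂ)) * V z.2 with hΦ
  set Θ : ℝ → ℂ := Φ ∘ fun s ↦ (θ s, γ s) with hΘ
  have hderiv : ∀ᵐ t, t ∈ Ioo (0 : ℝ) 1 → ∀ f', HasDerivAt Θ f' t →
      ‖f'‖ₑ ≤ K * ‖covariantGradient A V (grad V) (γ t)‖ₑ := by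
    filter_upwards [hγ.ae_differentiableWithinAt_of_mem, hint.ae_hasDerivAt_integral]
      with t h1 h2 ht f' hf'
    have htI := Ioo_subset_Icc_self ht
    have hd : HasDerivAt γ (deriv γ t) t :=
      ((h1 htI).differentiableAt (Icc_mem_nhds ht.1 ht.2)).hasDerivAt
    have hdθ : HasDerivAt θ (ψ t) t := by
      refine h2 ?_ 0 ?_
      · rw [uIcc_of_le zero_le_one]; exact htI
      · simp
    have hΩt : Ω ∈ 𝓝 (γ t) := hΩ.mem_nhds (hmaps ⟨ht.1, ht.2.le⟩)
    have hdV : HasFDerivAt V (fderiv ℝ V (γ t)) (γ t) :=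
      ((hV.contDiffAt hΩt).differentiableAt one_ne_zero).hasFDerivAt
    have hdVγ : HasDerivAt (fun s ↦ V (γ s)) (fderiv ℝ V (γ t) (deriv γ t)) t :=
      hdV.comp_hasDerivAt t hd
    have hde : HasDerivAt (fun s ↦ Complex.exp (Complex.I * (θ s : ℂ)))
        (Complex.exp (Complex.I * (θ t : ℂ)) * (Complex.I * (ψ t : ℂ))) t :=
      (hdθ.ofReal_comp.const_mul Complex.I).cexp
    have hdΘ := hde.mul hdVγ
    have hEq : f' = Complex.exp (Complex.I * (θ t : ℂ)) *
        (fderiv ℝ V (γ t) (deriv γ t) + Complex.I * (ψ t : ℂ) * V (γ t)) := by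
      rw [hf'.unique hdΘ]; ring
    have hne : ‖Complex.exp (Complex.I * (θ t : ℂ))‖ = 1 := by
      rw [mul_comm]; exact Complex.norm_exp_ofReal_mul_I _
    have hb : ‖f'‖ ≤ ‖covariantGradient A V (grad V) (γ t)‖ * K := by
      rw [hEq, norm_mul, hne, one_mul]
      refine (norm_fderiv_add_mul_le A V (γ t) (deriv γ t)).trans ?_
      exact mul_le_mul_of_nonneg_left (norm_deriv_le_of_lipschitzOnWith_Icc hγ ht) (norm_nonneg _)
    rw [mul_comm, ← enorm_norm f', ← enorm_norm (covariantGradient _ _ _ _)]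
    rw [Real.enorm_of_nonneg (norm_nonneg _), Real.enorm_of_nonneg (norm_nonneg _)]
    refine (ENNReal.ofReal_le_ofReal hb).trans ?_
    rw [ENNReal.ofReal_mul (norm_nonneg _), ENNReal.ofReal_coe_nnreal]
  -- the estimate away from the starting point
  have hε : ∀ ε ∈ Ioo (0 : ℝ) 1, ‖Θ 1 - Θ ε‖ₑ ≤
      K * ∫⁻ t in Ioo (0 : ℝ) 1, ‖covariantGradient A V (grad V) (γ t)‖ₑ := by
    intro ε hε
    have hsub : Icc ε 1 ⊆ Icc 0 1 := Icc_subset_Icc_left hε.1.le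
    have hpair : LipschitzOnWith (max L K) (fun s ↦ (θ s, γ s)) (Icc ε 1) :=
      (hL.mono hsub).prodMk (hγ.mono hsub)
    obtain ⟨K', hK'⟩ := exists_lipschitzOnWith_comp (Φ := Φ) hpair (by
      intro t ht
      have hΩt : Ω ∈ 𝓝 (γ t) := hΩ.mem_nhds (hmaps ⟨hε.1.trans_le ht.1, ht.2⟩)
      have hcd : ContDiffAt ℝ 1 Φ (θ t, γ t) := by
        have h2 : ContDiffAt ℝ 1 (fun z : ℝ × Space d ↦ V z.2) (θ t, γ t) :=
          (hV.contDiffAt hΩt).comp (θ t, γ t) contDiffAt_snd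
        refine ContDiffAt.mul ?_ h2
        refine ContDiffAt.cexp (contDiffAt_const.mul ?_)
        exact (Complex.ofRealCLM.contDiff.comp contDiff_fst).contDiffAt
      obtain ⟨L', s, hs, h⟩ := hcd.exists_lipschitzOnWith
      exact ⟨L', s, hs, h⟩)
    refine (enorm_sub_le_lintegral_of_lipschitzOnWith hε.2.le hK'
      (g := fun t ↦ K * ‖covariantGradient A V (grad V) (γ t)‖ₑ) ?_).trans ?_
    · filter_upwards [hderiv] with t ht htm
      exact ht ⟨hε.1.trans htm.1, htm.2⟩
    · rw [lintegral_const_mul' _ _ ENNReal.coe_ne_top]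
      gcongr
      exact hε.1.le
  have hcont : ContinuousOn Θ (Icc 0 1) := by
    have h1 : ContinuousOn (fun s ↦ V (γ s)) (Icc 0 1) := hVc.comp hγ.continuousOn hmc
    have h2 : ContinuousOn (fun s ↦ Complex.exp (Complex.I * (θ s : ℂ))) (Icc 0 1) :=
      (continuousOn_const.mul (Complex.continuous_ofReal.comp_continuousOn hL.continuousOn)).cexp
    exact h2.mul h1
  have htend : Tendsto Θ (𝓝[>] 0) (𝓝 (Θ 0)) :=
    ((hcont 0 (by simp)).mono_left
      (nhdsWithin_le_of_mem (mem_of_superset (Ioo_mem_nhdsGT zero_lt_one) Ioo_subset_Icc_self)))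
  have hΘ0 : Θ 0 = V (γ 0) := by simp [hΘ, hΦ, hθ]
  have hΘ1 : Θ 1 = Complex.exp (Complex.I * ((∫ t in (0 : ℝ)..1, ψ t : ℝ) : ℂ)) * V (γ 1) := rfl
  rw [← hΘ0, ← hΘ1]
  refine le_of_tendsto ((tendsto_const_nhds.sub htend).enorm) ?_
  filter_upwards [Ioo_mem_nhdsGT (zero_lt_one' ℝ)] with ε h using hε ε h

/-! ### The radial gauge and the magnetic flux -/

/-- The line integral of `A` along the segment from `w` to `q`. On a set that is star-shaped about
`w`, this is the potential of the homotopy formula: its differential is `A` up to a term that is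
controlled by the exterior derivative of `A`. -/
def radialPotential {d : ℕ} (A : Space d → Space d) (w q : Space d) : ℝ :=
  ∫ τ in (0 : ℝ)..1, (inner ℝ (A (w + τ • (q - w))) (q - w) : ℝ)

/-- The exterior derivative `dA(v, w) = (DA v) · w - (DA w) · v` of `A` is at most `β` on `Ω`. -/
def CurlBoundOn {d : ℕ} (Ω : Set (Space d)) (A : Space d → Space d) (β : ℝ≥0) : Prop :=
  ∀ x ∈ Ω, ∀ v w : Space d,
    |(inner ℝ (fderiv ℝ A x v) w : ℝ) - inner ℝ (fderiv ℝ A x w) v| ≤ β * ‖v‖ * ‖w‖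

/-- Differentiation under the integral sign: the radial potential is differentiable at the points
`q` whose segment to `w` lies in `Ω`, and these points form an open set. -/
theorem hasFDerivAt_radialPotential {d : ℕ} {Ω : Set (Space d)} (hΩ : IsOpen Ω)
    {A : Space d → Space d} (hA : ContDiffOn ℝ 1 A Ω) {w q : Space d}
    (hseg : ∀ τ ∈ Icc (0 : ℝ) 1, w + τ • (q - w) ∈ Ω) :
    HasFDerivAt (radialPotential A w)
      (∫ τ in (0 : ℝ)..1, (τ • (innerSL ℝ (q - w)).comp (fderiv ℝ A (w + τ • (q - w))) +
        innerSL ℝ (A (w + τ • (q - w))))) q ∧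
    IntervalIntegrable (fun τ : ℝ ↦ τ • (innerSL ℝ (q - w)).comp (fderiv ℝ A (w + τ • (q - w))) +
        innerSL ℝ (A (w + τ • (q - w)))) volume 0 1 ∧
    (fun q' ↦ ∀ τ ∈ Icc (0 : ℝ) 1, w + τ • (q' - w) ∈ Ω) ∈ 𝓝 q := by
  set S : Set (Space d) := (fun τ : ℝ ↦ w + τ • (q - w)) '' Icc 0 1 with hS
  have hcS : IsCompact S := isCompact_Icc.image (by fun_prop)
  have hSΩ : S ⊆ Ω := by rintro _ ⟨τ, hτ, rfl⟩; exact hseg τ hτ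
  obtain ⟨δ, hδ, hthick⟩ := hcS.exists_cthickening_subset_open hΩ hSΩ
  have hcomp : IsCompact (Metric.cthickening δ S) := hcS.cthickening
  have hmem : ∀ q' ∈ Metric.ball q δ, ∀ τ ∈ Icc (0 : ℝ) 1,
      w + τ • (q' - w) ∈ Metric.cthickening δ S := by
    intro q' hq' τ hτ
    refine Metric.mem_cthickening_of_dist_le _ (w + τ • (q - w)) δ S ⟨τ, hτ, rfl⟩ ?_
    rw [dist_add_left, dist_eq_norm, ← smul_sub, sub_sub_sub_cancel_right, norm_smul,
      Real.norm_of_nonneg hτ.1]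
    have h1 : ‖q' - q‖ < δ := by rwa [← dist_eq_norm]
    nlinarith [norm_nonneg (q' - q), hτ.1, hτ.2]
  have hfd : ContinuousOn (fderiv ℝ A) Ω := hA.continuousOn_fderiv_of_isOpen hΩ le_rfl
  obtain ⟨M₁, hM₁⟩ := hcomp.exists_bound_of_continuousOn (hA.continuousOn.mono hthick)
  obtain ⟨M₂, hM₂⟩ := hcomp.exists_bound_of_continuousOn (hfd.mono hthick)
  have hcontA : ContinuousOn (fun τ : ℝ ↦ A (w + τ • (q - w))) (Icc 0 1) :=
    hA.continuousOn.comp (by fun_prop) hseg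
  have hcontD : ContinuousOn (fun τ : ℝ ↦ fderiv ℝ A (w + τ • (q - w))) (Icc 0 1) :=
    hfd.comp (by fun_prop) hseg
  have hF' : ContinuousOn (fun τ : ℝ ↦
      τ • (innerSL ℝ (q - w)).comp (fderiv ℝ A (w + τ • (q - w))) +
        innerSL ℝ (A (w + τ • (q - w)))) (Icc 0 1) := by
    refine (continuousOn_id.smul (continuousOn_const.clm_comp hcontD)).add ?_
    exact (innerSL ℝ).continuous.comp_continuousOn hcontA
  have hF'i : IntervalIntegrable (fun τ : ℝ ↦
      τ • (innerSL ℝ (q - w)).comp (fderiv ℝ A (w + τ • (q - w))) +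
        innerSL ℝ (A (w + τ • (q - w)))) volume 0 1 :=
    (hF'.mono (by rw [uIcc_of_le zero_le_one])).intervalIntegrable
  refine ⟨?_, hF'i, ?_⟩
  · have hball : Metric.ball q δ ∈ 𝓝 q := Metric.ball_mem_nhds q hδ
    have hFc : ∀ q' ∈ Metric.ball q δ, ContinuousOn
        (fun τ : ℝ ↦ (inner ℝ (A (w + τ • (q' - w))) (q' - w) : ℝ)) (uIcc 0 1) := by
      intro q' hq'
      rw [uIcc_of_le zero_le_one]
      refine ContinuousOn.inner (hA.continuousOn.comp (by fun_prop) ?_) continuousOn_const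
      exact fun τ hτ ↦ hthick (hmem q' hq' τ hτ)
    refine intervalIntegral.hasFDerivAt_integral_of_dominated_of_fderiv_le
      (F := fun q' τ ↦ (inner ℝ (A (w + τ • (q' - w))) (q' - w) : ℝ))
      (F' := fun q' τ ↦ τ • (innerSL ℝ (q' - w)).comp (fderiv ℝ A (w + τ • (q' - w))) +
        innerSL ℝ (A (w + τ • (q' - w))))
      (bound := fun _ ↦ (‖q - w‖ + δ) * M₂ + M₁) hball ?_ ?_ ?_ ?_ ?_ ?_
    · filter_upwards [hball] with q' hq'
      exact ((hFc q' hq').mono uIoc_subset_uIcc).aestronglyMeasurable measurableSet_uIoc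
    · exact (hFc q (Metric.mem_ball_self hδ)).intervalIntegrable
    · exact (intervalIntegrable_iff.1 hF'i).aestronglyMeasurable
    · refine Eventually.of_forall fun τ hτ q' hq' ↦ ?_
      rw [uIoc_of_le zero_le_one] at hτ
      have hτ' := Ioc_subset_Icc_self hτ
      have hm := hmem q' hq' τ hτ'
      have hq'w : ‖q' - w‖ ≤ ‖q - w‖ + δ := by
        have : ‖q' - q‖ < δ := by rwa [← dist_eq_norm]
        calc ‖q' - w‖ = ‖(q' - q) + (q - w)‖ := by congr 1; abel
          _ ≤ _ := by linarith [norm_add_le (q' - q) (q - w)]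
      refine (norm_add_le _ _).trans ?_
      refine add_le_add ?_ ?_
      · rw [norm_smul, Real.norm_of_nonneg hτ'.1]
        have h1 := (innerSL ℝ (q' - w)).opNorm_comp_le (fderiv ℝ A (w + τ • (q' - w)))
        rw [innerSL_apply_norm] at h1
        have h2 := mul_le_mul hq'w (hM₂ _ hm) (norm_nonneg _) (by positivity)
        have h3 := norm_nonneg ((innerSL ℝ (q' - w)).comp (fderiv ℝ A (w + τ • (q' - w))))
        nlinarith [hτ'.2]
      · rw [innerSL_apply_norm]; exact hM₁ _ hm
    · exact intervalIntegrable_const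
    · refine Eventually.of_forall fun τ hτ q' hq' ↦ ?_
      rw [uIoc_of_le zero_le_one] at hτ
      have hm := hthick (hmem q' hq' τ (Ioc_subset_Icc_self hτ))
      have hdA : HasFDerivAt A (fderiv ℝ A (w + τ • (q' - w))) (w + τ • (q' - w)) :=
        ((hA.contDiffAt (hΩ.mem_nhds hm)).differentiableAt one_ne_zero).hasFDerivAt
      have h1 : HasFDerivAt (fun x : Space d ↦ x - w) (ContinuousLinearMap.id ℝ (Space d)) q' :=
        (hasFDerivAt_id q').sub_const w
      have h2 : HasFDerivAt (fun x : Space d ↦ w + τ • (x - w))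
          (τ • ContinuousLinearMap.id ℝ (Space d)) q' := (h1.const_smul τ).const_add w
      have h3 := (hdA.comp q' h2).inner ℝ h1
      refine h3.congr_fderiv ?_
      ext v
      simp [fderivInnerCLM_apply, real_inner_comm, add_comm, inner_smul_left, inner_sub_left]
  · exact mem_of_superset (Metric.ball_mem_nhds q hδ) fun q' hq' τ hτ ↦ hthick (hmem q' hq' τ hτ)

/-- The homotopy formula `d (radialPotential A w) - A = ∫₀¹ τ dA(w + τ (q - w))(q - w, ·) dτ`, as a
bound: the differential of the radial potential is `A`, up to the exterior derivative of `A` times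
the distance to the centre. -/
theorem abs_fderiv_radialPotential_sub_le {d : ℕ} {Ω : Set (Space d)} (hΩ : IsOpen Ω)
    {A : Space d → Space d} (hA : ContDiffOn ℝ 1 A Ω) {β : ℝ≥0} (hβ : CurlBoundOn Ω A β)
    {w q : Space d} (hseg : ∀ τ ∈ Icc (0 : ℝ) 1, w + τ • (q - w) ∈ Ω) (v : Space d) :
    |fderiv ℝ (radialPotential A w) q v - inner ℝ (A q) v| ≤ β * ‖q - w‖ * ‖v‖ := by
  obtain ⟨h1, h2, -⟩ := hasFDerivAt_radialPotential hΩ hA hseg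
  have hdA : ∀ τ ∈ Icc (0 : ℝ) 1,
      HasDerivAt (fun τ : ℝ ↦ τ * (inner ℝ (A (w + τ • (q - w))) v : ℝ))
        ((inner ℝ (A (w + τ • (q - w))) v : ℝ) +
          τ * inner ℝ (fderiv ℝ A (w + τ • (q - w)) (q - w)) v) τ := by
    intro τ hτ
    have hd : HasFDerivAt A (fderiv ℝ A (w + τ • (q - w))) (w + τ • (q - w)) :=
      ((hA.contDiffAt (hΩ.mem_nhds (hseg τ hτ))).differentiableAt one_ne_zero).hasFDerivAt
    have h3 : HasDerivAt (fun τ : ℝ ↦ w + τ • (q - w)) (q - w) τ := by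
      simpa using ((hasDerivAt_id τ).smul_const (q - w)).const_add w
    have h4 := (hd.comp_hasDerivAt τ h3).inner ℝ (hasDerivAt_const τ v)
    simpa [add_comm] using (hasDerivAt_id' τ).fun_mul h4
  have hcont : ContinuousOn (fun τ : ℝ ↦ (inner ℝ (A (w + τ • (q - w))) v : ℝ) +
          τ * inner ℝ (fderiv ℝ A (w + τ • (q - w)) (q - w)) v) (uIcc 0 1) := by
    rw [uIcc_of_le zero_le_one]
    have hcA : ContinuousOn (fun τ : ℝ ↦ A (w + τ • (q - w))) (Icc 0 1) :=
      hA.continuousOn.comp (by fun_prop) hseg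
    have hcD : ContinuousOn (fun τ : ℝ ↦ fderiv ℝ A (w + τ • (q - w))) (Icc 0 1) :=
      (hA.continuousOn_fderiv_of_isOpen hΩ le_rfl).comp (by fun_prop) hseg
    refine (hcA.inner continuousOn_const).add (continuousOn_id.mul ?_)
    exact (hcD.clm_apply continuousOn_const).inner continuousOn_const
  have h5 := intervalIntegral.integral_eq_sub_of_hasDerivAt
    (fun τ hτ ↦ hdA τ (by rwa [uIcc_of_le zero_le_one] at hτ)) hcont.intervalIntegrable
  have h6 : (inner ℝ (A q) v : ℝ) = ∫ τ in (0 : ℝ)..1,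
      ((inner ℝ (A (w + τ • (q - w))) v : ℝ) +
          τ * inner ℝ (fderiv ℝ A (w + τ • (q - w)) (q - w)) v) := by
    rw [h5]; simp
  rw [h1.fderiv, ContinuousLinearMap.intervalIntegral_apply h2, h6,
    ← intervalIntegral.integral_sub _ hcont.intervalIntegrable]
  · rw [← Real.norm_eq_abs]
    refine (intervalIntegral.norm_integral_le_of_norm_le_const (C := β * ‖q - w‖ * ‖v‖) ?_).trans
      (by simp)
    intro τ hτ
    rw [uIoc_of_le zero_le_one] at hτ
    have hb := hβ _ (hseg τ (Ioc_subset_Icc_self hτ)) v (q - w)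
    have hid : ((τ • (innerSL ℝ (q - w)).comp (fderiv ℝ A (w + τ • (q - w))) +
        innerSL ℝ (A (w + τ • (q - w)))) v : ℝ) - ((inner ℝ (A (w + τ • (q - w))) v : ℝ) +
          τ * inner ℝ (fderiv ℝ A (w + τ • (q - w)) (q - w)) v) =
        τ * ((inner ℝ (fderiv ℝ A (w + τ • (q - w)) v) (q - w) : ℝ) -
          inner ℝ (fderiv ℝ A (w + τ • (q - w)) (q - w)) v) := by
      simp only [add_apply, smul_apply,
        ContinuousLinearMap.comp_apply, innerSL_apply_apply, smul_eq_mul]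
      rw [real_inner_comm (q - w) (fderiv ℝ A (w + τ • (q - w)) v)]
      ring
    rw [hid, norm_mul, Real.norm_of_nonneg hτ.1.le, Real.norm_eq_abs]
    have h7 := abs_nonneg ((inner ℝ (fderiv ℝ A (w + τ • (q - w)) v) (q - w) : ℝ) -
          inner ℝ (fderiv ℝ A (w + τ • (q - w)) (q - w)) v)
    nlinarith [hτ.2]
  · exact ⟨(ContinuousLinearMap.apply ℝ ℝ v).integrable_comp h2.1,
      (ContinuousLinearMap.apply ℝ ℝ v).integrable_comp h2.2⟩

/-- The flux estimate for a curve inside `Ω`, in a region that is star-shaped about `w`. -/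
theorem abs_lineIntegral_sub_radialPotential_le_of_mapsTo {d : ℕ} {Ω : Set (Space d)}
    (hΩ : IsOpen Ω) {A : Space d → Space d} (hA : ContDiffOn ℝ 1 A Ω) {β : ℝ≥0}
    (hβ : CurlBoundOn Ω A β) {w : Space d} {γ : ℝ → Space d} {K D : ℝ≥0}
    (hγ : LipschitzOnWith K γ (Icc 0 1))
    (hseg : ∀ t ∈ Icc (0 : ℝ) 1, ∀ τ ∈ Icc (0 : ℝ) 1, w + τ • (γ t - w) ∈ Ω)
    (hD : ∀ t ∈ Icc (0 : ℝ) 1, ‖γ t - w‖ ≤ D) :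
    |(∫ t in (0 : ℝ)..1, (inner ℝ (A (γ t)) (deriv γ t) : ℝ)) -
      (radialPotential A w (γ 1) - radialPotential A w (γ 0))| ≤ β * D * K := by
  have hmaps : MapsTo γ (Icc 0 1) Ω := fun t ht ↦ by simpa using hseg t ht 1 (by simp)
  set ψ : ℝ → ℝ := fun t ↦ inner ℝ (A (γ t)) (deriv γ t) with hψ
  have hint : IntervalIntegrable ψ volume 0 1 :=
    intervalIntegrable_inner_deriv zero_le_one hA.continuousOn hγ hmaps
  obtain ⟨L, hL⟩ := exists_lipschitzOnWith_integral_inner_deriv zero_le_one hA.continuousOn hγ hmaps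
  obtain ⟨L', hL'⟩ := exists_lipschitzOnWith_comp (Φ := radialPotential A w) hγ (by
    intro t ht
    obtain ⟨-, -, h3⟩ := hasFDerivAt_radialPotential hΩ hA (hseg t ht)
    have hcA : ContinuousAt A (γ t) := hA.continuousOn.continuousAt (hΩ.mem_nhds (hmaps ht))
    have h4 : ∀ᶠ q in 𝓝 (γ t), ‖A q‖ < ‖A (γ t)‖ + 1 :=
      hcA.norm.eventually (gt_mem_nhds (by linarith))
    have h5 : ∀ᶠ q in 𝓝 (γ t), ‖q - w‖ < ‖γ t - w‖ + 1 :=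
      (continuousAt_id.sub continuousAt_const).norm.eventually (gt_mem_nhds (by simp))
    obtain ⟨δ, hδ, hball⟩ := Metric.eventually_nhds_iff_ball.1 ((h4.and h5).and h3)
    set C : ℝ := β * (‖γ t - w‖ + 1) + (‖A (γ t)‖ + 1) with hC
    have hC0 : 0 ≤ C := by positivity
    refine ⟨C.toNNReal, Metric.ball (γ t) δ, Metric.ball_mem_nhds _ hδ, ?_⟩
    refine Convex.lipschitzOnWith_of_nnnorm_fderiv_le (𝕜 := ℝ) ?_ ?_ (convex_ball _ _)
    · intro q hq
      exact (hasFDerivAt_radialPotential hΩ hA (hball q hq).2).1.differentiableAt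
    · intro q hq
      rw [← NNReal.coe_le_coe, coe_nnnorm, Real.coe_toNNReal _ hC0]
      refine ContinuousLinearMap.opNorm_le_bound _ hC0 fun v ↦ ?_
      have hb := abs_fderiv_radialPotential_sub_le hΩ hA hβ (hball q hq).2 v
      have hi := abs_real_inner_le_norm (A q) v
      obtain ⟨⟨hq1, hq2⟩, -⟩ := hball q hq
      rw [Real.norm_eq_abs, hC]
      have e1 : |fderiv ℝ (radialPotential A w) q v| ≤
          |fderiv ℝ (radialPotential A w) q v - inner ℝ (A q) v| + |(inner ℝ (A q) v : ℝ)| := by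
        simpa using abs_add_le (fderiv ℝ (radialPotential A w) q v - inner ℝ (A q) v)
          (inner ℝ (A q) v : ℝ)
      have e2 : (β : ℝ) * ‖q - w‖ * ‖v‖ ≤ β * (‖γ t - w‖ + 1) * ‖v‖ := by gcongr
      have e3 : ‖A q‖ * ‖v‖ ≤ (‖A (γ t)‖ + 1) * ‖v‖ := by gcongr
      linarith)
  have hsub := hL.sub hL'
  have key := enorm_sub_le_lintegral_of_lipschitzOnWith zero_le_one hsub
    (g := fun _ ↦ ENNReal.ofReal (β * D * K)) (by
      filter_upwards [hγ.ae_differentiableWithinAt_of_mem, hint.ae_hasDerivAt_integral]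
        with t h1 h2 ht f' hf'
      have htI := Ioo_subset_Icc_self ht
      have hd : HasDerivAt γ (deriv γ t) t :=
        ((h1 htI).differentiableAt (Icc_mem_nhds ht.1 ht.2)).hasDerivAt
      have hdθ : HasDerivAt (fun s ↦ ∫ t in (0 : ℝ)..s, ψ t) (ψ t) t := by
        refine h2 ?_ 0 ?_
        · rw [uIcc_of_le zero_le_one]; exact htI
        · simp
      have hdf : HasDerivAt (radialPotential A w ∘ γ)
          (fderiv ℝ (radialPotential A w) (γ t) (deriv γ t)) t :=
        (hasFDerivAt_radialPotential hΩ hA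
          (hseg t htI)).1.differentiableAt.hasFDerivAt.comp_hasDerivAt t hd
      have hu := hf'.unique (hdθ.sub hdf)
      rw [Real.enorm_eq_ofReal_abs]
      refine ENNReal.ofReal_le_ofReal ?_
      rw [hu, abs_sub_comm]
      refine (abs_fderiv_radialPotential_sub_le hΩ hA hβ (hseg t htI) _).trans ?_
      have e1 := hD t htI
      have e2 := norm_deriv_le_of_lipschitzOnWith_Icc hγ ht
      gcongr)
  simp only [Function.comp_apply, intervalIntegral.integral_same, zero_sub,
    lintegral_const, MeasurableSet.univ, Measure.restrict_apply, univ_inter, Real.volume_Ioo,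
    sub_zero, ENNReal.ofReal_one, mul_one] at key
  rw [Real.enorm_eq_ofReal_abs, ENNReal.ofReal_le_ofReal_iff (by positivity)] at key
  convert key using 2
  ring

/-- A bound for the essential supremum of the exterior derivative of a `C¹` field on an open set
holds at every point, by continuity. -/
theorem curlBoundOn_of_eLpNorm_magneticField_le {d : ℕ} {Ω : Set (Space d)} (hΩ : IsOpen Ω)
    {A : Space d → Space d} (hA : ContDiffOn ℝ 1 A Ω) {β : ℝ≥0}
    (hβ : eLpNorm (magneticField A) ∞ (volume.restrict Ω) ≤ β) : CurlBoundOn Ω A β := by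
  intro x hx v w
  have hdiff : ∀ z ∈ Ω, DifferentiableAt ℝ A z := fun z hz ↦
    (hA.contDiffAt (hΩ.mem_nhds hz)).differentiableAt one_ne_zero
  set k : Space d → ℝ := fun x ↦
    |(inner ℝ (fderiv ℝ A x v) w : ℝ) - inner ℝ (fderiv ℝ A x w) v| with hk
  have hform : ∀ z ∈ Ω, k z ≤ ‖magneticField A z‖ * ‖v‖ * ‖w‖ := by
    intro z hz
    have hω : DifferentiableAt ℝ (fun z ↦ ContinuousAlternatingMap.ofSubsingleton ℝ (Space d) ℝ
        (0 : Fin 1) (innerSL ℝ (A z))) z := by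
      have h1 : DifferentiableAt ℝ (fun z ↦ innerSL ℝ (A z)) z :=
        (innerSL ℝ).differentiableAt.comp z (hdiff z hz)
      exact (ContinuousAlternatingMap.ofSubsingletonLIE (𝕜 := ℝ) (E := Space d) (F := ℝ)
        (0 : Fin 1)).toContinuousLinearEquiv.differentiableAt.comp z h1
    have hinner : ∀ u u' : Space d,
        fderiv ℝ (fun z ↦ (inner ℝ (A z) u : ℝ)) z u' = inner ℝ (fderiv ℝ A z u') u := by
      intro u u'
      have := ((hdiff z hz).hasFDerivAt.inner ℝ (hasFDerivAt_const u z)).fderiv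
      rw [this]; simp [fderivInnerCLM_apply]
    have hval : magneticField A z ![v, w] =
        (inner ℝ (fderiv ℝ A z v) w : ℝ) - inner ℝ (fderiv ℝ A z w) v := by
      rw [magneticField, extDeriv_apply hω, Fin.sum_univ_two]
      simp only [ContinuousAlternatingMap.ofSubsingleton_apply_apply, innerSL_apply_apply]
      rw [hinner, hinner]
      simp [Fin.removeNth_apply, Fin.succAbove, sub_eq_add_neg]
    rw [hk]
    simp only
    rw [← hval, ← Real.norm_eq_abs, mul_assoc]
    simpa [Fin.prod_univ_two] using (magneticField A z).le_opNorm ![v, w]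
  have hcont : ContinuousOn k Ω := by
    have hfd := hA.continuousOn_fderiv_of_isOpen hΩ le_rfl
    exact (((hfd.clm_apply continuousOn_const).inner continuousOn_const).sub
      ((hfd.clm_apply continuousOn_const).inner continuousOn_const)).abs
  by_contra hlt
  push Not at hlt
  have hopen : IsOpen (Ω ∩ k ⁻¹' Ioi (β * ‖v‖ * ‖w‖)) := hcont.isOpen_inter_preimage hΩ isOpen_Ioi
  have hpos := hopen.measure_pos volume ⟨x, hx, hlt⟩
  have hae := ae_le_eLpNormEssSup (f := magneticField A) (μ := volume.restrict Ω)
  rw [eLpNorm_exponent_top] at hβ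
  rw [ae_restrict_iff' hΩ.measurableSet] at hae
  refine hpos.ne' (measure_mono_null ?_ (ae_iff.1 hae))
  rintro z ⟨hz, hz'⟩ hcon
  have h1 : ‖magneticField A z‖ ≤ β := by
    have := (hcon hz).trans hβ
    rw [← enorm_norm, Real.enorm_of_nonneg (norm_nonneg _), ← ENNReal.ofReal_coe_nnreal] at this
    exact (ENNReal.ofReal_le_ofReal_iff β.2).1 this
  have h2 := hform z hz
  have h3 : ‖magneticField A z‖ * ‖v‖ * ‖w‖ ≤ β * ‖v‖ * ‖w‖ := by gcongr
  exact absurd (h2.trans h3) (not_le.2 hz')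

/-- Continuity at the end point of an integral depending on a parameter. -/
theorem tendsto_integral_inner_nhdsGT {H : Type*} [NormedAddCommGroup H] [InnerProductSpace ℝ H]
    {F : ℝ → ℝ → H} {ψ : ℝ → H} {c K : ℝ} (hc : 0 < c)
    (hF : ContinuousOn (fun z : ℝ × ℝ ↦ F z.1 z.2) (Icc 0 c ×ˢ Icc 0 1))
    (hψ : AEStronglyMeasurable ψ) (hψK : ∀ t ∈ Ioo (0 : ℝ) 1, ‖ψ t‖ ≤ K) :
    Tendsto (fun ε ↦ ∫ t in (0 : ℝ)..1, (inner ℝ (F ε t) (ψ t) : ℝ)) (𝓝[>] 0)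
      (𝓝 (∫ t in (0 : ℝ)..1, (inner ℝ (F 0 t) (ψ t) : ℝ))) := by
  obtain ⟨M, hM⟩ := (isCompact_Icc.prod isCompact_Icc).exists_bound_of_continuousOn hF
  have hmem : Ioo 0 c ∈ 𝓝[>] (0 : ℝ) := Ioo_mem_nhdsGT hc
  refine intervalIntegral.tendsto_integral_filter_of_dominated_convergence (fun _ ↦ M * K)
    ?_ ?_ intervalIntegrable_const ?_
  · filter_upwards [hmem] with ε hε
    have : ContinuousOn (F ε) (Icc 0 1) :=
      hF.comp (f := fun t ↦ (ε, t)) (by fun_prop)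
        fun t ht ↦ ⟨Ioo_subset_Icc_self hε, ht⟩
    rw [uIoc_of_le zero_le_one]
    exact ((this.mono Ioc_subset_Icc_self).aestronglyMeasurable measurableSet_Ioc).inner (𝕜 := ℝ)
      hψ.restrict
  · filter_upwards [hmem] with ε hε
    have hne : ∀ᵐ t : ℝ, t ≠ 1 := by simp [ae_iff]
    filter_upwards [hne] with t ht1 ht
    rw [uIoc_of_le zero_le_one] at ht
    refine (norm_inner_le_norm (𝕜 := ℝ) _ _).trans ?_
    have hb := hM (ε, t) ⟨Ioo_subset_Icc_self hε, Ioc_subset_Icc_self ht⟩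
    exact mul_le_mul hb (hψK t ⟨ht.1, lt_of_le_of_ne ht.2 ht1⟩) (norm_nonneg _)
      ((norm_nonneg _).trans hb)
  · refine Eventually.of_forall fun t ht ↦ ?_
    rw [uIoc_of_le zero_le_one] at ht
    have h1 : ContinuousWithinAt (fun ε ↦ F ε t) (Icc 0 c) 0 :=
      (hF.comp (f := fun ε ↦ (ε, t)) (by fun_prop)
        fun ε hε ↦ ⟨hε, Ioc_subset_Icc_self ht⟩) 0 ⟨le_rfl, hc.le⟩
    have h2 : Tendsto (fun ε ↦ F ε t) (𝓝[>] 0) (𝓝 (F 0 t)) :=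
      h1.mono_left (nhdsWithin_le_of_mem (mem_of_superset hmem Ioo_subset_Icc_self))
    exact h2.inner tendsto_const_nhds

/-- The flux estimate for a curve in the closure of `Ω`: if the translates of the curve by the small
vectors `ε e` lie in a part of `Ω` that is star-shaped about `w`, the line integral of `A` along
the curve is the increment of the radial potential, up to the exterior derivative of `A` times the
area of the cone over the curve. -/
theorem abs_lineIntegral_sub_radialPotential_le {d : ℕ} {Ω : Set (Space d)}
    (hΩ : IsOpen Ω) {A : Space d → Space d} (hA : ContDiffOn ℝ 1 A Ω)
    (hAc : ContinuousOn A (closure Ω)) {β : ℝ≥0}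
    (hβ : CurlBoundOn Ω A β) {w e : Space d} {γ : ℝ → Space d} {K D : ℝ≥0} {c : ℝ} (hc : 0 < c)
    (hγ : LipschitzOnWith K γ (Icc 0 1))
    (hseg : ∀ ε ∈ Ioo 0 c, ∀ t ∈ Icc (0 : ℝ) 1, ∀ τ ∈ Icc (0 : ℝ) 1,
      w + τ • (γ t + ε • e - w) ∈ Ω)
    (hD : ∀ ε ∈ Ioo 0 c, ∀ t ∈ Icc (0 : ℝ) 1, ‖γ t + ε • e - w‖ ≤ D) :
    |(∫ t in (0 : ℝ)..1, (inner ℝ (A (γ t)) (deriv γ t) : ℝ)) -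
      (radialPotential A w (γ 1) - radialPotential A w (γ 0))| ≤ β * D * K := by
  set c' := c / 2 with hc'
  have hc'0 : 0 < c' := by positivity
  have hcl : ∀ ε ∈ Icc 0 c', ∀ t ∈ Icc (0 : ℝ) 1, ∀ τ ∈ Icc (0 : ℝ) 1,
      w + τ • (γ t + ε • e - w) ∈ closure Ω := by
    intro ε hε t ht τ hτ
    have h1 : Tendsto (fun ε' : ℝ ↦ w + τ • (γ t + ε' • e - w)) (𝓝[>] ε)
        (𝓝 (w + τ • (γ t + ε • e - w))) := by
      refine (Continuous.tendsto ?_ ε).mono_left nhdsWithin_le_nhds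
      fun_prop
    refine mem_closure_of_tendsto h1 ?_
    have : ε < c := by linarith [hε.2]
    filter_upwards [Ioo_mem_nhdsGT this] with ε' hε'
    exact hseg ε' ⟨hε.1.trans_lt hε'.1, hε'.2⟩ t ht τ hτ
  have hline : Tendsto (fun ε : ℝ ↦ ∫ t in (0 : ℝ)..1,
      (inner ℝ (A (γ t + ε • e)) (deriv γ t) : ℝ)) (𝓝[>] 0)
      (𝓝 (∫ t in (0 : ℝ)..1, (inner ℝ (A (γ t + (0 : ℝ) • e)) (deriv γ t) : ℝ))) := by
    refine tendsto_integral_inner_nhdsGT (F := fun ε t ↦ A (γ t + ε • e)) (K := K) hc'0 ?_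
      (stronglyMeasurable_deriv γ).aestronglyMeasurable
      (fun t ht ↦ norm_deriv_le_of_lipschitzOnWith_Icc hγ ht)
    refine hAc.comp ?_ ?_
    · exact (hγ.continuousOn.comp continuousOn_snd fun z hz ↦ hz.2).add
        (continuousOn_fst.smul continuousOn_const)
    · rintro ⟨ε, t⟩ ⟨hε, ht⟩
      simpa using hcl ε hε t ht 1 (by simp)
  have hrad : ∀ t ∈ Icc (0 : ℝ) 1,
      Tendsto (fun ε : ℝ ↦ radialPotential A w (γ t + ε • e)) (𝓝[>] 0)
        (𝓝 (radialPotential A w (γ t + (0 : ℝ) • e))) := by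
    intro t ht
    have := tendsto_integral_inner_nhdsGT (H := ℝ) (ψ := fun _ ↦ 1) (K := 1) (c := c')
      (F := fun ε τ ↦ inner ℝ (A (w + τ • (γ t + ε • e - w))) (γ t + ε • e - w)) hc'0 (by
        refine ContinuousOn.inner (hAc.comp (by fun_prop) ?_) (by fun_prop)
        rintro ⟨ε, τ⟩ ⟨hε, hτ⟩
        exact hcl ε hε t ht τ hτ) aestronglyMeasurable_const (by simp)
    simpa [radialPotential] using this
  have htot := (hline.sub ((hrad 1 (by simp)).sub (hrad 0 (by simp)))).abs
  simp only [zero_smul, add_zero] at htot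
  refine le_of_tendsto htot ?_
  filter_upwards [Ioo_mem_nhdsGT hc] with ε hε
  have hγε : LipschitzOnWith K (fun t ↦ γ t + ε • e) (Icc 0 1) :=
    LipschitzOnWith.of_dist_le_mul fun x hx y hy ↦ by
      simpa using hγ.dist_le_mul x hx y hy
  have := abs_lineIntegral_sub_radialPotential_le_of_mapsTo hΩ hA hβ hγε (hseg ε hε) (hD ε hε)
  simpa only [deriv_add_const] using this

/-! ### Lipschitz graph charts of the boundary -/

/-- Coordinates adapted to a unit vector `e`: the linear parametrization of the space by
`e^⊥ × ℝ`, where the orthogonal complement is identified isometrically with `ℝᵈ`. -/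
theorem exists_orthogonal_coordinates {d : ℕ} {e : Space d} (he : ‖e‖ = 1) :
    ∃ T : (EuclideanSpace ℝ (Fin d) × ℝ) ≃L[ℝ] Space d,
      (∀ x t, ‖T (x, t)‖ ^ 2 = ‖x‖ ^ 2 + t ^ 2) ∧ ∀ x t, (inner ℝ e (T (x, t)) : ℝ) = t := by
  have he0 : e ≠ 0 := by rintro rfl; simp at he
  have : Fact (Module.finrank ℝ (Space d) = d + 1) := ⟨by simp⟩
  set b := OrthonormalBasis.fromOrthogonalSpanSingleton (𝕜 := ℝ) (E := Space d) d he0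
  set ι : EuclideanSpace ℝ (Fin d) →ₗ[ℝ] Space d :=
    (ℝ ∙ e)ᗮ.subtype ∘ₗ (b.repr.symm.toLinearEquiv : EuclideanSpace ℝ (Fin d) →ₗ[ℝ] (ℝ ∙ e)ᗮ)
    with hι
  have hιe : ∀ x, (inner ℝ e (ι x) : ℝ) = 0 := fun x ↦
    Submodule.mem_orthogonal_singleton_iff_inner_right.1 (b.repr.symm x).2
  have hιn : ∀ x, ‖ι x‖ = ‖x‖ := fun x ↦ by
    change ‖((b.repr.symm x : (ℝ ∙ e)ᗮ) : Space d)‖ = ‖x‖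
    exact b.repr.symm.norm_map x
  set f : (EuclideanSpace ℝ (Fin d) × ℝ) →ₗ[ℝ] Space d :=
    ι.coprod (LinearMap.toSpanSingleton ℝ (Space d) e) with hf
  have hfa : ∀ x t, f (x, t) = ι x + t • e := fun x t ↦ by simp [hf]
  have hn : ∀ x t, ‖f (x, t)‖ ^ 2 = ‖x‖ ^ 2 + t ^ 2 := by
    intro x t
    rw [hfa, norm_add_sq_real, hιn, inner_smul_right, real_inner_comm, hιe, norm_smul, he]
    simp
  have hinj : Function.Injective f := by
    rw [injective_iff_map_eq_zero]
    rintro ⟨x, t⟩ h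
    have h1 := hn x t
    rw [h, norm_zero] at h1
    have h2 : ‖x‖ = 0 := by nlinarith [sq_nonneg ‖x‖, sq_nonneg t]
    have h3 : t = 0 := by nlinarith [sq_nonneg ‖x‖, sq_nonneg t]
    rw [norm_eq_zero] at h2
    rw [h2, h3]; rfl
  have hdim : Module.finrank ℝ (EuclideanSpace ℝ (Fin d) × ℝ) = Module.finrank ℝ (Space d) := by
    simp
  refine ⟨(LinearEquiv.ofInjectiveOfFinrankEq f hinj hdim).toContinuousLinearEquiv, fun x t ↦ ?_,
    fun x t ↦ ?_⟩
  · exact hn x t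
  · change (inner ℝ e (f (x, t)) : ℝ) = t
    rw [hfa, inner_add_right, hιe, inner_smul_right, real_inner_self_eq_norm_sq, he]
    simp

/-- The uniform interior cone condition for domains of class `C¹`. -/
theorem exists_interior_cone {d : ℕ} {Ω : Set (Space d)} (hΩ : IsBoundedC1Domain Ω) {z : Space d}
    (hz : z ∈ frontier Ω) :
    ∃ T : (EuclideanSpace ℝ (Fin d) × ℝ) ≃L[ℝ] Space d,
      (∀ x t, ‖T (x, t)‖ ^ 2 = ‖x‖ ^ 2 + t ^ 2) ∧
      ∃ R > 0, ∀ q ∈ closure Ω ∩ Metric.ball z R, ∀ x t, ‖x‖ < t →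
        q + T (x, t) ∈ Metric.ball z R → q + T (x, t) ∈ Ω := by
  obtain ⟨W, ρ, hW, hzW, hρ, hρz, hiff⟩ := hΩ.boundary z hz
  set n : Space d := (InnerProductSpace.toDual ℝ (Space d)).symm (fderiv ℝ ρ z) with hn
  have hn0 : n ≠ 0 := by simpa [hn] using hρz
  have hnpos : 0 < ‖n‖ := norm_pos_iff.2 hn0
  have hL : ∀ v, fderiv ℝ ρ z v = inner ℝ n v := fun v ↦ by
    rw [hn, InnerProductSpace.toDual_symm_apply]
  set e : Space d := -(‖n‖⁻¹ • n) with he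
  have he1 : ‖e‖ = 1 := by
    rw [he, norm_neg, norm_smul, norm_inv, norm_norm, inv_mul_cancel₀ hnpos.ne']
  have hne : n = -(‖n‖ • e) := by
    rw [he, smul_neg, neg_neg, smul_smul, mul_inv_cancel₀ hnpos.ne', one_smul]
  obtain ⟨T, hT, hTe⟩ := exists_orthogonal_coordinates he1
  refine ⟨T, hT, ?_⟩
  have hstrict : HasStrictFDerivAt ρ (fderiv ℝ ρ z) z :=
    (hρ.contDiffAt (hW.mem_nhds hzW)).hasStrictFDerivAt one_ne_zero
  have hev := hstrict.isLittleO.def (show 0 < ‖n‖ / 4 by positivity)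
  obtain ⟨R, hR, hball⟩ := Metric.eventually_nhds_iff_ball.1
    (hev.and ((hW.mem_nhds hzW) |> fun h ↦ (prod_mem_nhds h h :
      W ×ˢ W ∈ 𝓝 (z, z))))
  have hpair : ∀ a ∈ Metric.ball z R, ∀ b ∈ Metric.ball z R, (a, b) ∈ Metric.ball (z, z) R :=
    fun a ha b hb ↦ by rw [← ball_prod_same]; exact ⟨ha, hb⟩
  refine ⟨R, hR, ?_⟩
  rintro q ⟨hqc, hqR⟩ x t hxt hqv
  obtain ⟨h1, h2⟩ := hball _ (hpair _ hqv _ hqR)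
  have hqW : q ∈ W := h2.2
  -- points of the closure have nonpositive values of the defining function
  have hρq : ρ q ≤ 0 := by
    by_contra hpos
    push Not at hpos
    have hc : ContinuousAt ρ q := (hρ.contDiffAt (hW.mem_nhds hqW)).continuousAt
    have hnb := (hc.eventually (lt_mem_nhds hpos)).and (hW.mem_nhds hqW)
    obtain ⟨y, hy, hyΩ⟩ := mem_closure_iff_nhds.1 hqc _ hnb
    exact absurd ((hiff y hy.2).1 hyΩ) (not_lt.2 (le_of_lt hy.1))
  rw [hiff _ h2.1]
  simp only [add_sub_cancel_left] at h1
  rw [hL, hne, inner_neg_left, real_inner_smul_left, hTe, Real.norm_eq_abs] at h1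
  have ht : 0 < t := (norm_nonneg x).trans_lt hxt
  have hTn : ‖T (x, t)‖ ≤ 2 * t := by
    refine abs_le_of_sq_le_sq' ?_ (by positivity) |>.2
    rw [hT]; nlinarith [norm_nonneg x]
  rw [norm_neg, norm_smul, norm_norm, he1, mul_one] at h1
  have h3 := (abs_le.1 h1).2
  have h4 : ‖n‖ / 4 * ‖T (x, t)‖ ≤ ‖n‖ / 4 * (2 * t) := by gcongr
  nlinarith [mul_pos hnpos ht]

/-- A chart near the boundary point `z`, in which `Ω` is the region above the graph of a Lipschitz
function `φ`. The coordinates `T` are linear, with the last coordinate pointing into `Ω`. -/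
structure LipschitzChart {d : ℕ} (Ω : Set (Space d)) (z : Space d) where
  /-- the linear coordinates -/
  T : (EuclideanSpace ℝ (Fin d) × ℝ) ≃L[ℝ] Space d
  /-- the function whose graph is the boundary -/
  φ : EuclideanSpace ℝ (Fin d) → ℝ
  /-- the size of the chart -/
  r : ℝ
  /-- the parameter of the centre -/
  center : EuclideanSpace ℝ (Fin d)
  r_pos : 0 < r
  norm_le : ∀ x t, ‖T (x, t)‖ ≤ ‖x‖ + |t|
  le_norm : ∀ x t, ‖x‖ ≤ ‖T (x, t)‖
  lipschitz : LipschitzWith 1 φ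
  center_eq : T (center, φ center) = z
  above : ∀ x ∈ Metric.ball center r, ∀ s, 0 < s → s ≤ r → T (x, φ x + s) ∈ Ω
  on_frontier : ∀ x ∈ Metric.ball center r, T (x, φ x) ∈ frontier Ω
  graph : ∀ q ∈ frontier Ω, q ∈ Metric.ball z r → T ((T.symm q).1, φ (T.symm q).1) = q

/-- Each vertical line close to `z` meets the boundary, by connectedness; it does so only once, and
the height is a Lipschitz function of the line, by the interior cone condition. -/
theorem nonempty_lipschitzChart {d : ℕ} {Ω : Set (Space d)} (hΩ : IsBoundedC1Domain Ω)
    {z : Space d} (hz : z ∈ frontier Ω) : Nonempty (LipschitzChart Ω z) := by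
  obtain ⟨T, hT, R, hR, hcone⟩ := exists_interior_cone hΩ hz
  have hnle : ∀ x t, ‖T (x, t)‖ ≤ ‖x‖ + |t| := fun x t ↦ by
    refine (abs_le_of_sq_le_sq' ?_ (by positivity)).2
    rw [hT, add_sq, sq_abs]
    nlinarith [mul_nonneg (norm_nonneg x) (abs_nonneg t)]
  have hlen : ∀ x t, ‖x‖ ≤ ‖T (x, t)‖ := fun x t ↦ by
    refine (abs_le_of_sq_le_sq' ?_ (norm_nonneg _)).2
    rw [hT]; nlinarith [sq_nonneg t]
  set x₀ := (T.symm z).1 with hx₀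
  set t₀ := (T.symm z).2 with ht₀
  have hTz : T (x₀, t₀) = z := T.apply_symm_apply z
  set r := R / 8 with hr
  have hr0 : 0 < r := by positivity
  have hΩf : ∀ q ∈ frontier Ω, q ∉ Ω := fun q hq hqΩ ↦ by
    rw [hΩ.isOpen.frontier_eq] at hq
    exact hq.2 hqΩ
  have hfc : ∀ q ∈ frontier Ω, q ∈ closure Ω := fun q hq ↦ frontier_subset_closure hq
  have hnear : ∀ x t, ‖x - x₀‖ + |t - t₀| < R → T (x, t) ∈ Metric.ball z R := by
    intro x t h
    rw [mem_ball_iff_norm, ← hTz, ← map_sub]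
    exact (hnle _ _).trans_lt h
  -- on each vertical line close to `z` there is a boundary point
  have hex : ∀ x ∈ Metric.ball x₀ r, ∃ t, |t - t₀| ≤ 2 * r ∧ T (x, t) ∈ frontier Ω := by
    intro x hx
    rw [mem_ball_iff_norm] at hx
    have htop : T (x, t₀ + 2 * r) ∈ Ω := by
      have h1 : T (x, t₀ + 2 * r) = z + T (x - x₀, 2 * r) := by
        rw [← hTz, ← map_add]; simp
      have h2 : T (x, t₀ + 2 * r) ∈ Metric.ball z R := by
        apply hnear; rw [add_sub_cancel_left, abs_of_pos (by positivity)]; linarith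
      rw [h1] at h2 ⊢
      exact hcone z ⟨hfc z hz, Metric.mem_ball_self hR⟩ _ _ (by linarith) h2
    have hbot : T (x, t₀ - 2 * r) ∉ closure Ω := by
      intro hcl
      have h2 : T (x, t₀ - 2 * r) ∈ Metric.ball z R := by
        apply hnear; rw [sub_sub_cancel_left, abs_neg, abs_of_pos (by positivity)]; linarith
      have h1 : T (x, t₀ - 2 * r) + T (x₀ - x, 2 * r) = z := by
        rw [← hTz, ← map_add]; simp
      refine hΩf z hz ?_
      rw [← h1]
      refine hcone _ ⟨hcl, h2⟩ _ _ (by rw [norm_sub_rev]; linarith) ?_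
      rw [h1]; exact Metric.mem_ball_self hR
    by_contra hcon
    push Not at hcon
    have hpre : IsPreconnected ((fun t ↦ T (x, t)) '' Icc (t₀ - 2 * r) (t₀ + 2 * r)) :=
      isPreconnected_Icc.image _ (by fun_prop)
    obtain ⟨y, -, hy1, hy2⟩ := hpre Ω (closure Ω)ᶜ hΩ.isOpen isClosed_closure.isOpen_compl (by
        rintro _ ⟨t, ht, rfl⟩
        by_contra hn
        simp only [mem_union, mem_compl_iff, not_or, not_not] at hn
        refine hcon t ?_ ?_
        · rw [abs_le]; constructor <;> linarith [ht.1, ht.2]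
        · rw [hΩ.isOpen.frontier_eq]; exact ⟨hn.2, hn.1⟩)
      ⟨_, ⟨_, right_mem_Icc.2 (by linarith), rfl⟩, htop⟩
      ⟨_, ⟨_, left_mem_Icc.2 (by linarith), rfl⟩, hbot⟩
    exact hy2 (subset_closure hy1)
  -- two boundary points cannot be on top of each other, in the sense of the cone
  have hcmp : ∀ x t x' t', T (x, t) ∈ frontier Ω → T (x', t') ∈ frontier Ω →
      T (x, t) ∈ Metric.ball z R → T (x', t') ∈ Metric.ball z R → t - t' ≤ ‖x - x'‖ := by
    intro x t x' t' h1 h2 h3 h4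
    by_contra hlt
    push Not at hlt
    have h5 : T (x', t') + T (x - x', t - t') = T (x, t) := by rw [← map_add]; simp
    refine hΩf _ h1 ?_
    rw [← h5]
    refine hcone _ ⟨hfc _ h2, h4⟩ _ _ hlt ?_
    rwa [h5]
  choose! f hf using hex
  have hfball : ∀ x ∈ Metric.ball x₀ r, T (x, f x) ∈ Metric.ball z R := fun x hx ↦ by
    apply hnear
    have := (hf x hx).1
    rw [mem_ball_iff_norm] at hx
    linarith
  have hfl : LipschitzOnWith 1 f (Metric.ball x₀ r) := by
    refine LipschitzOnWith.of_dist_le_mul fun x hx y hy ↦ ?_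
    rw [NNReal.coe_one, one_mul, Real.dist_eq, dist_eq_norm, abs_le]
    have h1 := hcmp _ _ _ _ (hf x hx).2 (hf y hy).2 (hfball x hx) (hfball y hy)
    have h2 := hcmp _ _ _ _ (hf y hy).2 (hf x hx).2 (hfball y hy) (hfball x hx)
    rw [norm_sub_rev] at h2
    constructor <;> linarith
  obtain ⟨φ, hφ, hφf⟩ := hfl.extend_real
  have hx₀r : x₀ ∈ Metric.ball x₀ r := Metric.mem_ball_self hr0
  have hvert : ∀ x t, T (x, t) ∈ frontier Ω → T (x, t) ∈ Metric.ball z R →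
      x ∈ Metric.ball x₀ r → t = φ x := by
    intro x t h1 h2 h3
    have h4 := hcmp _ _ _ _ h1 (hf x h3).2 h2 (hfball x h3)
    have h5 := hcmp _ _ _ _ (hf x h3).2 h1 (hfball x h3) h2
    rw [← hφf h3]
    simp only [sub_self, norm_zero] at h4 h5
    linarith
  refine ⟨⟨T, φ, r, x₀, hr0, hnle, hlen, hφ, ?_, ?_, ?_, ?_⟩⟩
  · rw [← hvert x₀ t₀ (by rwa [hTz]) (by rw [hTz]; exact Metric.mem_ball_self hR) hx₀r, hTz]
  · intro x hx s hs hsr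
    have h1 : T (x, φ x + s) = T (x, φ x) + T (0, s) := by rw [← map_add]; simp
    have h2 : T (x, φ x + s) ∈ Metric.ball z R := by
      apply hnear
      rw [← hφf hx]
      have h3 := (hf x hx).1
      rw [mem_ball_iff_norm] at hx
      have h4 : |f x + s - t₀| ≤ |f x - t₀| + |s| := by
        rw [add_sub_right_comm]; exact abs_add_le _ _
      rw [abs_of_pos hs] at h4
      linarith
    rw [h1] at h2 ⊢
    rw [← hφf hx] at h2 ⊢
    exact hcone _ ⟨hfc _ (hf x hx).2, hfball x hx⟩ _ _ (by simpa using hs) h2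
  · intro x hx
    rw [← hφf hx]; exact (hf x hx).2
  · intro q hq hqr
    have h1 : T ((T.symm q).1, (T.symm q).2) = q := T.apply_symm_apply q
    have h2 : (T.symm q).1 ∈ Metric.ball x₀ r := by
      rw [mem_ball_iff_norm] at hqr ⊢
      refine lt_of_le_of_lt (hlen _ ((T.symm q).2 - t₀)) ?_
      have : T ((T.symm q).1 - x₀, (T.symm q).2 - t₀) = q - z := by
        rw [← Prod.mk_sub_mk, map_sub, hTz, h1]
      rwa [this]
    rw [← hvert _ (T.symm q).2 (by rwa [h1]) ?_ h2, h1]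
    rw [h1]
    exact Metric.ball_subset_ball (by linarith) hqr

/-! ### Minimizing geodesics of the boundary -/

/-- The velocity of a curve in `S` is tangent to `S`. -/
theorem hasDerivAt_mem_tangentConeAt {d : ℕ} {S : Set (Space d)} {γ : ℝ → Space d} {v : Space d}
    {t : ℝ} (hmaps : MapsTo γ (Icc 0 1) S) (ht : t ∈ Ioo (0 : ℝ) 1) (hd : HasDerivAt γ v t) :
    v ∈ tangentConeAt ℝ S (γ t) := by
  have h1 : (1 : ℝ) ∈ tangentConeAt ℝ (Icc (0 : ℝ) 1) t := by
    rw [tangentConeAt_of_mem_nhds (Icc_mem_nhds ht.1 ht.2)]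
    exact mem_univ _
  have h2 := hd.hasFDerivAt.hasFDerivWithinAt.mapsTo_tangent_cone (s := Icc (0 : ℝ) 1) h1
  have h3 := tangentConeAt_mono (𝕜 := ℝ) (x := γ t) hmaps.image_subset h2
  simpa using h3

/-- Below the injectivity radius, the line integral of the tangential part of `A` along the
minimizing geodesic is the line integral of `A` itself along a Lipschitz curve in `S`. -/
theorem exists_curve_geodesicPotential_eq {d : ℕ} {Ω : Set (Space d)} {A ν : Space d → Space d}
    (hν : ∀ z ∈ frontier Ω, IsUnitNormal Ω z (ν z)) {x y : Space d} (hx : x ∈ frontier Ω)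
    (hy : y ∈ frontier Ω) {K : ℝ≥0}
    (hK : intrinsicDist (frontier Ω) x y ≤ K) (hinj : K < injRadius (frontier Ω)) :
    ∃ γ : ℝ → Space d, LipschitzOnWith K γ (Icc 0 1) ∧ MapsTo γ (Icc 0 1) (frontier Ω) ∧
      γ 0 = x ∧ γ 1 = y ∧
      geodesicPotential (frontier Ω) (tangentialPart ν A) x y =
        ∫ t in (0 : ℝ)..1, (inner ℝ (A (γ t)) (deriv γ t) : ℝ) := by
  obtain ⟨R, hR, hKR⟩ := lt_sSup_iff.1 hinj
  have hex : ∃ γ, IsMinimizingGeodesic (frontier Ω) γ x y := by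
    obtain ⟨γ, hγ, -⟩ := hR x hx y hy (hK.trans_lt hKR)
    exact ⟨γ, hγ⟩
  set γ := hex.choose with hγdef
  have hγ : IsMinimizingGeodesic (frontier Ω) γ x y := hex.choose_spec
  have hlip : LipschitzOnWith K γ (Icc 0 1) := by
    have hle : ∀ s ∈ Icc (0 : ℝ) 1, ∀ t ∈ Icc (0 : ℝ) 1, s ≤ t →
        edist (γ s) (γ t) ≤ K * edist s t := by
      intro s hs t ht hst
      refine (eVariationOn.edist_le γ (s := Icc s t) (left_mem_Icc.2 hst)
        (right_mem_Icc.2 hst)).trans ?_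
      rw [hγ.length s t hs.1 hst ht.2, edist_comm, edist_dist, Real.dist_eq,
        abs_of_nonneg (sub_nonneg.2 hst), mul_comm]
      gcongr
    intro s hs t ht
    rcases le_total s t with h | h
    · exact hle s hs t ht h
    · rw [edist_comm, edist_comm s t]; exact hle t ht s hs h
  refine ⟨γ, hlip, hγ.curve.mapsTo, hγ.curve.source, hγ.curve.target, ?_⟩
  rw [geodesicPotential, dif_pos hex]
  refine intervalIntegral.integral_congr_ae ?_
  have hne : ∀ᵐ t : ℝ, t ≠ 1 := by simp [ae_iff]
  filter_upwards [hlip.ae_differentiableWithinAt_of_mem, hne] with t ht ht1 htm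
  rw [uIoc_of_le zero_le_one] at htm
  have ht' : t ∈ Ioo (0 : ℝ) 1 := ⟨htm.1, lt_of_le_of_ne htm.2 ht1⟩
  have hd : HasDerivAt γ (deriv γ t) t :=
    ((ht (Ioo_subset_Icc_self ht')).differentiableAt (Icc_mem_nhds ht'.1 ht'.2)).hasDerivAt
  have h1 := (hν _ (hγ.curve.mapsTo (Ioo_subset_Icc_self ht'))).2 _
    (hasDerivAt_mem_tangentConeAt hγ.curve.mapsTo ht' hd)
  rw [tangentialPart, inner_sub_left, real_inner_smul_left, h1, mul_zero, sub_zero]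

namespace LipschitzChart

variable {d : ℕ} {Ω : Set (Space d)} {z : Space d}

/-! ### Pointwise estimates in a chart -/

/-- The parametrization of the boundary by the graph. -/
def F (κ : LipschitzChart Ω z) (x : EuclideanSpace ℝ (Fin d)) : Space d := κ.T (x, κ.φ x)

/-- The flattening of the boundary: `s` is the height above the graph. -/
def Ψ (κ : LipschitzChart Ω z) (x : EuclideanSpace ℝ (Fin d)) (s : ℝ) : Space d :=
  κ.T (x, κ.φ x + s)

theorem abs_φ_sub_le (κ : LipschitzChart Ω z) (a b : EuclideanSpace ℝ (Fin d)) :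
    |κ.φ a - κ.φ b| ≤ ‖a - b‖ := by
  simpa [Real.dist_eq, dist_eq_norm] using κ.lipschitz.dist_le_mul a b

theorem Ψ_zero (κ : LipschitzChart Ω z) (a : EuclideanSpace ℝ (Fin d)) : κ.Ψ a 0 = κ.F a := by
  simp [Ψ, F]

theorem norm_Ψ_sub_le (κ : LipschitzChart Ω z) (a b : EuclideanSpace ℝ (Fin d)) (s t : ℝ) :
    ‖κ.Ψ a s - κ.Ψ b t‖ ≤ 2 * ‖a - b‖ + |s - t| := by
  rw [Ψ, Ψ, ← map_sub, Prod.mk_sub_mk]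
  refine (κ.norm_le _ _).trans ?_
  have h1 := κ.abs_φ_sub_le a b
  have h2 : |κ.φ a + s - (κ.φ b + t)| ≤ |κ.φ a - κ.φ b| + |s - t| := by
    rw [add_sub_add_comm]; exact abs_add_le _ _
  linarith

theorem norm_F_sub_le (κ : LipschitzChart Ω z) (a b : EuclideanSpace ℝ (Fin d)) :
    ‖κ.F a - κ.F b‖ ≤ 2 * ‖a - b‖ := by
  simpa [← Ψ_zero] using κ.norm_Ψ_sub_le a b 0 0

theorem norm_sub_le_norm_F_sub (κ : LipschitzChart Ω z) (a b : EuclideanSpace ℝ (Fin d)) :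
    ‖a - b‖ ≤ ‖κ.F a - κ.F b‖ := by
  rw [F, F, ← map_sub, Prod.mk_sub_mk]
  exact κ.le_norm _ _

theorem F_center (κ : LipschitzChart Ω z) : κ.F κ.center = z := κ.center_eq

theorem F_mem_frontier (κ : LipschitzChart Ω z) {x : EuclideanSpace ℝ (Fin d)}
    (hx : x ∈ Metric.ball κ.center κ.r) : κ.F x ∈ frontier Ω := κ.on_frontier x hx

theorem lipschitzWith_F (κ : LipschitzChart Ω z) : LipschitzWith 2 κ.F :=
  LipschitzWith.of_dist_le_mul fun a b ↦ by
    simpa [dist_eq_norm] using κ.norm_F_sub_le a b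

/-- The part of `Ω` in the chart is star-shaped about the points that lie high enough. -/
theorem segment_mem (κ : LipschitzChart Ω z) {a b : EuclideanSpace ℝ (Fin d)} {η σ : ℝ}
    (ha : a ∈ Metric.ball κ.center κ.r) (hb : b ∈ Metric.ball κ.center κ.r) (hη : 0 < η)
    (hσ : 0 < σ) (hab : 2 * ‖a - b‖ ≤ η) (hr : η + σ + ‖a - b‖ ≤ κ.r) {τ : ℝ}
    (hτ : τ ∈ Icc (0 : ℝ) 1) : κ.Ψ b η + τ • (κ.Ψ a σ - κ.Ψ b η) ∈ Ω := by
  obtain ⟨h0, h1⟩ := hτ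
  set c := b + τ • (a - b) with hc
  have hcball : c ∈ Metric.ball κ.center κ.r := by
    have := (convex_ball κ.center κ.r) hb ha (sub_nonneg.2 h1) h0 (by ring)
    convert this using 1
    rw [hc]; module
  set s := κ.φ b + η + τ * (κ.φ a + σ - (κ.φ b + η)) - κ.φ c with hs
  have hEq : κ.Ψ b η + τ • (κ.Ψ a σ - κ.Ψ b η) = κ.T (c, κ.φ c + s) := by
    rw [Ψ, Ψ, ← map_sub, ← map_smul, ← map_add]
    congr 1
    ext1
    · simp [hc]
    · simp [hs]
  have hcb : ‖c - b‖ = τ * ‖a - b‖ := by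
    rw [hc, add_sub_cancel_left, norm_smul, Real.norm_of_nonneg h0]
  have hca : ‖c - a‖ = (1 - τ) * ‖a - b‖ := by
    have : c - a = -((1 - τ) • (a - b)) := by rw [hc]; module
    rw [this, norm_neg, norm_smul, Real.norm_of_nonneg (sub_nonneg.2 h1)]
  have e1 := abs_le.1 (κ.abs_φ_sub_le c b)
  have e2 := abs_le.1 (κ.abs_φ_sub_le c a)
  rw [hcb] at e1
  rw [hca] at e2
  have hn := norm_nonneg (a - b)
  have ht : 0 ≤ τ * (1 - τ) := mul_nonneg h0 (sub_nonneg.2 h1)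
  have m1 := mul_le_mul_of_nonneg_left e1.2 (sub_nonneg.2 h1)
  have m2 := mul_le_mul_of_nonneg_left e2.2 h0
  have m3 := mul_le_mul_of_nonneg_left e1.1 (sub_nonneg.2 h1)
  have m4 := mul_le_mul_of_nonneg_left e2.1 h0
  have hlow : (1 - τ) * (η - 2 * τ * ‖a - b‖) + τ * σ ≤ s := by
    rw [hs]; linarith
  have hup : s ≤ (1 - τ) * (η + 2 * τ * ‖a - b‖) + τ * σ := by
    rw [hs]; linarith
  rw [hEq]
  refine κ.above c hcball s ?_ ?_
  · refine lt_of_lt_of_le ?_ hlow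
    rcases h0.eq_or_lt with h | h
    · rw [← h]; simpa using hη
    · have : 0 ≤ (1 - τ) * (η - 2 * τ * ‖a - b‖) := by
        refine mul_nonneg (sub_nonneg.2 h1) ?_
        nlinarith
      have := mul_pos h hσ
      linarith
  · refine hup.trans (le_trans ?_ hr)
    have k1 : (1 - τ) * η ≤ η := by nlinarith
    have k2 : τ * σ ≤ σ := by nlinarith
    have k3 : 2 * (τ * (1 - τ)) ≤ 1 := by nlinarith [sq_nonneg (2 * τ - 1)]
    have k4 : 2 * (τ * (1 - τ)) * ‖a - b‖ ≤ 1 * ‖a - b‖ := by gcongr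
    linarith

/-- The flux estimate for a curve close to the boundary, at the scale `ℓ`, with the radial gauge
centred at height `8 ℓ` above the graph. -/
theorem abs_lineIntegral_sub_le (κ : LipschitzChart Ω z) (hΩ : IsOpen Ω) {A : Space d → Space d}
    (hA : ContDiffOn ℝ 1 A Ω) (hAc : ContinuousOn A (closure Ω)) {β : ℝ≥0}
    (hβ : CurlBoundOn Ω A β) {m : EuclideanSpace ℝ (Fin d)} {ℓ : ℝ} (hℓ : 0 < ℓ)
    (hℓr : 20 * ℓ ≤ κ.r) (hm : m ∈ Metric.ball κ.center κ.r) {γ : ℝ → Space d} {K : ℝ≥0}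
    (hγ : LipschitzOnWith K γ (Icc 0 1))
    (hγΨ : ∀ t ∈ Icc (0 : ℝ) 1, ∃ a ∈ Metric.ball κ.center κ.r, ∃ s ∈ Icc 0 (8 * ℓ),
      ‖a - m‖ ≤ 5 / 2 * ℓ ∧ γ t = κ.Ψ a s) :
    |(∫ t in (0 : ℝ)..1, (inner ℝ (A (γ t)) (deriv γ t) : ℝ)) -
      (radialPotential A (κ.Ψ m (8 * ℓ)) (γ 1) - radialPotential A (κ.Ψ m (8 * ℓ)) (γ 0))| ≤
        β * (14 * ℓ) * K := by
  have hshift : ∀ a s ε, κ.Ψ a s + ε • κ.T (0, 1) = κ.Ψ a (s + ε) := by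
    intro a s ε
    rw [Ψ, Ψ, ← map_smul, ← map_add]
    congr 1
    ext1 <;> simp [add_assoc]
  have := abs_lineIntegral_sub_radialPotential_le hΩ hA hAc hβ (w := κ.Ψ m (8 * ℓ))
    (e := κ.T (0, 1)) (D := ⟨14 * ℓ, by positivity⟩) hℓ hγ ?_ ?_
  · exact this
  · intro ε hε t ht τ hτ
    obtain ⟨a, ha, s, hs, ham, hγt⟩ := hγΨ t ht
    rw [hγt, hshift]
    exact κ.segment_mem ha hm (by positivity) (by linarith [hs.1, hε.1]) (by linarith)
      (by linarith [hs.2, hε.2]) hτ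
  · intro ε hε t ht
    obtain ⟨a, ha, s, hs, ham, hγt⟩ := hγΨ t ht
    rw [hγt, hshift]
    refine (κ.norm_Ψ_sub_le _ _ _ _).trans ?_
    have : |s + ε - 8 * ℓ| ≤ 9 * ℓ := by
      rw [abs_le]; constructor <;> linarith [hs.1, hs.2, hε.1, hε.2]
    change _ ≤ 14 * ℓ
    linarith

/-- Transport along the ray from the boundary point of parameter `x` to the point at height
`8 ‖h‖` above the parameter `x + h / 2`. -/
theorem exists_phase_ray (κ : LipschitzChart Ω z) (hΩ : IsOpen Ω) {A : Space d → Space d}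
    (hA : ContDiffOn ℝ 1 A Ω) (hAc : ContinuousOn A (closure Ω)) {β : ℝ≥0}
    (hβ : CurlBoundOn Ω A β) {V : Space d → ℂ} (hV : ContDiffOn ℝ 1 V Ω)
    (hVc : ContinuousOn V (closure Ω)) {x h : EuclideanSpace ℝ (Fin d)} (hh : h ≠ 0)
    (hhr : 20 * ‖h‖ ≤ κ.r) (hx : ‖x - κ.center‖ + ‖h‖ < κ.r) :
    ∃ θ : ℝ,
      |θ + radialPotential A (κ.Ψ (x + (2 : ℝ)⁻¹ • h) (8 * ‖h‖)) (κ.F x)| ≤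
        126 * β * ‖h‖ ^ 2 ∧
      ‖Complex.exp (Complex.I * (θ : ℂ)) * V (κ.Ψ (x + (2 : ℝ)⁻¹ • h) (8 * ‖h‖)) - V (κ.F x)‖ₑ ≤
        ENNReal.ofReal (9 * ‖h‖) * ∫⁻ s in Ioo (0 : ℝ) 1,
          ‖covariantGradient A V (grad V) (κ.Ψ (x + (s / 2) • h) (8 * ‖h‖ * s))‖ₑ := by
  have hh0 : 0 < ‖h‖ := norm_pos_iff.2 hh
  set γ : ℝ → Space d := fun s ↦ κ.Ψ (x + (s / 2) • h) (8 * ‖h‖ * s) with hγ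
  have hball : ∀ s ∈ Icc (0 : ℝ) 1, x + (s / 2) • h ∈ Metric.ball κ.center κ.r := by
    intro s hs
    rw [mem_ball_iff_norm, add_sub_right_comm]
    refine (norm_add_le _ _).trans_lt ?_
    rw [norm_smul, Real.norm_of_nonneg (by linarith [hs.1])]
    nlinarith [hs.1, hs.2]
  have hlip : LipschitzOnWith (9 * ‖h‖).toNNReal γ (Icc 0 1) := by
    refine LipschitzOnWith.of_dist_le_mul fun s hs t ht ↦ ?_
    rw [dist_eq_norm, hγ, Real.coe_toNNReal _ (by positivity)]
    refine (κ.norm_Ψ_sub_le _ _ _ _).trans ?_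
    rw [add_sub_add_left_eq_sub, ← sub_smul, norm_smul, ← mul_sub, abs_mul,
      abs_of_pos (by positivity : 0 < 8 * ‖h‖), ← sub_div, Real.norm_eq_abs, abs_div, Real.dist_eq,
      abs_of_pos (two_pos : (0 : ℝ) < 2)]
    exact le_of_eq (by ring)
  have hγ1 : γ 1 = κ.Ψ (x + (2 : ℝ)⁻¹ • h) (8 * ‖h‖) := by simp [hγ]
  have hγ0 : γ 0 = κ.F x := by simp [hγ, Ψ_zero]
  have hx0 : x ∈ Metric.ball κ.center κ.r := by simpa using hball 0 (by simp)
  have hm : x + (2 : ℝ)⁻¹ • h ∈ Metric.ball κ.center κ.r := by simpa using hball 1 (by simp)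
  refine ⟨∫ t in (0 : ℝ)..1, (inner ℝ (A (γ t)) (deriv γ t) : ℝ), ?_, ?_⟩
  · have := κ.abs_lineIntegral_sub_le hΩ hA hAc hβ hh0 hhr hm hlip (by
      intro t ht
      refine ⟨_, hball t ht, 8 * ‖h‖ * t, ⟨by have := ht.1; positivity, ?_⟩, ?_, rfl⟩
      · exact mul_le_of_le_one_right (by positivity) ht.2
      · rw [add_sub_add_left_eq_sub, ← sub_smul, norm_smul, Real.norm_eq_abs]
        have : |t / 2 - 2⁻¹| ≤ 5 / 2 := by
          rw [abs_le]; constructor <;> linarith [ht.1, ht.2]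
        gcongr)
    rw [hγ1, hγ0] at this
    have hzero : radialPotential A (κ.Ψ (x + (2 : ℝ)⁻¹ • h) (8 * ‖h‖))
        (κ.Ψ (x + (2 : ℝ)⁻¹ • h) (8 * ‖h‖)) = 0 := by simp [radialPotential]
    rw [hzero, zero_sub, sub_neg_eq_add] at this
    refine this.trans (le_of_eq ?_)
    rw [Real.coe_toNNReal _ (by positivity)]
    ring
  · have hmaps : MapsTo γ (Ioc 0 1) Ω := by
      intro s hs
      refine κ.above _ (hball s (Ioc_subset_Icc_self hs)) _ ?_ ?_
      · have := hs.1; positivity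
      · have : 8 * ‖h‖ * s ≤ 8 * ‖h‖ := mul_le_of_le_one_right (by positivity) hs.2
        linarith
    have := enorm_parallelTransport_sub_le hΩ hAc hV hVc hlip
      (by rw [hγ0]; exact frontier_subset_closure (κ.on_frontier x hx0)) hmaps
    rw [hγ1, hγ0] at this
    exact this

/-- Segments of parameters give curves in the boundary. -/
theorem intrinsicDist_F_le (κ : LipschitzChart Ω z) {x y : EuclideanSpace ℝ (Fin d)}
    (hx : x ∈ Metric.ball κ.center κ.r) (hy : y ∈ Metric.ball κ.center κ.r) :
    intrinsicDist (frontier Ω) (κ.F x) (κ.F y) ≤ ENNReal.ofReal (2 * ‖y - x‖) := by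
  set c : ℝ → EuclideanSpace ℝ (Fin d) := fun t ↦ x + t • (y - x) with hc
  have hcb : ∀ t ∈ Icc (0 : ℝ) 1, c t ∈ Metric.ball κ.center κ.r := by
    intro t ht
    have := (convex_ball κ.center κ.r) hx hy (sub_nonneg.2 ht.2) ht.1 (by ring)
    convert this using 1
    rw [hc]; module
  have hlip : LipschitzWith (2 * ‖y - x‖).toNNReal (κ.F ∘ c) := by
    refine LipschitzWith.of_dist_le_mul fun s t ↦ ?_
    rw [dist_eq_norm, Real.coe_toNNReal _ (by positivity)]
    refine (κ.norm_F_sub_le _ _).trans ?_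
    rw [hc, add_sub_add_left_eq_sub, ← sub_smul, norm_smul, Real.dist_eq, Real.norm_eq_abs]
    exact le_of_eq (by ring)
  refine (iInf₂_le (κ.F ∘ c) ⟨hlip.continuous.continuousOn, fun t ht ↦ κ.on_frontier _ (hcb t ht),
    by simp [hc], by simp [hc]⟩).trans ?_
  refine ((hlip.lipschitzOnWith (s := Icc (0 : ℝ) 1)).comp_eVariationOn_le
    (f := κ.F ∘ c) (g := id) (s := Icc (0 : ℝ) 1) (mapsTo_id _)).trans ?_
  have h1 := (monotoneOn_id (s := Icc (0 : ℝ) 1)).eVariationOn_eq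
    (left_mem_Icc.2 zero_le_one) (right_mem_Icc.2 zero_le_one)
  rw [inter_self] at h1
  rw [h1]
  simp [ENNReal.ofReal]

theorem norm_exp_sub_exp_le (a b : ℝ) :
    ‖Complex.exp (Complex.I * (a : ℂ)) - Complex.exp (Complex.I * (b : ℂ))‖ ≤ min 2 |a - b| := by
  have hn : ∀ c : ℝ, ‖Complex.exp (Complex.I * (c : ℂ))‖ = 1 := fun c ↦ by
    rw [mul_comm]; exact Complex.norm_exp_ofReal_mul_I c
  refine le_min ?_ ?_
  · refine (norm_sub_le _ _).trans ?_
    rw [hn, hn]; norm_num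
  · have : Complex.exp (Complex.I * (a : ℂ)) - Complex.exp (Complex.I * (b : ℂ)) =
        Complex.exp (Complex.I * (b : ℂ)) *
          (Complex.exp (Complex.I * ((a - b : ℝ) : ℂ)) - 1) := by
      rw [mul_sub, ← Complex.exp_add, mul_one]
      congr 2
      push_cast; ring
    rw [this, norm_mul, hn, one_mul]
    exact Real.norm_exp_I_mul_ofReal_sub_one_le

/-- The pointwise estimate behind the theorem: the geodesic transport from `y` to `x` is compared
with the transport along two rays that meet above the middle of `x` and `y`. The closed curve
that they form with the geodesic has a magnetic flux of order `β |y - x|²`. -/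
theorem enorm_geodesicTransport_sub_le (κ : LipschitzChart Ω z) (hΩ : IsOpen Ω)
    {A ν : Space d → Space d} (hA : ContDiffOn ℝ 1 A Ω) (hAc : ContinuousOn A (closure Ω))
    {β : ℝ≥0} (hβ : CurlBoundOn Ω A β) (hν : ∀ z ∈ frontier Ω, IsUnitNormal Ω z (ν z))
    {V : Space d → ℂ} (hV : ContDiffOn ℝ 1 V Ω) (hVc : ContinuousOn V (closure Ω))
    {x h : EuclideanSpace ℝ (Fin d)} (hh : h ≠ 0) (hhr : 20 * ‖h‖ ≤ κ.r)
    (hx : ‖κ.F x - z‖ < κ.r / 2)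
    (hinj : ENNReal.ofReal (2 * ‖h‖) < injRadius (frontier Ω)) :
    ‖Complex.exp (Complex.I * (geodesicPotential (frontier Ω) (tangentialPart ν A) (κ.F x)
        (κ.F (x + h)) : ℂ)) * V (κ.F (x + h)) - V (κ.F x)‖ₑ ≤
      ENNReal.ofReal (9 * ‖h‖) * (∫⁻ s in Ioo (0 : ℝ) 1,
          ‖covariantGradient A V (grad V) (κ.Ψ (x + (s / 2) • h) (8 * ‖h‖ * s))‖ₑ) +
      ENNReal.ofReal (9 * ‖h‖) * (∫⁻ s in Ioo (0 : ℝ) 1,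
          ‖covariantGradient A V (grad V) (κ.Ψ (x + h + (s / 2) • (-h)) (8 * ‖h‖ * s))‖ₑ) +
      ENNReal.ofReal (min 2 (280 * β * ‖h‖ ^ 2)) * ‖V (κ.F (x + h))‖ₑ := by
  have hh0 : 0 < ‖h‖ := norm_pos_iff.2 hh
  have hxc : ‖x - κ.center‖ < κ.r / 2 := by
    refine (κ.norm_sub_le_norm_F_sub _ _).trans_lt ?_
    rwa [κ.F_center]
  have hyc : ‖x + h - κ.center‖ ≤ ‖x - κ.center‖ + ‖h‖ := by
    rw [add_sub_right_comm]; exact norm_add_le _ _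
  have hr := κ.r_pos
  have hxb : x ∈ Metric.ball κ.center κ.r := by rw [mem_ball_iff_norm]; linarith
  have hyb : x + h ∈ Metric.ball κ.center κ.r := by rw [mem_ball_iff_norm]; linarith
  set m := x + (2 : ℝ)⁻¹ • h with hm
  have hmy : x + h + (2 : ℝ)⁻¹ • (-h) = m := by rw [hm]; module
  have hmb : m ∈ Metric.ball κ.center κ.r := by
    rw [mem_ball_iff_norm, hm, add_sub_right_comm]
    refine (norm_add_le _ _).trans_lt ?_
    rw [norm_smul, norm_inv, Real.norm_two]; linarith
  set w := κ.Ψ m (8 * ‖h‖) with hw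
  obtain ⟨θ₁, h1, h1'⟩ := κ.exists_phase_ray hΩ hA hAc hβ hV hVc (x := x) hh hhr (by linarith)
  obtain ⟨θ₂, h2, h2'⟩ := κ.exists_phase_ray hΩ hA hAc hβ hV hVc (x := x + h) (h := -h)
    (neg_ne_zero.2 hh) (by rwa [norm_neg]) (by rw [norm_neg]; linarith)
  rw [norm_neg, hmy, ← hw] at h2 h2'
  rw [← hm, ← hw] at h1 h1'
  have hdist := κ.intrinsicDist_F_le hxb hyb
  rw [add_sub_cancel_left] at hdist
  obtain ⟨γ, hγ, hγS, hγ0, hγ1, hI⟩ := exists_curve_geodesicPotential_eq (A := A) hν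
    (κ.F_mem_frontier hxb) (κ.F_mem_frontier hyb) hdist hinj
  have hflux := κ.abs_lineIntegral_sub_le hΩ hA hAc hβ hh0 hhr hmb hγ (by
    intro t ht
    have hd : ‖γ t - κ.F x‖ ≤ 2 * ‖h‖ := by
      rw [← hγ0, ← dist_eq_norm]
      refine (hγ.dist_le_mul t ht 0 (by simp)).trans ?_
      rw [Real.coe_toNNReal _ (by positivity), Real.dist_eq, sub_zero, abs_of_nonneg ht.1]
      exact mul_le_of_le_one_right (by positivity) ht.2
    have hz : γ t ∈ Metric.ball z κ.r := by
      rw [mem_ball_iff_norm]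
      have : γ t - z = (γ t - κ.F x) + (κ.F x - z) := by abel
      rw [this]
      refine (norm_add_le _ _).trans_lt ?_
      linarith
    set a := (κ.T.symm (γ t)).1 with ha
    have hFa : κ.F a = γ t := κ.graph _ (hγS ht) hz
    have hax : ‖a - x‖ ≤ 2 * ‖h‖ := by
      refine (κ.norm_sub_le_norm_F_sub a x).trans ?_
      rwa [hFa]
    refine ⟨a, ?_, 0, ⟨le_rfl, by positivity⟩, ?_, ?_⟩
    · rw [mem_ball_iff_norm]
      refine (κ.norm_sub_le_norm_F_sub _ _).trans_lt ?_
      rw [hFa, κ.F_center]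
      rwa [mem_ball_iff_norm] at hz
    · have : a - m = (a - x) + -((2 : ℝ)⁻¹ • h) := by rw [hm]; module
      rw [this]
      refine (norm_add_le _ _).trans ?_
      rw [norm_neg, norm_smul, norm_inv, Real.norm_two]; linarith
    · rw [Ψ_zero, hFa])
  rw [← hI, hγ0, hγ1, ← hw, Real.coe_toNNReal _ (by positivity : (0 : ℝ) ≤ 2 * ‖h‖)] at hflux
  set Φ := geodesicPotential (frontier Ω) (tangentialPart ν A) (κ.F x) (κ.F (x + h)) with hΦ
  have hphase : |Φ - (θ₁ - θ₂)| ≤ 280 * β * ‖h‖ ^ 2 := by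
    have e1 := abs_le.1 hflux
    have e2 := abs_le.1 h1
    have e3 := abs_le.1 h2
    rw [abs_le]
    constructor <;> linarith
  have hn : ∀ c : ℝ, ‖Complex.exp (Complex.I * (c : ℂ))‖ₑ = 1 := fun c ↦ by
    rw [mul_comm, ← enorm_norm, Complex.norm_exp_ofReal_mul_I]; simp
  have hdecomp : Complex.exp (Complex.I * (Φ : ℂ)) * V (κ.F (x + h)) - V (κ.F x) =
      (Complex.exp (Complex.I * (θ₁ : ℂ)) * V w - V (κ.F x)) +
      -(Complex.exp (Complex.I * ((θ₁ - θ₂ : ℝ) : ℂ)) *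
        (Complex.exp (Complex.I * (θ₂ : ℂ)) * V w - V (κ.F (x + h)))) +
      (Complex.exp (Complex.I * (Φ : ℂ)) - Complex.exp (Complex.I * ((θ₁ - θ₂ : ℝ) : ℂ))) *
        V (κ.F (x + h)) := by
    have : Complex.exp (Complex.I * (θ₁ : ℂ)) = Complex.exp (Complex.I * ((θ₁ - θ₂ : ℝ) : ℂ)) *
        Complex.exp (Complex.I * (θ₂ : ℂ)) := by
      rw [← Complex.exp_add]; congr 1; push_cast; ring
    rw [this]; ring
  rw [hdecomp]
  refine (enorm_add_le _ _).trans (add_le_add ((enorm_add_le _ _).trans (add_le_add h1' ?_)) ?_)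
  · rw [enorm_neg, enorm_mul, hn, one_mul]; exact h2'
  · rw [enorm_mul]
    gcongr
    rw [← enorm_norm, Real.enorm_of_nonneg (norm_nonneg _)]
    refine ENNReal.ofReal_le_ofReal ((norm_exp_sub_exp_le _ _).trans ?_)
    exact min_le_min le_rfl hphase

end LipschitzChart

/-! ### Integral inequalities -/

theorem lintegral_comp_mul_left_of_pos {f : ℝ → ℝ≥0∞} (hf : Measurable f) {c : ℝ} (hc : 0 < c) :
    ∫⁻ t, f (c * t) = ENNReal.ofReal c⁻¹ * ∫⁻ t, f t := by
  have h := Real.map_volume_mul_left hc.ne'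
  rw [← lintegral_map hf (measurable_const_mul c), h, lintegral_smul_measure,
    abs_of_pos (inv_pos.2 hc), smul_eq_mul]

theorem setLIntegral_Ioi_comp_mul_left {f : ℝ → ℝ≥0∞} (hf : Measurable f) {c : ℝ} (hc : 0 < c) :
    ∫⁻ t in Ioi 0, f (c * t) = ENNReal.ofReal c⁻¹ * ∫⁻ t in Ioi 0, f t := by
  rw [← lintegral_indicator measurableSet_Ioi, ← lintegral_indicator measurableSet_Ioi,
    ← lintegral_comp_mul_left_of_pos (hf.indicator measurableSet_Ioi) hc]
  refine lintegral_congr fun t ↦ ?_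
  simp only [indicator, mem_Ioi, mul_pos_iff_of_pos_left hc]

theorem setLIntegral_Ioo_comp_mul_left {f : ℝ → ℝ≥0∞} (hf : Measurable f) {c : ℝ} (hc : 0 < c) :
    ∫⁻ t in Ioo 0 1, f (c * t) = ENNReal.ofReal c⁻¹ * ∫⁻ t in Ioo 0 c, f t := by
  rw [← lintegral_indicator measurableSet_Ioo, ← lintegral_indicator measurableSet_Ioo,
    ← lintegral_comp_mul_left_of_pos (hf.indicator measurableSet_Ioo) hc]
  refine lintegral_congr fun t ↦ ?_
  simp only [indicator, mem_Ioo, mul_pos_iff_of_pos_left hc, mul_lt_iff_lt_one_right hc]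

/-- Integration of radial functions in polar coordinates. -/
theorem exists_lintegral_fun_norm_eq {d : ℕ} (hd : 1 ≤ d) :
    ∃ C : ℝ≥0, ∀ f : ℝ → ℝ≥0∞, Measurable f →
      ∫⁻ x : EuclideanSpace ℝ (Fin d), f ‖x‖ =
        C * ∫⁻ r in Ioi (0 : ℝ), ENNReal.ofReal (r ^ (d - 1)) * f r := by
  have : Nonempty (Fin d) := ⟨⟨0, hd⟩⟩
  set μ : Measure (EuclideanSpace ℝ (Fin d)) := volume with hμ
  refine ⟨(μ.toSphere univ).toNNReal, fun f hf ↦ ?_⟩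
  rw [ENNReal.coe_toNNReal (measure_ne_top _ _)]
  have hfin : Module.finrank ℝ (EuclideanSpace ℝ (Fin d)) = d := by simp
  have hfm : Measurable fun r : Ioi (0 : ℝ) ↦ f r := hf.comp measurable_subtype_coe
  have hfm' : Measurable fun x : Metric.sphere (0 : EuclideanSpace ℝ (Fin d)) 1 × Ioi (0 : ℝ) ↦
      f x.2 := hfm.comp measurable_snd
  calc ∫⁻ x, f ‖x‖ ∂μ =
        ∫⁻ x : ({(0)}ᶜ : Set (EuclideanSpace ℝ (Fin d))), f ‖x.1‖ ∂(μ.comap (↑)) := by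
        rw [lintegral_subtype_comap (measurableSet_singleton _).compl fun x ↦ f ‖x‖,
          restrict_compl_singleton]
    _ = ∫⁻ x, f x.2 ∂μ.toSphere.prod (.volumeIoiPow (d - 1)) := by
        have h := μ.measurePreserving_homeomorphUnitSphereProd
        rw [hfin] at h
        rw [← h.lintegral_comp hfm']
        simp
    _ = μ.toSphere univ * ∫⁻ r : Ioi (0 : ℝ), f r ∂.volumeIoiPow (d - 1) := by
        rw [lintegral_prod _ hfm'.aemeasurable]
        simp [mul_comm]
    _ = _ := by
        rw [Measure.volumeIoiPow, lintegral_withDensity_eq_lintegral_mul _ (by fun_prop) hfm]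
        congr 1
        exact lintegral_subtype_comap measurableSet_Ioi
          fun r ↦ ENNReal.ofReal (r ^ (d - 1)) * f r

/-- Hölder's inequality with a power weight. -/
theorem exists_rpow_setLIntegral_le {p : ℝ} (hp : 1 < p) :
    ∃ C : ℝ≥0, ∀ g : ℝ → ℝ≥0∞, Measurable g →
      (∫⁻ s in Ioo (0 : ℝ) 1, g s) ^ p ≤
        C * ∫⁻ s in Ioo (0 : ℝ) 1, ENNReal.ofReal (s ^ ((p - 1) / 2)) * g s ^ p := by
  have hp0 : 0 < p := by linarith
  set q := p.conjExponent with hq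
  have hpq : p.HolderConjugate q := Real.HolderConjugate.conjExponent hp
  have hq0 : 0 < q := hpq.symm.pos
  set a := (p - 1) / (2 * p) with ha
  have hap : a * p = (p - 1) / 2 := by rw [ha]; field_simp
  have haq : a * q = 1 / 2 := by
    rw [ha, hq, Real.conjExponent]
    have : p - 1 ≠ 0 := by linarith
    field_simp
  have hI : ∫⁻ s in Ioo (0 : ℝ) 1, ENNReal.ofReal (s ^ (-a)) ^ q ≠ ⊤ := by
    have h1 : IntegrableOn (fun s : ℝ ↦ s ^ (-(1 / 2) : ℝ)) (Ioo 0 1) :=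
      (intervalIntegral.integrableOn_Ioo_rpow_iff zero_lt_one).2 (by norm_num)
    have h2 := h1.lintegral_lt_top
    refine ne_of_lt (lt_of_le_of_lt (le_of_eq ?_) h2)
    refine setLIntegral_congr_fun measurableSet_Ioo fun s hs ↦ ?_
    rw [ENNReal.ofReal_rpow_of_nonneg (Real.rpow_nonneg hs.1.le _) hq0.le,
      ← Real.rpow_mul hs.1.le, neg_mul, haq]
  set I := ∫⁻ s in Ioo (0 : ℝ) 1, ENNReal.ofReal (s ^ (-a)) ^ q with hIdef
  refine ⟨(I ^ (p / q)).toNNReal, fun g hg ↦ ?_⟩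
  rw [ENNReal.coe_toNNReal (ENNReal.rpow_ne_top_of_nonneg (by positivity) hI)]
  have hm1 : Measurable fun s : ℝ ↦ ENNReal.ofReal (s ^ a) * g s := by fun_prop
  have hm2 : Measurable fun s : ℝ ↦ ENNReal.ofReal (s ^ (-a)) := by fun_prop
  have hH := ENNReal.lintegral_mul_le_Lp_mul_Lq (volume.restrict (Ioo (0 : ℝ) 1)) hpq
    hm1.aemeasurable hm2.aemeasurable
  have h1 : ∫⁻ s in Ioo (0 : ℝ) 1, g s = ∫⁻ s in Ioo (0 : ℝ) 1,
      ((fun s : ℝ ↦ ENNReal.ofReal (s ^ a) * g s) * fun s : ℝ ↦ ENNReal.ofReal (s ^ (-a))) s := by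
    refine setLIntegral_congr_fun measurableSet_Ioo fun s hs ↦ ?_
    simp only [Pi.mul_apply]
    rw [mul_right_comm, ← ENNReal.ofReal_mul (Real.rpow_nonneg hs.1.le _), ← Real.rpow_add hs.1]
    simp
  have h2 : ∫⁻ s in Ioo (0 : ℝ) 1, (ENNReal.ofReal (s ^ a) * g s) ^ p =
      ∫⁻ s in Ioo (0 : ℝ) 1, ENNReal.ofReal (s ^ ((p - 1) / 2)) * g s ^ p := by
    refine setLIntegral_congr_fun measurableSet_Ioo fun s hs ↦ ?_
    rw [ENNReal.mul_rpow_of_nonneg _ _ hp0.le,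
      ENNReal.ofReal_rpow_of_nonneg (Real.rpow_nonneg hs.1.le _) hp0.le,
      ← Real.rpow_mul hs.1.le, hap]
  rw [← h1, h2] at hH
  refine (ENNReal.rpow_le_rpow hH hp0.le).trans (le_of_eq ?_)
  rw [ENNReal.mul_rpow_of_nonneg _ _ hp0.le, ← ENNReal.rpow_mul, ← ENNReal.rpow_mul,
    one_div_mul_cancel hp0.ne', ENNReal.rpow_one, mul_comm]
  congr 2
  ring

/-- The power of the norm in the Gagliardo kernel is compensated by the polar Jacobian. -/
theorem ofReal_pow_mul_div_rpow {d : ℕ} (hd : 1 ≤ d) (p : ℝ) {r : ℝ} (hr : 0 < r) (X : ℝ≥0∞) :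
    ENNReal.ofReal (r ^ (d - 1)) * (X / ENNReal.ofReal r ^ ((d : ℝ) + p - 1)) =
      X / ENNReal.ofReal r ^ p := by
  have h1 : ENNReal.ofReal (r ^ (d - 1)) = ENNReal.ofReal r ^ ((d : ℝ) - 1) := by
    rw [ENNReal.ofReal_rpow_of_pos hr, ← Real.rpow_natCast, Nat.cast_sub hd, Nat.cast_one]
  have hr0 : ENNReal.ofReal r ≠ 0 := by simpa using hr
  rw [h1, div_eq_mul_inv, div_eq_mul_inv, ← ENNReal.rpow_neg, ← ENNReal.rpow_neg, mul_left_comm,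
    ← ENNReal.rpow_add _ _ hr0 ENNReal.ofReal_ne_top]
  congr 2
  ring

/-- The Gagliardo integral of the averages of `G` over the rays of directions `(h / 2, 8 ‖h‖)` is
bounded by the `L^p` norm of `G` in the half space, by Hölder's inequality with a power weight,
translation invariance and polar coordinates. -/
theorem exists_lintegral_ray_le {d : ℕ} (hd : 1 ≤ d) {p : ℝ} (hp : 1 < p) :
    ∃ C : ℝ≥0, ∀ G : EuclideanSpace ℝ (Fin d) × ℝ → ℝ≥0∞, Measurable G →
      ∫⁻ h : EuclideanSpace ℝ (Fin d), ∫⁻ x : EuclideanSpace ℝ (Fin d),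
        (ENNReal.ofReal ‖h‖ * ∫⁻ s in Ioo (0 : ℝ) 1, G (x + (s / 2) • h, 8 * ‖h‖ * s)) ^ p /
          ENNReal.ofReal ‖h‖ ^ ((d : ℝ) + p - 1) ≤
      C * ∫⁻ x : EuclideanSpace ℝ (Fin d), ∫⁻ t in Ioi (0 : ℝ), G (x, t) ^ p := by
  obtain ⟨C₁, hC₁⟩ := exists_rpow_setLIntegral_le hp
  obtain ⟨C₂, hC₂⟩ := exists_lintegral_fun_norm_eq hd
  have hp0 : 0 < p := by linarith
  have hI : ∫⁻ s in Ioo (0 : ℝ) 1,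
      ENNReal.ofReal (s ^ ((p - 1) / 2)) * ENNReal.ofReal (8 * s)⁻¹ ≠ ⊤ := by
    have h1 : IntegrableOn (fun s : ℝ ↦ s ^ ((p - 1) / 2 - 1)) (Ioo 0 1) :=
      (intervalIntegral.integrableOn_Ioo_rpow_iff zero_lt_one).2 (by linarith)
    refine ne_of_lt (lt_of_le_of_lt ?_ h1.lintegral_lt_top)
    refine setLIntegral_mono' measurableSet_Ioo fun s hs ↦ ?_
    rw [← ENNReal.ofReal_mul (Real.rpow_nonneg hs.1.le _)]
    refine ENNReal.ofReal_le_ofReal ?_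
    rw [Real.rpow_sub hs.1, Real.rpow_one, div_eq_mul_inv]
    refine mul_le_mul_of_nonneg_left ?_ (Real.rpow_nonneg hs.1.le _)
    exact inv_anti₀ hs.1 (by linarith [hs.1])
  set I := ∫⁻ s in Ioo (0 : ℝ) 1,
      ENNReal.ofReal (s ^ ((p - 1) / 2)) * ENNReal.ofReal (8 * s)⁻¹ with hIdef
  refine ⟨C₁ * C₂ * I.toNNReal, fun G hG ↦ ?_⟩
  set N : ℝ → ℝ≥0∞ := fun t ↦ ∫⁻ x : EuclideanSpace ℝ (Fin d), G (x, t) ^ p with hN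
  have hNm : Measurable N :=
    Measurable.lintegral_prod_left' (f := fun z : EuclideanSpace ℝ (Fin d) × ℝ ↦ G z ^ p)
      (hG.pow_const p)
  set w : ℝ → ℝ≥0∞ := fun r ↦ ENNReal.ofReal r ^ p / ENNReal.ofReal r ^ ((d : ℝ) + p - 1) with hw
  have hwm : Measurable w := by fun_prop
  calc ∫⁻ h : EuclideanSpace ℝ (Fin d), ∫⁻ x : EuclideanSpace ℝ (Fin d),
        (ENNReal.ofReal ‖h‖ * ∫⁻ s in Ioo (0 : ℝ) 1, G (x + (s / 2) • h, 8 * ‖h‖ * s)) ^ p /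
          ENNReal.ofReal ‖h‖ ^ ((d : ℝ) + p - 1)
      ≤ ∫⁻ h : EuclideanSpace ℝ (Fin d), ∫⁻ x : EuclideanSpace ℝ (Fin d),
          ∫⁻ s in Ioo (0 : ℝ) 1, C₁ * (w ‖h‖ * (ENNReal.ofReal (s ^ ((p - 1) / 2)) *
            G (x + (s / 2) • h, 8 * ‖h‖ * s) ^ p)) := by
        refine lintegral_mono fun h ↦ lintegral_mono fun x ↦ ?_
        simp only
        rw [ENNReal.mul_rpow_of_nonneg _ _ hp0.le, ENNReal.mul_div_right_comm]
        rw [lintegral_const_mul _ (by fun_prop), lintegral_const_mul _ (by fun_prop), mul_left_comm]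
        gcongr
        exact hC₁ _ (by fun_prop)
    _ = ∫⁻ s in Ioo (0 : ℝ) 1, ∫⁻ h : EuclideanSpace ℝ (Fin d),
          ∫⁻ x : EuclideanSpace ℝ (Fin d), C₁ * (w ‖h‖ * (ENNReal.ofReal (s ^ ((p - 1) / 2)) *
            G (x + (s / 2) • h, 8 * ‖h‖ * s) ^ p)) := by
        refine (lintegral_congr fun h ↦ lintegral_lintegral_swap ?_).trans
          (lintegral_lintegral_swap ?_)
        · refine Measurable.aemeasurable ?_
          fun_prop
        · refine Measurable.aemeasurable ?_
          refine Measurable.lintegral_prod_right' (f := fun z : (EuclideanSpace ℝ (Fin d) × ℝ) ×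
            EuclideanSpace ℝ (Fin d) ↦ C₁ * (w ‖z.1.1‖ *
              (ENNReal.ofReal (z.1.2 ^ ((p - 1) / 2)) *
                G (z.2 + (z.1.2 / 2) • z.1.1, 8 * ‖z.1.1‖ * z.1.2) ^ p))) ?_
          fun_prop
    _ = ∫⁻ s in Ioo (0 : ℝ) 1, C₁ * C₂ * (∫⁻ τ in Ioi (0 : ℝ), N τ) *
          (ENNReal.ofReal (s ^ ((p - 1) / 2)) * ENNReal.ofReal (8 * s)⁻¹) := by
        refine setLIntegral_congr_fun measurableSet_Ioo fun s hs ↦ ?_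
        have h1 : ∀ h : EuclideanSpace ℝ (Fin d), ∫⁻ x : EuclideanSpace ℝ (Fin d),
            C₁ * (w ‖h‖ * (ENNReal.ofReal (s ^ ((p - 1) / 2)) *
            G (x + (s / 2) • h, 8 * ‖h‖ * s) ^ p)) =
            C₁ * (ENNReal.ofReal (s ^ ((p - 1) / 2)) * (w ‖h‖ * N (8 * s * ‖h‖))) := by
          intro h
          rw [lintegral_const_mul _ (by fun_prop), lintegral_const_mul _ (by fun_prop),
            lintegral_const_mul _ (by fun_prop), mul_left_comm (w ‖h‖),
            lintegral_add_right_eq_self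
              (fun x : EuclideanSpace ℝ (Fin d) ↦ G (x, 8 * ‖h‖ * s) ^ p) ((s / 2) • h),
            mul_right_comm 8 ‖h‖ s]
        simp_rw [h1]
        rw [lintegral_const_mul _ (by fun_prop), lintegral_const_mul _ (by fun_prop),
          hC₂ (fun r ↦ w r * N (8 * s * r)) (by fun_prop)]
        have h2 : ∫⁻ r in Ioi (0 : ℝ), ENNReal.ofReal (r ^ (d - 1)) * (w r * N (8 * s * r)) =
            ∫⁻ r in Ioi (0 : ℝ), N (8 * s * r) := by
          refine setLIntegral_congr_fun measurableSet_Ioi fun r hr ↦ ?_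
          have hr : 0 < r := hr
          rw [← mul_assoc, hw]
          simp only
          rw [ofReal_pow_mul_div_rpow hd p hr, ENNReal.div_self, one_mul]
          · exact (ENNReal.rpow_pos (ENNReal.ofReal_pos.2 hr) ENNReal.ofReal_ne_top).ne'
          · exact ENNReal.rpow_ne_top_of_nonneg hp0.le ENNReal.ofReal_ne_top
        rw [h2, setLIntegral_Ioi_comp_mul_left hNm (by linarith [hs.1])]
        ring
    _ = ↑(C₁ * C₂ * I.toNNReal) * ∫⁻ x : EuclideanSpace ℝ (Fin d),
          ∫⁻ t in Ioi (0 : ℝ), G (x, t) ^ p := by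
        rw [lintegral_const_mul _ (by fun_prop), ← hIdef, lintegral_lintegral_swap (by fun_prop)]
        push_cast
        rw [ENNReal.coe_toNNReal hI]
        ring

/-- The contribution of the magnetic flux: after the scaling `h ↦ β^{-1/2} h`, a convergent
integral in polar coordinates remains. -/
theorem exists_lintegral_min_rpow_le {d : ℕ} (hd : 1 ≤ d) {p : ℝ} (hp : 1 < p) :
    ∃ C : ℝ≥0, ∀ β : ℝ≥0,
      ∫⁻ h : EuclideanSpace ℝ (Fin d), ENNReal.ofReal (min 2 (280 * β * ‖h‖ ^ 2)) ^ p /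
          ENNReal.ofReal ‖h‖ ^ ((d : ℝ) + p - 1) ≤ C * (β : ℝ≥0∞) ^ ((p - 1) / 2) := by
  obtain ⟨C₂, hC₂⟩ := exists_lintegral_fun_norm_eq hd
  have hp0 : 0 < p := by linarith
  set N : ℝ → ℝ≥0∞ := fun τ ↦ ENNReal.ofReal (min 2 (280 * τ ^ 2)) ^ p / ENNReal.ofReal τ ^ p
    with hN
  have hNm : Measurable N := by fun_prop
  have hI : ∫⁻ τ in Ioi (0 : ℝ), N τ ≠ ⊤ := by
    have h1 : IntegrableOn (fun s : ℝ ↦ s ^ (-p)) (Ioi 1) :=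
      integrableOn_Ioi_rpow_of_lt (by linarith) one_pos
    rw [← Ioc_union_Ioi_eq_Ioi (zero_le_one' ℝ)]
    refine ne_of_lt ((lintegral_union_le _ _ _).trans_lt (ENNReal.add_lt_top.2 ⟨?_, ?_⟩))
    · refine lt_of_le_of_lt (setLIntegral_mono' measurableSet_Ioc
        (g := fun _ ↦ ENNReal.ofReal 280 ^ p) fun τ hτ ↦ ?_) ?_
      · rw [hN]
        simp only
        rw [← ENNReal.div_rpow_of_nonneg _ _ hp0.le]
        gcongr
        rw [← ENNReal.ofReal_div_of_pos hτ.1]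
        refine ENNReal.ofReal_le_ofReal ?_
        rw [div_le_iff₀ hτ.1]
        refine (min_le_right _ _).trans ?_
        nlinarith [hτ.1, hτ.2]
      · rw [setLIntegral_const]
        exact ENNReal.mul_lt_top (ENNReal.rpow_lt_top_of_nonneg hp0.le ENNReal.ofReal_ne_top)
          (by simp)
    · refine lt_of_le_of_lt (setLIntegral_mono' measurableSet_Ioi
        (g := fun τ ↦ ENNReal.ofReal 2 ^ p * ENNReal.ofReal (τ ^ (-p))) fun τ hτ ↦ ?_) ?_
      · have hτ : (0 : ℝ) < τ := one_pos.trans hτ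
        rw [hN]
        simp only
        rw [div_eq_mul_inv, ← ENNReal.rpow_neg, ENNReal.ofReal_rpow_of_pos hτ]
        gcongr
        exact min_le_left _ _
      · rw [lintegral_const_mul _ (by fun_prop)]
        exact ENNReal.mul_lt_top (ENNReal.rpow_lt_top_of_nonneg hp0.le ENNReal.ofReal_ne_top)
          h1.lintegral_lt_top
  set I := ∫⁻ τ in Ioi (0 : ℝ), N τ with hIdef
  refine ⟨C₂ * I.toNNReal, fun β ↦ ?_⟩
  rcases eq_or_ne β 0 with rfl | hβ
  · simp [ENNReal.zero_rpow_of_pos hp0]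
  have hβ0 : (0 : ℝ) < β := by simpa using pos_iff_ne_zero.2 hβ
  set b : ℝ := Real.sqrt β with hb
  have hb0 : 0 < b := Real.sqrt_pos.2 hβ0
  have hbb : b ^ 2 = β := Real.sq_sqrt hβ0.le
  rw [hC₂ (fun r ↦ ENNReal.ofReal (min 2 (280 * β * r ^ 2)) ^ p /
    ENNReal.ofReal r ^ ((d : ℝ) + p - 1)) (by fun_prop)]
  have h2 : ∫⁻ r in Ioi (0 : ℝ), ENNReal.ofReal (r ^ (d - 1)) *
      (ENNReal.ofReal (min 2 (280 * β * r ^ 2)) ^ p / ENNReal.ofReal r ^ ((d : ℝ) + p - 1)) =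
      ∫⁻ r in Ioi (0 : ℝ), ENNReal.ofReal b ^ p * N (b * r) := by
    refine setLIntegral_congr_fun measurableSet_Ioi fun r hr ↦ ?_
    have hr : 0 < r := hr
    rw [ofReal_pow_mul_div_rpow hd p hr, hN]
    simp only
    rw [ENNReal.ofReal_mul hb0.le, ENNReal.mul_rpow_of_nonneg _ _ hp0.le, ← mul_div_assoc,
      ENNReal.mul_div_mul_left, mul_pow, hbb, ← mul_assoc 280]
    · exact (ENNReal.rpow_pos (ENNReal.ofReal_pos.2 hb0) ENNReal.ofReal_ne_top).ne'
    · exact ENNReal.rpow_ne_top_of_nonneg hp0.le ENNReal.ofReal_ne_top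
  rw [h2, lintegral_const_mul _ (by fun_prop), setLIntegral_Ioi_comp_mul_left hNm hb0, ← hIdef]
  push_cast
  rw [ENNReal.coe_toNNReal hI]
  have h3 : ENNReal.ofReal b ^ p * ENNReal.ofReal b⁻¹ = (β : ℝ≥0∞) ^ ((p - 1) / 2) := by
    rw [ENNReal.ofReal_rpow_of_pos hb0, ← ENNReal.ofReal_mul (by positivity),
      ← ENNReal.ofReal_coe_nnreal, ENNReal.ofReal_rpow_of_pos hβ0]
    congr 1
    rw [hb, Real.sqrt_eq_rpow, ← Real.rpow_neg_one, ← Real.rpow_mul hβ0.le,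
      ← Real.rpow_mul hβ0.le, ← Real.rpow_add hβ0]
    congr 1; ring
  rw [← h3]
  exact le_of_eq (by ring)

/-- A weak form of Minkowski's inequality. -/
theorem rpow_add_le_mul {p : ℝ} (hp : 1 < p) (a b : ℝ≥0∞) :
    (a + b) ^ p ≤ 2 ^ p * (a ^ p + b ^ p) := by
  refine (ENNReal.rpow_add_le_mul_rpow_add_rpow a b hp.le).trans ?_
  gcongr
  · norm_num
  · linarith

/-- Hölder's inequality on an interval. -/
theorem rpow_setLIntegral_Ioo_le {p : ℝ} (hp : 1 < p) {g : ℝ → ℝ≥0∞} (hg : Measurable g) {ℓ : ℝ}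
    (hℓ : 0 < ℓ) :
    (∫⁻ t in Ioo 0 ℓ, g t) ^ p ≤ ENNReal.ofReal (ℓ ^ (p - 1)) * ∫⁻ t in Ioo 0 ℓ, g t ^ p := by
  have hp0 : 0 < p := by linarith
  set q := p.conjExponent with hq
  have hpq : p.HolderConjugate q := Real.HolderConjugate.conjExponent hp
  have hH := ENNReal.lintegral_mul_le_Lp_mul_Lq (volume.restrict (Ioo (0 : ℝ) ℓ)) hpq
    hg.aemeasurable (aemeasurable_const (b := (1 : ℝ≥0∞)))
  simp only [Pi.mul_apply, mul_one, ENNReal.one_rpow, lintegral_const, MeasurableSet.univ,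
    Measure.restrict_apply, univ_inter, Real.volume_Ioo, sub_zero, one_mul] at hH
  refine (ENNReal.rpow_le_rpow hH hp0.le).trans (le_of_eq ?_)
  rw [ENNReal.mul_rpow_of_nonneg _ _ hp0.le, ← ENNReal.rpow_mul, ← ENNReal.rpow_mul,
    one_div_mul_cancel hp0.ne', ENNReal.rpow_one, mul_comm, ENNReal.ofReal_rpow_of_pos hℓ]
  congr 3
  rw [hq, Real.conjExponent]
  have : p - 1 ≠ 0 := by linarith
  field_simp

namespace LipschitzChart

variable {d : ℕ} {Ω : Set (Space d)} {z : Space d}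

/-! ### Measures in a chart -/

/-- In a chart, the surface measure is controlled by the Lebesgue measure of the parameters. -/
theorem setLIntegral_surfaceMeasure_le (κ : LipschitzChart Ω z) {f : Space d → ℝ≥0∞}
    (hf : Measurable f) :
    ∫⁻ x in Metric.ball z κ.r, f x ∂surfaceMeasure Ω ≤
      2 ^ d * ∫⁻ a in Metric.ball κ.center κ.r, f (κ.F a) := by
  have hF : Measurable κ.F := κ.lipschitzWith_F.continuous.measurable
  have hle : (surfaceMeasure Ω).restrict (Metric.ball z κ.r) ≤
      (2 ^ d : ℝ≥0∞) • (volume.restrict (Metric.ball κ.center κ.r)).map κ.F := by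
    refine Measure.le_iff.2 fun s hs ↦ ?_
    have hb : MeasurableSet (Metric.ball z κ.r) := measurableSet_ball
    rw [Measure.restrict_apply hs, surfaceMeasure, Measure.restrict_apply (hs.inter hb),
      Measure.smul_apply, Measure.map_apply hF hs, Measure.restrict_apply (hF hs), smul_eq_mul]
    have hsub : s ∩ Metric.ball z κ.r ∩ frontier Ω ⊆
        κ.F '' (κ.F ⁻¹' s ∩ Metric.ball κ.center κ.r) := by
      rintro q ⟨⟨hqs, hqb⟩, hqf⟩
      have hq : κ.F (κ.T.symm q).1 = q := κ.graph q hqf hqb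
      refine ⟨(κ.T.symm q).1, ⟨by rwa [mem_preimage, hq], ?_⟩, hq⟩
      rw [mem_ball_iff_norm] at hqb ⊢
      refine (κ.norm_sub_le_norm_F_sub _ _).trans_lt ?_
      rwa [hq, κ.F_center]
    refine (measure_mono hsub).trans ?_
    rw [← EuclideanSpace.euclideanHausdorffMeasure_eq_volume, Measure.euclideanHausdorffMeasure_def,
      Measure.euclideanHausdorffMeasure_def, Measure.smul_apply, Measure.smul_apply]
    have h := κ.lipschitzWith_F.hausdorffMeasure_image_le (d := d) (Nat.cast_nonneg d)
      (κ.F ⁻¹' s ∩ Metric.ball κ.center κ.r)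
    rw [ENNReal.smul_def, ENNReal.smul_def, smul_eq_mul, smul_eq_mul, mul_left_comm]
    gcongr
    simpa using h
  calc ∫⁻ x in Metric.ball z κ.r, f x ∂surfaceMeasure Ω
      ≤ ∫⁻ x, f x ∂((2 ^ d : ℝ≥0∞) • (volume.restrict (Metric.ball κ.center κ.r)).map κ.F) :=
        lintegral_mono' hle le_rfl
    _ = _ := by rw [lintegral_smul_measure, lintegral_map hf hF, smul_eq_mul]

/-- The flattening multiplies the volume by a constant. -/
theorem exists_lintegral_Ψ_eq (κ : LipschitzChart Ω z) :
    ∃ C : ℝ≥0, ∀ f : Space d → ℝ≥0∞, Measurable f →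
      ∫⁻ a, ∫⁻ t, f (κ.Ψ a t) = C * ∫⁻ x, f x := by
  obtain ⟨c, hc⟩ : ∃ c : ℝ≥0,
      ((volume : Measure (EuclideanSpace ℝ (Fin d))).prod (volume : Measure ℝ)).map κ.T =
        c • (volume : Measure (Space d)) := by
    have : (((volume : Measure (EuclideanSpace ℝ (Fin d))).prod
      (volume : Measure ℝ)).map κ.T).IsAddHaarMeasure := κ.T.isAddHaarMeasure_map _
    exact ⟨_, Measure.isAddLeftInvariant_eq_smul _ volume⟩
  refine ⟨c, fun f hf ↦ ?_⟩
  have hTm : Measurable κ.T := κ.T.continuous.measurable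
  have h1 : ∀ a, ∫⁻ t, f (κ.Ψ a t) = ∫⁻ t, f (κ.T (a, t)) := fun a ↦ by
    simp only [Ψ]
    exact lintegral_add_left_eq_self (fun t ↦ f (κ.T (a, t))) (κ.φ a)
  simp_rw [h1]
  rw [← lintegral_prod (fun z : EuclideanSpace ℝ (Fin d) × ℝ ↦ f (κ.T z))
    (hf.comp hTm).aemeasurable, ← lintegral_map hf hTm, hc, lintegral_smul_measure]
  simp [ENNReal.smul_def]

theorem measurable_Ψ (κ : LipschitzChart Ω z) :
    Measurable fun x : EuclideanSpace ℝ (Fin d) × ℝ ↦ κ.Ψ x.1 x.2 := by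
  have h1 : Measurable κ.T := κ.T.continuous.measurable
  have h2 : Measurable κ.φ := κ.lipschitz.continuous.measurable
  unfold Ψ
  fun_prop

/-! ### The trace inequality in a chart -/

/-- Transport along the vertical segment of height `s`. -/
theorem enorm_F_le (κ : LipschitzChart Ω z) (hΩ : IsOpen Ω) {A : Space d → Space d}
    (hAc : ContinuousOn A (closure Ω)) {V : Space d → ℂ} (hV : ContDiffOn ℝ 1 V Ω)
    (hVc : ContinuousOn V (closure Ω)) {g : Space d → ℝ≥0∞} (hg : Measurable g)
    (hgV : ∀ x ∈ Ω, ‖covariantGradient A V (grad V) x‖ₑ = g x)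
    {a : EuclideanSpace ℝ (Fin d)} (ha : a ∈ Metric.ball κ.center κ.r) {s : ℝ} (hs : 0 < s)
    (hsr : s ≤ κ.r) :
    ‖V (κ.F a)‖ₑ ≤ ‖V (κ.Ψ a s)‖ₑ + ∫⁻ t in Ioo 0 s, g (κ.Ψ a t) := by
  have hlip : LipschitzOnWith s.toNNReal (fun τ ↦ κ.Ψ a (s * τ)) (Icc 0 1) := by
    refine LipschitzOnWith.of_dist_le_mul fun t _ t' _ ↦ ?_
    rw [dist_eq_norm, Real.coe_toNNReal _ hs.le]
    refine (κ.norm_Ψ_sub_le _ _ _ _).trans ?_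
    rw [← mul_sub, abs_mul, abs_of_pos hs, Real.dist_eq]
    simp
  have hmaps : MapsTo (fun τ ↦ κ.Ψ a (s * τ)) (Ioc 0 1) Ω := fun τ hτ ↦
    κ.above a ha _ (mul_pos hs hτ.1) ((mul_le_of_le_one_right hs.le hτ.2).trans hsr)
  have key := enorm_parallelTransport_sub_le hΩ hAc hV hVc hlip (by
    rw [mul_zero, Ψ_zero]; exact frontier_subset_closure (κ.F_mem_frontier ha)) hmaps
  simp only [mul_zero, mul_one, Ψ_zero] at key
  set θ := ∫ t in (0 : ℝ)..1,
    (inner ℝ (A (κ.Ψ a (s * t))) (deriv (fun τ ↦ κ.Ψ a (s * τ)) t) : ℝ) with hθ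
  have hn : ‖Complex.exp (Complex.I * (θ : ℂ))‖ₑ = 1 := by
    rw [mul_comm, ← enorm_norm, Complex.norm_exp_ofReal_mul_I]; simp
  have hint : s.toNNReal * ∫⁻ t in Ioo (0 : ℝ) 1,
      ‖covariantGradient A V (grad V) (κ.Ψ a (s * t))‖ₑ = ∫⁻ t in Ioo 0 s, g (κ.Ψ a t) := by
    have h1 : ∫⁻ t in Ioo (0 : ℝ) 1, ‖covariantGradient A V (grad V) (κ.Ψ a (s * t))‖ₑ =
        ∫⁻ t in Ioo (0 : ℝ) 1, g (κ.Ψ a (s * t)) :=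
      setLIntegral_congr_fun measurableSet_Ioo fun t ht ↦ hgV _ (hmaps (Ioo_subset_Ioc_self ht))
    have hm : Measurable fun t ↦ g (κ.Ψ a t) :=
      hg.comp (κ.measurable_Ψ.comp (measurable_const.prodMk measurable_id))
    rw [h1, setLIntegral_Ioo_comp_mul_left hm hs, ← mul_assoc, ← ENNReal.ofReal,
      ← ENNReal.ofReal_mul hs.le, mul_inv_cancel₀ hs.ne', ENNReal.ofReal_one, one_mul]
  rw [hint] at key
  have h2 : V (κ.F a) = Complex.exp (Complex.I * (θ : ℂ)) * V (κ.Ψ a s) -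
      (Complex.exp (Complex.I * (θ : ℂ)) * V (κ.Ψ a s) - V (κ.F a)) := by ring
  rw [h2]
  refine enorm_sub_le.trans (add_le_add ?_ key)
  rw [enorm_mul, hn, one_mul]

/-- The trace inequality in a chart, at all scales `ℓ`. -/
theorem exists_lintegral_F_le (κ : LipschitzChart Ω z) (hΩ : IsOpen Ω) {p : ℝ} (hp : 1 < p) :
    ∃ C : ℝ≥0, ∀ (A : Space d → Space d) (V : Space d → ℂ) (g v : Space d → ℝ≥0∞),
      ContinuousOn A (closure Ω) → ContDiffOn ℝ 1 V Ω → ContinuousOn V (closure Ω) →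
      Measurable g → Measurable v →
      (∀ x ∈ Ω, ‖covariantGradient A V (grad V) x‖ₑ = g x) → (∀ x ∈ closure Ω, ‖V x‖ₑ = v x) →
      ∀ ℓ, 0 < ℓ → ℓ ≤ κ.r →
        ∫⁻ a in Metric.ball κ.center κ.r, v (κ.F a) ^ p ≤
          C * (ENNReal.ofReal ℓ⁻¹ * (∫⁻ x in Ω, v x ^ p) +
            ENNReal.ofReal (ℓ ^ (p - 1)) * ∫⁻ x in Ω, g x ^ p) := by
  obtain ⟨C, hC⟩ := κ.exists_lintegral_Ψ_eq
  have hp0 : 0 < p := by linarith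
  refine ⟨2 ^ p * C, fun A V g v hAc hV hVc hg hv hgV hvV ℓ hℓ hℓr ↦ ?_⟩
  -- the restriction to `Ω` of the two functions
  set g' := Ω.indicator g with hg'
  set v' := Ω.indicator v with hv'
  have hg'm : Measurable g' := hg.indicator hΩ.measurableSet
  have hv'm : Measurable v' := hv.indicator hΩ.measurableSet
  have hΨg : Measurable fun x : EuclideanSpace ℝ (Fin d) × ℝ ↦ g' (κ.Ψ x.1 x.2) :=
    hg'm.comp κ.measurable_Ψ
  have hΨv : Measurable fun x : EuclideanSpace ℝ (Fin d) × ℝ ↦ v' (κ.Ψ x.1 x.2) :=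
    hv'm.comp κ.measurable_Ψ
  have hΨg1 : ∀ a, Measurable fun t ↦ g' (κ.Ψ a t) := fun a ↦
    hΨg.comp (measurable_const.prodMk measurable_id)
  have hΨv1 : ∀ a, Measurable fun t ↦ v' (κ.Ψ a t) := fun a ↦
    hΨv.comp (measurable_const.prodMk measurable_id)
  have hint : ∀ f : Space d → ℝ≥0∞, ∫⁻ x, (Ω.indicator f x) ^ p = ∫⁻ x in Ω, f x ^ p := by
    intro f
    rw [← lintegral_indicator hΩ.measurableSet]
    refine lintegral_congr fun x ↦ ?_
    by_cases hx : x ∈ Ω <;> simp [hx, ENNReal.zero_rpow_of_pos hp0]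
  have hpt : ∀ a ∈ Metric.ball κ.center κ.r, v (κ.F a) ^ p ≤
      2 ^ p * (ENNReal.ofReal ℓ⁻¹ * (∫⁻ t, v' (κ.Ψ a t) ^ p) +
        ENNReal.ofReal (ℓ ^ (p - 1)) * ∫⁻ t, g' (κ.Ψ a t) ^ p) := by
    intro a ha
    set J := ∫⁻ t, g' (κ.Ψ a t) ^ p with hJ
    have hs : ∀ s ∈ Ioo 0 ℓ, v (κ.F a) ^ p ≤
        2 ^ p * (v' (κ.Ψ a s) ^ p + ENNReal.ofReal (ℓ ^ (p - 1)) * J) := by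
      intro s hs
      have hmem : ∀ t ∈ Ioo 0 ℓ, κ.Ψ a t ∈ Ω := fun t ht ↦
        κ.above a ha t ht.1 (ht.2.le.trans hℓr)
      have h1 := κ.enorm_F_le hΩ hAc hV hVc hg hgV ha hs.1 (hs.2.le.trans hℓr)
      rw [hvV _ (frontier_subset_closure (κ.F_mem_frontier ha)),
        hvV _ (subset_closure (hmem s hs))] at h1
      have h2 : ∫⁻ t in Ioo 0 s, g (κ.Ψ a t) ≤ ∫⁻ t in Ioo 0 ℓ, g' (κ.Ψ a t) := by
        have : ∫⁻ t in Ioo 0 s, g (κ.Ψ a t) = ∫⁻ t in Ioo 0 s, g' (κ.Ψ a t) :=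
          setLIntegral_congr_fun measurableSet_Ioo fun t ht ↦ by
            rw [hg', indicator_of_mem (hmem t ⟨ht.1, ht.2.trans hs.2⟩)]
        rw [this]
        exact lintegral_mono_set (Ioo_subset_Ioo_right hs.2.le)
      have h3 : v (κ.Ψ a s) = v' (κ.Ψ a s) := by rw [hv', indicator_of_mem (hmem s hs)]
      rw [h3] at h1
      refine (ENNReal.rpow_le_rpow (h1.trans (add_le_add le_rfl h2)) hp0.le).trans ?_
      refine (rpow_add_le_mul hp _ _).trans ?_
      gcongr
      refine (rpow_setLIntegral_Ioo_le hp (hΨg1 a) hℓ).trans ?_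
      gcongr
      exact setLIntegral_le_lintegral _ _
    have hℓ0 : ENNReal.ofReal ℓ ≠ 0 := by simpa using hℓ
    have havg : ENNReal.ofReal ℓ * v (κ.F a) ^ p ≤
        2 ^ p * ((∫⁻ t, v' (κ.Ψ a t) ^ p) +
          ENNReal.ofReal ℓ * (ENNReal.ofReal (ℓ ^ (p - 1)) * J)) := by
      calc ENNReal.ofReal ℓ * v (κ.F a) ^ p = ∫⁻ _ in Ioo 0 ℓ, v (κ.F a) ^ p := by
            rw [setLIntegral_const, Real.volume_Ioo, sub_zero, mul_comm]
        _ ≤ ∫⁻ s in Ioo 0 ℓ,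
              2 ^ p * (v' (κ.Ψ a s) ^ p + ENNReal.ofReal (ℓ ^ (p - 1)) * J) :=
            setLIntegral_mono' measurableSet_Ioo hs
        _ ≤ _ := by
            rw [lintegral_const_mul _ (((hΨv1 a).pow_const p).add_const _),
              lintegral_add_right _ measurable_const,
              setLIntegral_const, Real.volume_Ioo, sub_zero, mul_comm _ (ENNReal.ofReal ℓ)]
            gcongr
            exact Measure.restrict_le_self
    calc v (κ.F a) ^ p = ENNReal.ofReal ℓ⁻¹ * (ENNReal.ofReal ℓ * v (κ.F a) ^ p) := by
          rw [← mul_assoc, ← ENNReal.ofReal_mul (by positivity), inv_mul_cancel₀ hℓ.ne',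
            ENNReal.ofReal_one, one_mul]
      _ ≤ _ := mul_le_mul_right havg _
      _ = 2 ^ p * (ENNReal.ofReal ℓ⁻¹ * (∫⁻ t, v' (κ.Ψ a t) ^ p) +
            (ENNReal.ofReal ℓ⁻¹ * ENNReal.ofReal ℓ) * (ENNReal.ofReal (ℓ ^ (p - 1)) * J)) := by
          ring
      _ = _ := by
          rw [← ENNReal.ofReal_mul (by positivity), inv_mul_cancel₀ hℓ.ne',
            ENNReal.ofReal_one, one_mul]
  have hmv : Measurable fun a ↦ ∫⁻ t, v' (κ.Ψ a t) ^ p :=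
    (hΨv.pow_const p).lintegral_prod_right'
  have hmg : Measurable fun a ↦ ∫⁻ t, g' (κ.Ψ a t) ^ p :=
    (hΨg.pow_const p).lintegral_prod_right'
  calc ∫⁻ a in Metric.ball κ.center κ.r, v (κ.F a) ^ p
      ≤ ∫⁻ a in Metric.ball κ.center κ.r,
          2 ^ p * (ENNReal.ofReal ℓ⁻¹ * (∫⁻ t, v' (κ.Ψ a t) ^ p) +
            ENNReal.ofReal (ℓ ^ (p - 1)) * ∫⁻ t, g' (κ.Ψ a t) ^ p) :=
        setLIntegral_mono' measurableSet_ball hpt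
    _ ≤ ∫⁻ a, 2 ^ p * (ENNReal.ofReal ℓ⁻¹ * (∫⁻ t, v' (κ.Ψ a t) ^ p) +
            ENNReal.ofReal (ℓ ^ (p - 1)) * ∫⁻ t, g' (κ.Ψ a t) ^ p) :=
        setLIntegral_le_lintegral _ _
    _ = _ := by
        rw [lintegral_const_mul _ (by fun_prop), lintegral_add_right _ (by fun_prop),
          lintegral_const_mul _ hmv, lintegral_const_mul _ hmg,
          hC (fun x ↦ v' x ^ p) (hv'm.pow_const p), hC (fun x ↦ g' x ^ p) (hg'm.pow_const p),
          hint, hint]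
        have h2 : ((2 ^ p * C : ℝ≥0) : ℝ≥0∞) = 2 ^ p * (C : ℝ≥0∞) := by
          rw [ENNReal.coe_mul, ENNReal.coe_rpow_of_nonneg _ hp0.le]; simp
        rw [h2]
        ring

end LipschitzChart

/-! ### Pairs of close boundary points -/

/-- A potential `A` whose magnetic field is at most `β` and a function `V`, both `C¹` in `Ω` and
continuous up to the boundary, together with measurable versions `g` of `|∇_A V|` on `Ω` (vanishing outside `Ω`) and
`v` of `|V|` on the closure. -/
structure IsRegularPair {d : ℕ} (Ω : Set (Space d)) (A : Space d → Space d) (β : ℝ≥0)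
    (V : Space d → ℂ) (g v : Space d → ℝ≥0∞) : Prop where
  curlBound : CurlBoundOn Ω A β
  contDiffOn_potential : ContDiffOn ℝ 1 A Ω
  continuousOn_potential : ContinuousOn A (closure Ω)
  contDiffOn : ContDiffOn ℝ 1 V Ω
  continuousOn : ContinuousOn V (closure Ω)
  measurable_grad : Measurable g
  measurable_abs : Measurable v
  grad_eq : ∀ x ∈ Ω, ‖covariantGradient A V (grad V) x‖ₑ = g x
  grad_eq_zero : ∀ x ∉ Ω, g x = 0
  abs_eq : ∀ x ∈ closure Ω, ‖V x‖ₑ = v x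

/-- The right-hand side of the trace inequality, in terms of `|∇_A V|` and `|V|`. -/
def magneticEnergy {d : ℕ} (Ω : Set (Space d)) (p : ℝ) (β : ℝ≥0) (g v : Space d → ℝ≥0∞) : ℝ≥0∞ :=
  (∫⁻ x in Ω, g x ^ p) + (1 + (β : ℝ≥0∞) ^ (p / 2)) * ∫⁻ x in Ω, v x ^ p

/-- The integrand of `boundaryGagliardo`. -/
def gagliardoIntegrand {d : ℕ} (Ω : Set (Space d)) (p : ℝ) (B : Space d → Space d)
    (u : Space d → ℂ) (x y : Space d) : ℝ≥0∞ :=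
  ‖Complex.exp (Complex.I * (geodesicPotential (frontier Ω) B x y : ℂ)) * u y - u x‖ₑ ^ p /
      ‖y - x‖ₑ ^ ((d : ℝ) + p - 1)

theorem setLIntegral_le_magneticEnergy {d : ℕ} (Ω : Set (Space d)) (p : ℝ) (β : ℝ≥0)
    (g v : Space d → ℝ≥0∞) : ∫⁻ x in Ω, g x ^ p ≤ magneticEnergy Ω p β g v :=
  le_self_add

theorem setLIntegral_abs_le_magneticEnergy {d : ℕ} (Ω : Set (Space d)) (p : ℝ) (β : ℝ≥0)
    (g v : Space d → ℝ≥0∞) : ∫⁻ x in Ω, v x ^ p ≤ magneticEnergy Ω p β g v := by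
  rw [magneticEnergy]
  refine le_trans ?_ le_add_self
  calc ∫⁻ x in Ω, v x ^ p = 1 * ∫⁻ x in Ω, v x ^ p := (one_mul _).symm
    _ ≤ _ := by gcongr; exact le_self_add

namespace LipschitzChart

variable {d : ℕ} {Ω : Set (Space d)} {z : Space d}

/-- The trace inequality at the scale of the chart. -/
theorem exists_lintegral_F_le_magneticEnergy (κ : LipschitzChart Ω z) (hΩ : IsOpen Ω) {p : ℝ}
    (hp : 1 < p) :
    ∃ C : ℝ≥0, ∀ (A : Space d → Space d) (β : ℝ≥0) (V : Space d → ℂ) (g v : Space d → ℝ≥0∞),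
      IsRegularPair Ω A β V g v →
        ∫⁻ a in Metric.ball κ.center κ.r, v (κ.F a) ^ p ≤ C * magneticEnergy Ω p β g v := by
  obtain ⟨C, hC⟩ := κ.exists_lintegral_F_le hΩ hp
  refine ⟨C * ((κ.r)⁻¹.toNNReal + (κ.r ^ (p - 1)).toNNReal), fun A β V g v h ↦ ?_⟩
  refine (hC A V g v h.continuousOn_potential h.contDiffOn h.continuousOn h.measurable_grad
    h.measurable_abs h.grad_eq h.abs_eq κ.r κ.r_pos le_rfl).trans ?_
  rw [ENNReal.coe_mul, ENNReal.coe_add, mul_assoc, add_mul]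
  refine mul_le_mul_right (add_le_add ?_ ?_) _
  · exact mul_le_mul_right (setLIntegral_abs_le_magneticEnergy _ _ _ _ _) _
  · exact mul_le_mul_right (setLIntegral_le_magneticEnergy _ _ _ _ _) _

/-- The trace inequality at the magnetic scale `β ^ (-1/2)`, or at the scale of the chart if this
is smaller. -/
theorem exists_rpow_mul_lintegral_F_le_magneticEnergy (κ : LipschitzChart Ω z) (hΩ : IsOpen Ω)
    {p : ℝ} (hp : 1 < p) :
    ∃ C : ℝ≥0, ∀ (A : Space d → Space d) (β : ℝ≥0) (V : Space d → ℂ) (g v : Space d → ℝ≥0∞),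
      IsRegularPair Ω A β V g v →
        (β : ℝ≥0∞) ^ ((p - 1) / 2) * ∫⁻ a in Metric.ball κ.center κ.r, v (κ.F a) ^ p ≤
          C * magneticEnergy Ω p β g v := by
  obtain ⟨C₁, hC₁⟩ := κ.exists_lintegral_F_le_magneticEnergy hΩ hp
  obtain ⟨C₂, hC₂⟩ := κ.exists_lintegral_F_le hΩ hp
  have hr := κ.r_pos
  set ρ : ℝ≥0 := (κ.r⁻¹ ^ 2).toNNReal with hρ
  refine ⟨ρ ^ ((p - 1) / 2) * C₁ + C₂, fun A β V g v h ↦ ?_⟩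
  have hp1 : 0 ≤ (p - 1) / 2 := by linarith
  rw [ENNReal.coe_add, add_mul]
  rcases le_total β ρ with hβ | hβ
  · refine le_trans ?_ le_self_add
    rw [ENNReal.coe_mul, mul_assoc, ENNReal.coe_rpow_of_nonneg _ hp1]
    exact mul_le_mul' (ENNReal.rpow_le_rpow (by exact_mod_cast hβ) hp1) (hC₁ A β V g v h)
  · refine le_trans ?_ le_add_self
    have hβr : κ.r⁻¹ ^ 2 ≤ (β : ℝ) := Real.toNNReal_le_iff_le_coe.1 hβ
    have hβ0 : 0 < (β : ℝ) := lt_of_lt_of_le (by positivity) hβr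
    -- `β ^ ((p - 1) / 2) ℓ⁻¹ = β ^ (p / 2)` and `β ^ ((p - 1) / 2) ℓ ^ (p - 1) = 1` for this `ℓ`
    set ℓ : ℝ := (β : ℝ) ^ (-(1 / 2) : ℝ) with hℓ
    have hℓ0 : 0 < ℓ := Real.rpow_pos_of_pos hβ0 _
    have hℓr : ℓ ≤ κ.r := by
      have h1 : κ.r⁻¹ ≤ (β : ℝ) ^ (1 / 2 : ℝ) := by
        rw [← Real.sqrt_eq_rpow]; exact Real.le_sqrt_of_sq_le hβr
      rw [hℓ, Real.rpow_neg hβ0.le]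
      exact inv_le_of_inv_le₀ hr h1
    have hb : (β : ℝ≥0∞) ^ ((p - 1) / 2) = ENNReal.ofReal ((β : ℝ) ^ ((p - 1) / 2)) := by
      rw [← ENNReal.ofReal_rpow_of_pos hβ0, ENNReal.ofReal_coe_nnreal]
    have hb2 : (β : ℝ≥0∞) ^ (p / 2) = ENNReal.ofReal ((β : ℝ) ^ (p / 2)) := by
      rw [← ENNReal.ofReal_rpow_of_pos hβ0, ENNReal.ofReal_coe_nnreal]
    have e1 : (β : ℝ) ^ ((p - 1) / 2) * ℓ⁻¹ = (β : ℝ) ^ (p / 2) := by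
      rw [hℓ, ← Real.rpow_neg hβ0.le, ← Real.rpow_add hβ0]; congr 1; ring
    have e2 : (β : ℝ) ^ ((p - 1) / 2) * ℓ ^ (p - 1) = 1 := by
      rw [hℓ, ← Real.rpow_mul hβ0.le, ← Real.rpow_add hβ0,
        show (p - 1) / 2 + -(1 / 2) * (p - 1) = 0 by ring, Real.rpow_zero]
    have hpos : 0 ≤ (β : ℝ) ^ ((p - 1) / 2) := Real.rpow_nonneg hβ0.le _
    refine (mul_le_mul_right (hC₂ A V g v h.continuousOn_potential h.contDiffOn h.continuousOn
      h.measurable_grad h.measurable_abs h.grad_eq h.abs_eq ℓ hℓ0 hℓr) _).trans ?_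
    rw [mul_left_comm, mul_add, ← mul_assoc, ← mul_assoc, hb, ← ENNReal.ofReal_mul hpos,
      ← ENNReal.ofReal_mul hpos, e1, e2, ENNReal.ofReal_one, one_mul, magneticEnergy, hb2,
      add_comm]
    gcongr
    exact le_add_self

/-- The contribution of the ray that leaves the boundary point with parameter `a` in the direction
`h`. -/
def rayTerm (κ : LipschitzChart Ω z) (p : ℝ) (g : Space d → ℝ≥0∞)
    (a h : EuclideanSpace ℝ (Fin d)) : ℝ≥0∞ :=
  (ENNReal.ofReal ‖h‖ * ∫⁻ s in Ioo (0 : ℝ) 1, g (κ.Ψ (a + (s / 2) • h) (8 * ‖h‖ * s))) ^ p /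
    ENNReal.ofReal ‖h‖ ^ ((d : ℝ) + p - 1)

/-- The weight that comes from the magnetic flux. -/
def fluxWeight (d : ℕ) (p : ℝ) (β : ℝ≥0) (h : EuclideanSpace ℝ (Fin d)) : ℝ≥0∞ :=
  ENNReal.ofReal (min 2 (280 * β * ‖h‖ ^ 2)) ^ p / ENNReal.ofReal ‖h‖ ^ ((d : ℝ) + p - 1)

theorem measurable_rayTerm (κ : LipschitzChart Ω z) (p : ℝ) {g : Space d → ℝ≥0∞}
    (hg : Measurable g) :
    Measurable fun q : EuclideanSpace ℝ (Fin d) × EuclideanSpace ℝ (Fin d) ↦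
      κ.rayTerm p g q.1 q.2 := by
  have h1 : Measurable fun w : (EuclideanSpace ℝ (Fin d) × EuclideanSpace ℝ (Fin d)) × ℝ ↦
      g (κ.Ψ (w.1.1 + (w.2 / 2) • w.1.2) (8 * ‖w.1.2‖ * w.2)) := by
    refine hg.comp (κ.measurable_Ψ.comp (f := fun w : (EuclideanSpace ℝ (Fin d) ×
      EuclideanSpace ℝ (Fin d)) × ℝ ↦ (w.1.1 + (w.2 / 2) • w.1.2, 8 * ‖w.1.2‖ * w.2)) ?_)
    fun_prop
  have h2 : Measurable fun q : EuclideanSpace ℝ (Fin d) × EuclideanSpace ℝ (Fin d) ↦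
      ∫⁻ s in Ioo (0 : ℝ) 1, g (κ.Ψ (q.1 + (s / 2) • q.2) (8 * ‖q.2‖ * s)) :=
    h1.lintegral_prod_right'
  unfold rayTerm
  fun_prop

theorem measurable_rayTerm_sub (κ : LipschitzChart Ω z) (p : ℝ) {g : Space d → ℝ≥0∞}
    (hg : Measurable g) :
    Measurable fun q : EuclideanSpace ℝ (Fin d) × EuclideanSpace ℝ (Fin d) ↦
      κ.rayTerm p g q.1 (q.2 - q.1) :=
  (κ.measurable_rayTerm p hg).comp
    (f := fun q : EuclideanSpace ℝ (Fin d) × EuclideanSpace ℝ (Fin d) ↦ (q.1, q.2 - q.1))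
    (measurable_fst.prodMk (measurable_snd.sub measurable_fst))

theorem measurable_rayTerm_sub_swap (κ : LipschitzChart Ω z) (p : ℝ) {g : Space d → ℝ≥0∞}
    (hg : Measurable g) :
    Measurable fun q : EuclideanSpace ℝ (Fin d) × EuclideanSpace ℝ (Fin d) ↦
      κ.rayTerm p g q.2 (q.1 - q.2) :=
  (κ.measurable_rayTerm p hg).comp
    (f := fun q : EuclideanSpace ℝ (Fin d) × EuclideanSpace ℝ (Fin d) ↦ (q.2, q.1 - q.2))
    (measurable_snd.prodMk (measurable_fst.sub measurable_snd))

theorem measurable_fluxWeight (d : ℕ) (p : ℝ) (β : ℝ≥0) : Measurable (fluxWeight d p β) := by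
  unfold fluxWeight
  fun_prop

/-- The majorant of the Gagliardo integrand at the boundary points with parameters `a` and `b`. -/
def pairMajorant (κ : LipschitzChart Ω z) (p : ℝ) (β : ℝ≥0) (g v : Space d → ℝ≥0∞)
    (a b : EuclideanSpace ℝ (Fin d)) : ℝ≥0∞ :=
  (2 ^ p * 2 ^ p * ENNReal.ofReal 9 ^ p) * (κ.rayTerm p g a (b - a) + κ.rayTerm p g b (a - b) +
    fluxWeight d p β (b - a) * v (κ.F b) ^ p)

theorem measurable_pairMajorant (κ : LipschitzChart Ω z) (p : ℝ) (β : ℝ≥0)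
    {g v : Space d → ℝ≥0∞} (hg : Measurable g) (hv : Measurable v) :
    Measurable fun q : EuclideanSpace ℝ (Fin d) × EuclideanSpace ℝ (Fin d) ↦
      κ.pairMajorant p β g v q.1 q.2 := by
  have h1 := κ.measurable_rayTerm_sub p hg
  have h2 := κ.measurable_rayTerm_sub_swap p hg
  have h3 := (measurable_fluxWeight d p β).comp
    (f := fun q : EuclideanSpace ℝ (Fin d) × EuclideanSpace ℝ (Fin d) ↦ q.2 - q.1)
    (by fun_prop)
  have h4 : Measurable fun q : EuclideanSpace ℝ (Fin d) × EuclideanSpace ℝ (Fin d) ↦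
      v (κ.F q.2) :=
    hv.comp (κ.lipschitzWith_F.continuous.measurable.comp measurable_snd)
  exact (((h1.add h2).add (h3.mul (h4.pow_const p)))).const_mul _

/-- The pointwise estimate, raised to the power `p`. -/
theorem gagliardoIntegrand_le_pairMajorant (κ : LipschitzChart Ω z) (hΩ : IsOpen Ω) {p : ℝ}
    (hp : 1 < p) {A ν : Space d → Space d} {β : ℝ≥0} {V : Space d → ℂ} {g v : Space d → ℝ≥0∞}
    (hA : IsRegularPair Ω A β V g v) (hν : ∀ z ∈ frontier Ω, IsUnitNormal Ω z (ν z))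
    {a b : EuclideanSpace ℝ (Fin d)} (hab : a ≠ b) (ha : ‖κ.F a - z‖ < κ.r / 2)
    (hr : 20 * ‖κ.F b - κ.F a‖ ≤ κ.r)
    (hinj : ENNReal.ofReal (2 * ‖κ.F b - κ.F a‖) < injRadius (frontier Ω)) :
    gagliardoIntegrand Ω p (tangentialPart ν A) V (κ.F a) (κ.F b) ≤
      κ.pairMajorant p β g v a b := by
  have hp0 : 0 < p := by linarith
  obtain ⟨h, rfl⟩ : ∃ h, b = a + h := ⟨b - a, by abel⟩
  have hh : h ≠ 0 := by rintro rfl; simp at hab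
  have hh0 : 0 < ‖h‖ := norm_pos_iff.2 hh
  have hle : ‖h‖ ≤ ‖κ.F (a + h) - κ.F a‖ := by simpa using κ.norm_sub_le_norm_F_sub (a + h) a
  have hhr : 20 * ‖h‖ ≤ κ.r := by linarith
  have key := κ.enorm_geodesicTransport_sub_le hΩ hA.contDiffOn_potential
    hA.continuousOn_potential hA.curlBound hν hA.contDiffOn hA.continuousOn hh hhr ha
    ((ENNReal.ofReal_le_ofReal (by linarith)).trans_lt hinj)
  -- the parameters of the points met by the computation stay in the chart
  have hac : ‖a - κ.center‖ < κ.r / 2 := by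
    refine (κ.norm_sub_le_norm_F_sub _ _).trans_lt ?_
    rwa [κ.F_center]
  have hmem : ∀ c, ‖c - a‖ ≤ ‖h‖ → c ∈ Metric.ball κ.center κ.r := fun c hc ↦ by
    rw [mem_ball_iff_norm, ← sub_add_sub_cancel c a κ.center]
    refine (norm_add_le _ _).trans_lt ?_
    linarith
  have hΩ1 : ∀ s ∈ Ioo (0 : ℝ) 1, κ.Ψ (a + (s / 2) • h) (8 * ‖h‖ * s) ∈ Ω := fun s hs ↦ by
    refine κ.above _ (hmem _ ?_) _ (by have := hs.1; positivity) ?_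
    · rw [add_sub_cancel_left, norm_smul, Real.norm_of_nonneg (by linarith [hs.1])]
      nlinarith [hs.2]
    · nlinarith [hs.2, hs.1]
  have hΩ2 : ∀ s ∈ Ioo (0 : ℝ) 1, κ.Ψ (a + h + (s / 2) • (-h)) (8 * ‖h‖ * s) ∈ Ω := fun s hs ↦ by
    refine κ.above _ (hmem _ ?_) _ (by have := hs.1; positivity) ?_
    · have : a + h + (s / 2) • (-h) - a = (1 - s / 2) • h := by module
      rw [this, norm_smul, Real.norm_of_nonneg (by linarith [hs.2])]
      nlinarith [hs.1]
    · nlinarith [hs.2, hs.1]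
  rw [setLIntegral_congr_fun measurableSet_Ioo fun s hs ↦ hA.grad_eq _ (hΩ1 s hs),
    setLIntegral_congr_fun measurableSet_Ioo fun s hs ↦ hA.grad_eq _ (hΩ2 s hs),
    hA.abs_eq _ (frontier_subset_closure (κ.F_mem_frontier (hmem _ (by simp))))] at key
  have hden : ENNReal.ofReal ‖h‖ ^ ((d : ℝ) + p - 1) ≤
      ‖κ.F (a + h) - κ.F a‖ₑ ^ ((d : ℝ) + p - 1) := by
    have : 0 ≤ (d : ℝ) + p - 1 := by have := Nat.cast_nonneg (α := ℝ) d; linarith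
    rw [← ofReal_norm]
    gcongr
  refine (ENNReal.div_le_div (ENNReal.rpow_le_rpow key hp0.le) hden).trans ?_
  rw [pairMajorant, rayTerm, rayTerm, fluxWeight, add_sub_cancel_left,
    show a - (a + h) = -h by abel, norm_neg]
  set J₁ := ∫⁻ s in Ioo (0 : ℝ) 1, g (κ.Ψ (a + (s / 2) • h) (8 * ‖h‖ * s))
  set J₂ := ∫⁻ s in Ioo (0 : ℝ) 1, g (κ.Ψ (a + h + (s / 2) • (-h)) (8 * ‖h‖ * s))
  set D := ENNReal.ofReal ‖h‖ ^ ((d : ℝ) + p - 1)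
  set M := ENNReal.ofReal (min 2 (280 * β * ‖h‖ ^ 2))
  set w := v (κ.F (a + h))
  have h9 : (1 : ℝ≥0∞) ≤ ENNReal.ofReal 9 ^ p := ENNReal.one_le_rpow (by norm_num) hp0
  have h2 : (1 : ℝ≥0∞) ≤ 2 ^ p := ENNReal.one_le_rpow (by norm_num) hp0
  have hJ : ∀ J : ℝ≥0∞, (ENNReal.ofReal (9 * ‖h‖) * J) ^ p =
      ENNReal.ofReal 9 ^ p * (ENNReal.ofReal ‖h‖ * J) ^ p := fun J ↦ by
    rw [ENNReal.ofReal_mul (by norm_num), mul_assoc, ENNReal.mul_rpow_of_nonneg _ _ hp0.le]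
  have hsum : (ENNReal.ofReal (9 * ‖h‖) * J₁ + ENNReal.ofReal (9 * ‖h‖) * J₂ + M * w) ^ p ≤
      (2 ^ p * 2 ^ p * ENNReal.ofReal 9 ^ p) * ((ENNReal.ofReal ‖h‖ * J₁) ^ p +
        (ENNReal.ofReal ‖h‖ * J₂) ^ p + M ^ p * w ^ p) := by
    calc _ ≤ 2 ^ p * ((ENNReal.ofReal (9 * ‖h‖) * J₁ + ENNReal.ofReal (9 * ‖h‖) * J₂) ^ p +
            (M * w) ^ p) := rpow_add_le_mul hp _ _
      _ ≤ 2 ^ p * (2 ^ p * ((ENNReal.ofReal (9 * ‖h‖) * J₁) ^ p +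
            (ENNReal.ofReal (9 * ‖h‖) * J₂) ^ p) + 2 ^ p * ENNReal.ofReal 9 ^ p * (M * w) ^ p) := by
          gcongr
          · exact rpow_add_le_mul hp _ _
          · exact le_mul_of_one_le_left' (one_le_mul h2 h9)
      _ = _ := by
          rw [hJ, hJ, ENNReal.mul_rpow_of_nonneg M w hp0.le]; ring
  refine (ENNReal.div_le_div_right hsum _).trans (le_of_eq ?_)
  simp only [div_eq_mul_inv]
  ring

theorem exists_lintegral_rayTerm_le (κ : LipschitzChart Ω z) (hΩ : IsOpen Ω) (hd : 1 ≤ d)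
    {p : ℝ} (hp : 1 < p) :
    ∃ C : ℝ≥0, ∀ g : Space d → ℝ≥0∞, Measurable g → (∀ x ∉ Ω, g x = 0) →
      ∫⁻ a, ∫⁻ b, κ.rayTerm p g a (b - a) ≤ C * ∫⁻ x in Ω, g x ^ p := by
  have hp0 : 0 < p := by linarith
  obtain ⟨C₁, hC₁⟩ := exists_lintegral_ray_le hd hp
  obtain ⟨C₃, hC₃⟩ := κ.exists_lintegral_Ψ_eq
  refine ⟨C₁ * C₃, fun g hg hg0 ↦ ?_⟩
  have e1 : ∀ a, ∫⁻ b, κ.rayTerm p g a (b - a) = ∫⁻ h, κ.rayTerm p g a h := fun a ↦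
    lintegral_sub_right_eq_self (fun b ↦ κ.rayTerm p g a b) a
  simp_rw [e1]
  rw [lintegral_lintegral_swap (κ.measurable_rayTerm p hg).aemeasurable]
  refine (hC₁ (fun q ↦ g (κ.Ψ q.1 q.2)) (hg.comp κ.measurable_Ψ)).trans ?_
  rw [ENNReal.coe_mul, mul_assoc]
  gcongr
  calc ∫⁻ x, ∫⁻ t in Ioi (0 : ℝ), g (κ.Ψ x t) ^ p
      ≤ ∫⁻ x, ∫⁻ t, g (κ.Ψ x t) ^ p := lintegral_mono fun x ↦ setLIntegral_le_lintegral _ _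
    _ = C₃ * ∫⁻ x, g x ^ p := hC₃ (fun x ↦ g x ^ p) (hg.pow_const p)
    _ = C₃ * ∫⁻ x in Ω, g x ^ p := by
      congr 1
      rw [← lintegral_indicator hΩ.measurableSet]
      refine lintegral_congr fun x ↦ ?_
      by_cases hx : x ∈ Ω
      · simp [hx]
      · simp [hx, hg0 x hx, ENNReal.zero_rpow_of_pos hp0]

theorem exists_lintegral_fluxWeight_mul_le (hd : 1 ≤ d) {p : ℝ} (hp : 1 < p) :
    ∃ C : ℝ≥0, ∀ (β : ℝ≥0) (w : EuclideanSpace ℝ (Fin d) → ℝ≥0∞), Measurable w →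
      ∀ D : Set (EuclideanSpace ℝ (Fin d)),
        ∫⁻ a in D, ∫⁻ b in D, fluxWeight d p β (b - a) * w b ≤
          C * ((β : ℝ≥0∞) ^ ((p - 1) / 2) * ∫⁻ b in D, w b) := by
  obtain ⟨C, hC⟩ := exists_lintegral_min_rpow_le hd hp
  refine ⟨C, fun β w hw D ↦ ?_⟩
  have hm : Measurable fun q : EuclideanSpace ℝ (Fin d) × EuclideanSpace ℝ (Fin d) ↦
      fluxWeight d p β (q.2 - q.1) * w q.2 :=
    ((measurable_fluxWeight d p β).comp (measurable_snd.sub measurable_fst)).mul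
      (hw.comp measurable_snd)
  rw [lintegral_lintegral_swap hm.aemeasurable]
  have e1 : ∀ b, ∫⁻ a in D, fluxWeight d p β (b - a) * w b ≤
      C * (β : ℝ≥0∞) ^ ((p - 1) / 2) * w b := fun b ↦ by
    have hb : Measurable fun a ↦ fluxWeight d p β (b - a) :=
      (measurable_fluxWeight d p β).comp (measurable_const.sub measurable_id)
    rw [lintegral_mul_const _ hb]
    gcongr
    refine (setLIntegral_le_lintegral _ _).trans ?_
    rw [lintegral_sub_left_eq_self (fun a ↦ fluxWeight d p β a) b]
    exact hC β
  refine (lintegral_mono e1).trans ?_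
  rw [lintegral_const_mul _ hw, mul_assoc]

/-- The integral of `R a b + R b a + W a b`, where only `R` has to be measurable. -/
theorem lintegral_lintegral_symm_add_le {E : Type*} [MeasureSpace E]
    [SFinite (volume : Measure E)] {R : E → E → ℝ≥0∞} (c : ℝ≥0)
    (hR : Measurable fun q : E × E ↦ R q.1 q.2) (W : E → E → ℝ≥0∞) (D : Set E) :
    ∫⁻ a in D, ∫⁻ b in D, c * (R a b + R b a + W a b) ≤
      c * ((∫⁻ a, ∫⁻ b, R a b) + (∫⁻ a, ∫⁻ b, R a b) + ∫⁻ a in D, ∫⁻ b in D, W a b) := by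
  have hR' : Measurable fun q : E × E ↦ R q.2 q.1 := hR.comp measurable_swap
  have s1 : ∀ a, ∫⁻ b in D, c * (R a b + R b a + W a b) =
      c * ((∫⁻ b in D, R a b) + (∫⁻ b in D, R b a) + ∫⁻ b in D, W a b) := fun a ↦ by
    have k1 : Measurable fun b ↦ R a b := hR.comp (measurable_const.prodMk measurable_id)
    have k2 : Measurable fun b ↦ R b a := hR'.comp (measurable_const.prodMk measurable_id)
    have k12 : Measurable fun b ↦ R a b + R b a := k1.add k2
    rw [lintegral_const_mul' _ _ ENNReal.coe_ne_top, lintegral_add_left k12,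
      lintegral_add_left k1]
  have i1 : Measurable fun a ↦ ∫⁻ b in D, R a b := hR.lintegral_prod_right'
  have i2 : Measurable fun a ↦ ∫⁻ b in D, R b a := hR'.lintegral_prod_right'
  have i12 : Measurable fun a ↦ (∫⁻ b in D, R a b) + ∫⁻ b in D, R b a := i1.add i2
  simp_rw [s1]
  rw [lintegral_const_mul' _ _ ENNReal.coe_ne_top, lintegral_add_left i12,
    lintegral_add_left i1]
  have hle : ∫⁻ a in D, ∫⁻ b in D, R a b ≤ ∫⁻ a, ∫⁻ b, R a b :=
    (setLIntegral_le_lintegral _ _).trans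
      (lintegral_mono fun a ↦ setLIntegral_le_lintegral _ _)
  refine mul_le_mul_right (add_le_add (add_le_add hle ?_) le_rfl) _
  rw [lintegral_lintegral_swap hR'.aemeasurable]
  exact hle

/-- The two rays contribute equally, and the flux term is absorbed by the trace inequality at the
magnetic scale. -/
theorem exists_lintegral_pairMajorant_le (κ : LipschitzChart Ω z) (hΩ : IsOpen Ω) (hd : 1 ≤ d)
    {p : ℝ} (hp : 1 < p) :
    ∃ C : ℝ≥0, ∀ (A : Space d → Space d) (β : ℝ≥0) (V : Space d → ℂ) (g v : Space d → ℝ≥0∞),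
      IsRegularPair Ω A β V g v →
        ∫⁻ a in Metric.ball κ.center κ.r, ∫⁻ b in Metric.ball κ.center κ.r,
          κ.pairMajorant p β g v a b ≤ C * magneticEnergy Ω p β g v := by
  have hp0 : 0 < p := by linarith
  obtain ⟨C₁, hC₁⟩ := κ.exists_lintegral_rayTerm_le hΩ hd hp
  obtain ⟨C₂, hC₂⟩ := exists_lintegral_fluxWeight_mul_le hd hp
  obtain ⟨C₄, hC₄⟩ := κ.exists_rpow_mul_lintegral_F_le_magneticEnergy hΩ hp
  obtain ⟨c, hcc⟩ : ∃ c : ℝ≥0, (c : ℝ≥0∞) = 2 ^ p * 2 ^ p * ENNReal.ofReal 9 ^ p :=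
    ⟨_, ENNReal.coe_toNNReal (ENNReal.mul_ne_top (ENNReal.mul_ne_top
      (ENNReal.rpow_ne_top_of_nonneg hp0.le ENNReal.ofNat_ne_top)
      (ENNReal.rpow_ne_top_of_nonneg hp0.le ENNReal.ofNat_ne_top))
      (ENNReal.rpow_ne_top_of_nonneg hp0.le ENNReal.ofReal_ne_top))⟩
  refine ⟨c * (C₁ + C₁ + C₂ * C₄), fun A β V g v h ↦ ?_⟩
  have hmF : Measurable fun b ↦ v (κ.F b) ^ p :=
    (h.measurable_abs.comp κ.lipschitzWith_F.continuous.measurable).pow_const p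
  have hray := (hC₁ g h.measurable_grad h.grad_eq_zero).trans
    (mul_le_mul_right (setLIntegral_le_magneticEnergy Ω p β g v) _)
  have hflux := (hC₂ β _ hmF (Metric.ball κ.center κ.r)).trans
    (mul_le_mul_right (hC₄ A β V g v h) _)
  rw [← mul_assoc] at hflux
  simp_rw [pairMajorant, ← hcc]
  refine (lintegral_lintegral_symm_add_le (R := fun a b ↦ κ.rayTerm p g a (b - a)) c
    (κ.measurable_rayTerm_sub p h.measurable_grad) _ _).trans ?_
  rw [ENNReal.coe_mul, mul_assoc, ENNReal.coe_add, ENNReal.coe_add, ENNReal.coe_mul, add_mul,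
    add_mul]
  exact mul_le_mul_right (add_le_add (add_le_add hray hray) hflux) _

/-- Double integrals over the boundary, in the parameters of a chart. -/
theorem setLIntegral_setLIntegral_surfaceMeasure_le (κ : LipschitzChart Ω z)
    {H : EuclideanSpace ℝ (Fin d) → EuclideanSpace ℝ (Fin d) → ℝ≥0∞}
    (hH : Measurable fun q : EuclideanSpace ℝ (Fin d) × EuclideanSpace ℝ (Fin d) ↦ H q.1 q.2) :
    ∫⁻ x in Metric.ball z κ.r, ∫⁻ y in Metric.ball z κ.r,
        H (κ.T.symm x).1 (κ.T.symm y).1 ∂surfaceMeasure Ω ∂surfaceMeasure Ω ≤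
      2 ^ d * (2 ^ d * ∫⁻ a in Metric.ball κ.center κ.r, ∫⁻ b in Metric.ball κ.center κ.r,
        H a b) := by
  have hπ : Measurable fun x ↦ (κ.T.symm x).1 :=
    measurable_fst.comp κ.T.symm.continuous.measurable
  have hF : ∀ a, (κ.T.symm (κ.F a)).1 = a := fun a ↦ by simp [F]
  have h1 : ∀ x, ∫⁻ y in Metric.ball z κ.r, H (κ.T.symm x).1 (κ.T.symm y).1 ∂surfaceMeasure Ω ≤
      2 ^ d * ∫⁻ b in Metric.ball κ.center κ.r, H (κ.T.symm x).1 b := fun x ↦ by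
    have := κ.setLIntegral_surfaceMeasure_le (f := fun y ↦ H (κ.T.symm x).1 (κ.T.symm y).1)
      (hH.comp (measurable_const.prodMk hπ))
    simpa only [hF] using this
  refine (lintegral_mono h1).trans ?_
  have hm : Measurable fun x ↦ ∫⁻ b in Metric.ball κ.center κ.r, H (κ.T.symm x).1 b :=
    Measurable.comp (g := fun a ↦ ∫⁻ b in Metric.ball κ.center κ.r, H a b)
      hH.lintegral_prod_right' hπ
  rw [lintegral_const_mul _ hm]
  gcongr
  have := κ.setLIntegral_surfaceMeasure_le
    (f := fun x ↦ ∫⁻ b in Metric.ball κ.center κ.r, H (κ.T.symm x).1 b) hm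
  simpa only [hF] using this

/-- The part of the Gagliardo integral that comes from pairs of close points, one of which is close
to `z`. -/
theorem exists_close_majorant (κ : LipschitzChart Ω z) (hΩ : IsOpen Ω) (hd : 1 ≤ d) {p : ℝ}
    (hp : 1 < p) :
    ∃ C : ℝ≥0, ∀ (A ν : Space d → Space d) (β : ℝ≥0) (V : Space d → ℂ) (g v : Space d → ℝ≥0∞),
      IsRegularPair Ω A β V g v → (∀ z ∈ frontier Ω, IsUnitNormal Ω z (ν z)) →
      ∃ N : Space d × Space d → ℝ≥0∞, Measurable N ∧
        (∀ x ∈ frontier Ω, ∀ y ∈ frontier Ω, x ∈ Metric.ball z (κ.r / 2) → x ≠ y →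
          20 * ‖y - x‖ ≤ κ.r → ENNReal.ofReal (2 * ‖y - x‖) < injRadius (frontier Ω) →
          gagliardoIntegrand Ω p (tangentialPart ν A) V x y ≤ N (x, y)) ∧
        ∫⁻ x, ∫⁻ y, N (x, y) ∂surfaceMeasure Ω ∂surfaceMeasure Ω ≤
          C * magneticEnergy Ω p β g v := by
  obtain ⟨C, hC⟩ := κ.exists_lintegral_pairMajorant_le hΩ hd hp
  refine ⟨2 ^ d * (2 ^ d * C), fun A ν β V g v h hν ↦ ?_⟩
  obtain ⟨H, hH, hHm⟩ : ∃ H, H = κ.pairMajorant p β g v ∧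
      Measurable fun q : EuclideanSpace ℝ (Fin d) × EuclideanSpace ℝ (Fin d) ↦ H q.1 q.2 :=
    ⟨_, rfl, κ.measurable_pairMajorant p β h.measurable_grad h.measurable_abs⟩
  have hπ : Measurable fun x ↦ (κ.T.symm x).1 :=
    measurable_fst.comp κ.T.symm.continuous.measurable
  have key := κ.setLIntegral_setLIntegral_surfaceMeasure_le hHm
  have hD : MeasurableSet (Metric.ball z κ.r) := measurableSet_ball
  have hHC := hC A β V g v h
  rw [← hH] at hHC
  refine ⟨(Metric.ball z κ.r ×ˢ Metric.ball z κ.r).indicator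
    fun q ↦ H (κ.T.symm q.1).1 (κ.T.symm q.2).1, ?_, ?_, ?_⟩
  · refine Measurable.indicator ?_ (hD.prod hD)
    exact hHm.comp ((hπ.comp measurable_fst).prodMk (hπ.comp measurable_snd))
  · intro x hx y hy hxz hxy hr hinj
    rw [mem_ball_iff_norm] at hxz
    have hr0 := κ.r_pos
    have hxD : x ∈ Metric.ball z κ.r := by rw [mem_ball_iff_norm]; linarith
    have hyD : y ∈ Metric.ball z κ.r := by
      rw [mem_ball_iff_norm, ← sub_add_sub_cancel y x z]
      refine (norm_add_le _ _).trans_lt ?_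
      linarith
    rw [indicator_of_mem (mk_mem_prod hxD hyD)]
    have ex : κ.F (κ.T.symm x).1 = x := κ.graph x hx hxD
    have ey : κ.F (κ.T.symm y).1 = y := κ.graph y hy hyD
    have hle := κ.gagliardoIntegrand_le_pairMajorant hΩ hp h hν (a := (κ.T.symm x).1)
      (b := (κ.T.symm y).1) (fun e ↦ hxy (by rw [← ex, ← ey, e])) (by rwa [ex]) (by rwa [ex, ey])
      (by rwa [ex, ey])
    rwa [ex, ey, ← hH] at hle
  · generalize Metric.ball z κ.r = D at hD key ⊢
    have e : ∀ x, ∫⁻ y, (D ×ˢ D).indicator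
        (fun q : Space d × Space d ↦ H (κ.T.symm q.1).1 (κ.T.symm q.2).1) (x, y)
          ∂surfaceMeasure Ω = D.indicator
        (fun x ↦ ∫⁻ y in D, H (κ.T.symm x).1 (κ.T.symm y).1 ∂surfaceMeasure Ω) x := fun x ↦ by
      by_cases hx : x ∈ D
      · rw [indicator_of_mem hx, ← lintegral_indicator hD]
        refine lintegral_congr fun y ↦ ?_
        by_cases hy : y ∈ D <;> simp [hx, hy]
      · rw [indicator_of_notMem hx]
        simp [hx]
    simp_rw [e]
    rw [lintegral_indicator hD]
    refine key.trans ?_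
    push_cast
    rw [mul_assoc, mul_assoc]
    gcongr

end LipschitzChart

/-! ### The estimate for smooth functions -/

variable {d : ℕ} {Ω : Set (Space d)}

theorem isCompact_frontier (hΩ : IsBoundedC1Domain Ω) : IsCompact (frontier Ω) :=
  Metric.isCompact_of_isClosed_isBounded isClosed_frontier
    (hΩ.isBounded.closure.subset frontier_subset_closure)

/-- The surface measure only charges the boundary, so that it is controlled by its restrictions
to the members of a cover of the boundary. -/
theorem lintegral_surfaceMeasure_le_sum {ι : Type*} (t : Finset ι) {D : ι → Set (Space d)}
    (hD : frontier Ω ⊆ ⋃ i ∈ t, D i) (f : Space d → ℝ≥0∞) :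
    ∫⁻ x, f x ∂surfaceMeasure Ω ≤ ∑ i ∈ t, ∫⁻ x in D i, f x ∂surfaceMeasure Ω := by
  have h1 : surfaceMeasure Ω ≤ ∑ i ∈ t, (surfaceMeasure Ω).restrict (D i) := by
    refine Measure.le_iff.2 fun s hs ↦ ?_
    rw [Measure.finsetSum_apply]
    simp_rw [Measure.restrict_apply hs]
    have h2 : surfaceMeasure Ω s = surfaceMeasure Ω (s ∩ frontier Ω) := by
      rw [surfaceMeasure, Measure.restrict_apply hs,
        Measure.restrict_apply (hs.inter isClosed_frontier.measurableSet), inter_assoc, inter_self]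
    rw [h2]
    refine (measure_mono (inter_subset_inter_right s hD)).trans ?_
    rw [inter_iUnion₂]
    exact measure_biUnion_finset_le t _
  refine (lintegral_mono' h1 le_rfl).trans ?_
  rw [lintegral_finsetSum_measure]

theorem exists_lipschitzChart_cover (hΩ : IsBoundedC1Domain Ω) :
    ∃ (t : Finset (frontier Ω)) (κ : ∀ z : frontier Ω, LipschitzChart Ω z),
      frontier Ω ⊆ ⋃ z ∈ t, Metric.ball (z : Space d) ((κ z).r / 2) := by
  have κ : ∀ z : frontier Ω, LipschitzChart Ω z := fun z ↦
    (nonempty_lipschitzChart hΩ z.2).some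
  obtain ⟨t, ht⟩ := (isCompact_frontier hΩ).elim_nhds_subcover'
    (fun z hz ↦ Metric.ball z ((κ ⟨z, hz⟩).r / 2))
    fun z hz ↦ Metric.ball_mem_nhds z (half_pos (κ ⟨z, hz⟩).r_pos)
  exact ⟨t, κ, ht⟩

theorem isFiniteMeasure_surfaceMeasure (hΩ : IsBoundedC1Domain Ω) :
    IsFiniteMeasure (surfaceMeasure Ω) := by
  obtain ⟨t, κ, ht⟩ := exists_lipschitzChart_cover hΩ
  refine ⟨?_⟩
  have h := lintegral_surfaceMeasure_le_sum (Ω := Ω) t (D := fun z ↦ Metric.ball z (κ z).r)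
    (ht.trans (iUnion₂_mono fun z _ ↦ Metric.ball_subset_ball (by linarith [(κ z).r_pos])))
    fun _ ↦ 1
  rw [lintegral_one] at h
  refine h.trans_lt (ENNReal.sum_lt_top.2 fun z _ ↦ ?_)
  refine ((κ z).setLIntegral_surfaceMeasure_le measurable_const).trans_lt ?_
  rw [setLIntegral_one]
  exact ENNReal.mul_lt_top (by simp) measure_ball_lt_top

/-- The trace inequality. -/
theorem exists_lintegral_surfaceMeasure_le (hΩ : IsBoundedC1Domain Ω) {p : ℝ} (hp : 1 < p) :
    ∃ C : ℝ≥0, ∀ (A : Space d → Space d) (β : ℝ≥0) (V : Space d → ℂ) (g v : Space d → ℝ≥0∞),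
      IsRegularPair Ω A β V g v →
        ∫⁻ x, v x ^ p ∂surfaceMeasure Ω ≤ C * magneticEnergy Ω p β g v := by
  obtain ⟨t, κ, ht⟩ := exists_lipschitzChart_cover hΩ
  choose C hC using fun z ↦ (κ z).exists_lintegral_F_le_magneticEnergy hΩ.isOpen hp
  refine ⟨∑ z ∈ t, 2 ^ d * C z, fun A β V g v h ↦ ?_⟩
  have h1 := lintegral_surfaceMeasure_le_sum (Ω := Ω) t (D := fun z ↦ Metric.ball z (κ z).r)
    (ht.trans (iUnion₂_mono fun z _ ↦ Metric.ball_subset_ball (by linarith [(κ z).r_pos])))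
    fun x ↦ v x ^ p
  refine h1.trans ?_
  push_cast
  rw [Finset.sum_mul]
  refine Finset.sum_le_sum fun z _ ↦ ?_
  refine ((κ z).setLIntegral_surfaceMeasure_le (h.measurable_abs.pow_const p)).trans ?_
  rw [mul_assoc]
  exact mul_le_mul_right (hC z A β V g v h) _

/-- For pairs at distance at least `δ`, the phase plays no role. -/
theorem gagliardoIntegrand_le_of_le_norm {p : ℝ} (hp : 1 < p) (B : Space d → Space d)
    {V : Space d → ℂ} {x y : Space d} {δ : ℝ} (hδ : δ ≤ ‖y - x‖) :
    gagliardoIntegrand Ω p B V x y ≤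
      2 ^ p / ENNReal.ofReal δ ^ ((d : ℝ) + p - 1) * (‖V x‖ₑ ^ p + ‖V y‖ₑ ^ p) := by
  have hp0 : 0 < p := by linarith
  have hn : ‖Complex.exp (Complex.I * (geodesicPotential (frontier Ω) B x y : ℂ))‖ₑ = 1 := by
    rw [mul_comm, ← enorm_norm, Complex.norm_exp_ofReal_mul_I]; simp
  have h1 : ‖Complex.exp (Complex.I * (geodesicPotential (frontier Ω) B x y : ℂ)) * V y -
      V x‖ₑ ≤ ‖V x‖ₑ + ‖V y‖ₑ := by
    refine enorm_sub_le.trans ?_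
    rw [enorm_mul, hn, one_mul, add_comm]
  have h2 : ENNReal.ofReal δ ^ ((d : ℝ) + p - 1) ≤ ‖y - x‖ₑ ^ ((d : ℝ) + p - 1) := by
    have : 0 ≤ (d : ℝ) + p - 1 := by have := Nat.cast_nonneg (α := ℝ) d; linarith
    rw [← ofReal_norm]
    gcongr
  calc gagliardoIntegrand Ω p B V x y
      ≤ (‖V x‖ₑ + ‖V y‖ₑ) ^ p / ENNReal.ofReal δ ^ ((d : ℝ) + p - 1) :=
        ENNReal.div_le_div (ENNReal.rpow_le_rpow h1 hp0.le) h2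
    _ ≤ (2 ^ p * (‖V x‖ₑ ^ p + ‖V y‖ₑ ^ p)) / ENNReal.ofReal δ ^ ((d : ℝ) + p - 1) :=
        ENNReal.div_le_div_right (rpow_add_le_mul hp _ _) _
    _ = _ := ENNReal.mul_div_right_comm

/-- For smooth functions, the Gagliardo integrand has a measurable majorant off the diagonal, whose
integral is controlled by the magnetic energy. -/
theorem exists_gagliardoIntegrand_majorant (hd : 1 ≤ d) {p : ℝ} (hp : 1 < p)
    (hΩ : IsBoundedC1Domain Ω) (hinj : 0 < injRadius (frontier Ω)) :
    ∃ C : ℝ≥0, ∀ (A ν : Space d → Space d) (β : ℝ≥0) (V : Space d → ℂ) (g v : Space d → ℝ≥0∞),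
      IsRegularPair Ω A β V g v → (∀ z ∈ frontier Ω, IsUnitNormal Ω z (ν z)) →
      ∃ N : Space d × Space d → ℝ≥0∞, Measurable N ∧
        (∀ x ∈ frontier Ω, ∀ y ∈ frontier Ω, x ≠ y →
          gagliardoIntegrand Ω p (tangentialPart ν A) V x y ≤ N (x, y)) ∧
        ∫⁻ x, ∫⁻ y, N (x, y) ∂surfaceMeasure Ω ∂surfaceMeasure Ω ≤
          C * magneticEnergy Ω p β g v := by
  have hp0 : 0 < p := by linarith
  have := isFiniteMeasure_surfaceMeasure hΩ
  obtain ⟨t, κ, ht⟩ := exists_lipschitzChart_cover hΩ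
  -- the threshold between close and distant pairs
  obtain ⟨δ, ⟨hδr, hδi⟩, hδ⟩ : ∃ δ : ℝ, ((∀ z ∈ t, 20 * δ ≤ (κ z).r) ∧
      ENNReal.ofReal (2 * δ) < injRadius (frontier Ω)) ∧ 0 < δ := by
    have h1 : ∀ᶠ δ : ℝ in 𝓝[>] 0, ∀ z ∈ t, 20 * δ ≤ (κ z).r := by
      refine (Finset.eventually_all t).2 fun z _ ↦ ?_
      filter_upwards [Ioo_mem_nhdsGT (show (0 : ℝ) < (κ z).r / 20 by
        have := (κ z).r_pos; positivity)] with δ hδ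
      linarith [hδ.2]
    have h2 : ∀ᶠ δ : ℝ in 𝓝[>] 0, ENNReal.ofReal (2 * δ) < injRadius (frontier Ω) := by
      have h3 : Tendsto (fun δ : ℝ ↦ ENNReal.ofReal (2 * δ)) (𝓝[>] 0) (𝓝 0) := by
        have : Tendsto (fun δ : ℝ ↦ ENNReal.ofReal (2 * δ)) (𝓝 0)
            (𝓝 (ENNReal.ofReal (2 * 0))) :=
          (ENNReal.continuous_ofReal.comp (continuous_const.mul continuous_id)).tendsto 0
        rw [mul_zero, ENNReal.ofReal_zero] at this
        exact this.mono_left nhdsWithin_le_nhds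
      exact h3.eventually_lt_const hinj
    exact ((h1.and h2).and self_mem_nhdsWithin).exists
  choose C hC using fun z ↦ (κ z).exists_close_majorant hΩ.isOpen hd hp
  obtain ⟨C₀, hC₀⟩ := exists_lintegral_surfaceMeasure_le hΩ hp
  obtain ⟨K, hK⟩ : ∃ K : ℝ≥0, (K : ℝ≥0∞) = 2 ^ p / ENNReal.ofReal δ ^ ((d : ℝ) + p - 1) := by
    refine ⟨_, ENNReal.coe_toNNReal (ENNReal.div_ne_top
      (ENNReal.rpow_ne_top_of_nonneg hp0.le ENNReal.ofNat_ne_top) ?_)⟩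
    exact (ENNReal.rpow_pos (by simpa using hδ) ENNReal.ofReal_ne_top).ne'
  set m : ℝ≥0 := (surfaceMeasure Ω univ).toNNReal with hm
  have hmσ : surfaceMeasure Ω univ = m := (ENNReal.coe_toNNReal (measure_ne_top _ _)).symm
  refine ⟨∑ z ∈ t, C z + K * (m * C₀ + m * C₀), fun A ν β V g v h hν ↦ ?_⟩
  choose N hNm hNle hNint using fun z ↦ hC z A ν β V g v h hν
  have hvm : Measurable fun x ↦ v x ^ p := h.measurable_abs.pow_const p
  have hSm : Measurable fun q : Space d × Space d ↦ ∑ z ∈ t, N z q :=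
    Finset.measurable_sum _ fun z _ ↦ hNm z
  refine ⟨fun q ↦ ∑ z ∈ t, N z q + K * (v q.1 ^ p + v q.2 ^ p), ?_, ?_, ?_⟩
  · exact hSm.add (((hvm.comp measurable_fst).add (hvm.comp measurable_snd)).const_mul _)
  · intro x hx y hy hxy
    rcases le_total ‖y - x‖ δ with hle | hle
    · obtain ⟨z, hz, hxz⟩ := mem_iUnion₂.1 (ht hx)
      refine (hNle z x hx y hy hxz hxy ?_ ?_).trans ?_
      · linarith [hδr z hz]
      · exact (ENNReal.ofReal_le_ofReal (by linarith)).trans_lt hδi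
      · exact (Finset.single_le_sum (f := fun z ↦ N z (x, y)) (fun _ _ ↦ zero_le) hz).trans
          le_self_add
    · refine (gagliardoIntegrand_le_of_le_norm hp _ hle).trans ?_
      rw [← hK, h.abs_eq x (frontier_subset_closure hx), h.abs_eq y (frontier_subset_closure hy)]
      exact le_add_self
  · have e1 : ∀ x, ∫⁻ y, ∑ z ∈ t, N z (x, y) + K * (v x ^ p + v y ^ p) ∂surfaceMeasure Ω =
        (∑ z ∈ t, ∫⁻ y, N z (x, y) ∂surfaceMeasure Ω) +
          K * (m * v x ^ p + ∫⁻ y, v y ^ p ∂surfaceMeasure Ω) := fun x ↦ by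
      have hNx : ∀ z, Measurable fun y ↦ N z (x, y) := fun z ↦
        (hNm z).comp (measurable_const.prodMk measurable_id)
      rw [lintegral_add_left (Finset.measurable_sum _ fun z _ ↦ hNx z),
        lintegral_finsetSum _ fun z _ ↦ hNx z, lintegral_const_mul' _ _ ENNReal.coe_ne_top,
        lintegral_add_left measurable_const, lintegral_const, hmσ, mul_comm (m : ℝ≥0∞)]
    simp_rw [e1]
    have hNi : ∀ z, Measurable fun x ↦ ∫⁻ y, N z (x, y) ∂surfaceMeasure Ω := fun z ↦
      (hNm z).lintegral_prod_right'
    rw [lintegral_add_left (Finset.measurable_sum _ fun z _ ↦ hNi z),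
      lintegral_finsetSum _ fun z _ ↦ hNi z, lintegral_const_mul' _ _ ENNReal.coe_ne_top,
      lintegral_add_left (hvm.const_mul _), lintegral_const_mul _ hvm, lintegral_const, hmσ,
      mul_comm _ (m : ℝ≥0∞)]
    have h0 := hC₀ A β V g v h
    push_cast
    rw [add_mul, Finset.sum_mul, mul_assoc, add_mul, mul_assoc]
    gcongr with z hz
    exact hNint z

/-! ### From smooth functions to Sobolev functions -/

theorem edist_le_intrinsicDist (S : Set (Space d)) (x y : Space d) :
    edist x y ≤ intrinsicDist S x y := by
  refine le_iInf₂ fun γ hγ ↦ ?_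
  have := eVariationOn.edist_le γ (s := Icc (0 : ℝ) 1) (x := 0) (y := 1) (by simp) (by simp)
  rwa [hγ.source, hγ.target] at this

theorem surfaceMeasure_singleton (hd : 1 ≤ d) (x : Space d) : surfaceMeasure Ω {x} = 0 := by
  have : NullSingletonClass (Measure.hausdorffMeasure (X := Space d) (d : ℝ)) :=
    Measure.nullSingletonClass_hausdorff _ (by exact_mod_cast hd)
  refine le_antisymm ((Measure.restrict_apply_le _ _).trans ?_) zero_le
  rw [Measure.euclideanHausdorffMeasure_def, Measure.smul_apply, measure_singleton, smul_zero]

/-- When the injectivity radius vanishes, there is nothing to integrate. -/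
theorem boundaryGagliardo_eq_zero (hd : 1 ≤ d) (hinj : injRadius (frontier Ω) = 0) (p : ℝ)
    (B : Space d → Space d) (u : Space d → ℂ) : boundaryGagliardo Ω p B u = 0 := by
  have h : ∀ x, surfaceMeasure Ω
      {y | intrinsicDist (frontier Ω) y x ≤ injRadius (frontier Ω)} = 0 := fun x ↦ by
    refine measure_mono_null (fun y hy ↦ ?_) (surfaceMeasure_singleton hd x)
    rw [mem_ofPred_eq, hinj] at hy
    exact edist_le_zero.1 ((edist_le_intrinsicDist _ _ _).trans hy)
  rw [boundaryGagliardo]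
  simp_rw [setLIntegral_measure_zero _ _ (h _)]
  exact lintegral_zero

/-- The complex vector `i w a`. -/
def potentialMul (a : Space d) (w : ℂ) : CSpace d :=
  WithLp.toLp 2 fun j ↦ Complex.I * ((a j : ℝ) : ℂ) * w

theorem norm_potentialMul (a : Space d) (w : ℂ) : ‖potentialMul a w‖ = ‖a‖ * ‖w‖ := by
  rw [EuclideanSpace.norm_eq, EuclideanSpace.norm_eq, ← Real.sqrt_sq (norm_nonneg w),
    ← Real.sqrt_mul (by positivity), Finset.sum_mul]
  congr 1
  refine Finset.sum_congr rfl fun j _ ↦ ?_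
  simp [potentialMul, mul_pow]

theorem continuous_potentialMul :
    Continuous fun q : Space d × ℂ ↦ potentialMul q.1 q.2 := by
  refine (PiLp.continuous_toLp 2 _).comp (continuous_pi fun j ↦ ?_)
  fun_prop

theorem aestronglyMeasurable_potentialMul {μ : Measure (Space d)} {a : Space d → Space d}
    {w : Space d → ℂ} (ha : AEStronglyMeasurable a μ) (hw : AEStronglyMeasurable w μ) :
    AEStronglyMeasurable (fun x ↦ potentialMul (a x) (w x)) μ :=
  Continuous.comp_aestronglyMeasurable₂ (g := potentialMul) continuous_potentialMul ha hw

/-- The difference of two covariant gradients. -/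
theorem covariantGradient_eq_add (A : Space d → Space d) (V U : Space d → ℂ)
    (H G : Space d → CSpace d) :
    covariantGradient A V H =
      ((fun x ↦ H x - G x) + fun x ↦ potentialMul (A x) (V x - U x)) +
        covariantGradient A U G := by
  ext x j
  simp only [covariantGradient, potentialMul, Pi.add_apply, PiLp.add_apply, PiLp.sub_apply]
  ring

theorem continuousOn_covariantGradient (hΩ : IsOpen Ω) {A : Space d → Space d} {V : Space d → ℂ}
    (hA : ContinuousOn A Ω) (hV : ContDiffOn ℝ 1 V Ω) :
    ContinuousOn (covariantGradient A V (grad V)) Ω := by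
  have h1 := hV.continuousOn_fderiv_of_isOpen hΩ le_rfl
  have h2 := hV.continuousOn
  refine (PiLp.continuous_toLp 2 _).comp_continuousOn (continuousOn_pi.2 fun j ↦ ?_)
  have hAj : ContinuousOn (fun x ↦ A x j) Ω :=
    (EuclideanSpace.proj (𝕜 := ℝ) j).continuous.comp_continuousOn hA
  refine ContinuousOn.add (h1.clm_apply continuousOn_const) ?_
  exact (continuousOn_const.mul (Complex.continuous_ofReal.comp_continuousOn hAj)).mul h2

theorem isRegularPair (hΩ : IsOpen Ω) {A : Space d → Space d} {β : ℝ≥0} {V : Space d → ℂ}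
    (hA : ContDiffOn ℝ 1 A (closure Ω))
    (hβ : eLpNorm (magneticField A) ⊤ (volume.restrict Ω) ≤ β)
    (hV : ContDiffOn ℝ 1 V (closure Ω)) :
    IsRegularPair Ω A β V (Ω.indicator fun x ↦ ‖covariantGradient A V (grad V) x‖ₑ)
      ((closure Ω).indicator fun x ↦ ‖V x‖ₑ) where
  curlBound := curlBoundOn_of_eLpNorm_magneticField_le hΩ (hA.mono subset_closure) hβ
  contDiffOn_potential := hA.mono subset_closure
  continuousOn_potential := hA.continuousOn
  contDiffOn := hV.mono subset_closure
  continuousOn := hV.continuousOn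
  measurable_grad := by
    classical
    rw [← piecewise_eq_indicator]
    exact (continuousOn_covariantGradient hΩ (hA.continuousOn.mono subset_closure)
      (hV.mono subset_closure)).enorm.measurable_piecewise continuousOn_const hΩ.measurableSet
  measurable_abs := by
    classical
    rw [← piecewise_eq_indicator]
    exact hV.continuousOn.enorm.measurable_piecewise continuousOn_const
      isClosed_closure.measurableSet
  grad_eq x hx := (indicator_of_mem hx fun x ↦ ‖covariantGradient A V (grad V) x‖ₑ).symm
  grad_eq_zero x hx := indicator_of_notMem hx _
  abs_eq x hx := (indicator_of_mem hx fun x ↦ ‖V x‖ₑ).symm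

theorem magneticEnergy_eq (hΩ : IsOpen Ω) {p : ℝ} (hp : 1 < p) (β : ℝ≥0) (A : Space d → Space d)
    (V : Space d → ℂ) :
    magneticEnergy Ω p β (Ω.indicator fun x ↦ ‖covariantGradient A V (grad V) x‖ₑ)
      ((closure Ω).indicator fun x ↦ ‖V x‖ₑ) =
      eLpNorm (covariantGradient A V (grad V)) (ENNReal.ofReal p) (volume.restrict Ω) ^ p +
        (1 + (β : ℝ≥0∞) ^ (p / 2)) * eLpNorm V (ENNReal.ofReal p) (volume.restrict Ω) ^ p := by
  have hp0 : 0 < p := by linarith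
  have h0 : ENNReal.ofReal p ≠ 0 := by simpa using hp0
  have hpow : ∀ a : ℝ≥0∞, (a ^ (1 / p)) ^ p = a := fun a ↦ by
    rw [← ENNReal.rpow_mul, one_div_mul_cancel hp0.ne', ENNReal.rpow_one]
  rw [eLpNorm_eq_lintegral_rpow_enorm_toReal h0 ENNReal.ofReal_ne_top,
    eLpNorm_eq_lintegral_rpow_enorm_toReal h0 ENNReal.ofReal_ne_top, ENNReal.toReal_ofReal hp0.le,
    hpow, hpow, magneticEnergy]
  congr 1
  · refine setLIntegral_congr_fun hΩ.measurableSet fun x hx ↦ ?_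
    simp only [indicator_of_mem hx]
  · congr 1
    refine setLIntegral_congr_fun hΩ.measurableSet fun x hx ↦ ?_
    simp only [indicator_of_mem (subset_closure hx)]

/-- The covariant gradients of an approximating sequence are controlled by that of the limit. -/
theorem exists_eLpNorm_covariantGradient_le (hΩ : IsBoundedC1Domain Ω) {p : ℝ} (hp : 1 < p)
    {A : Space d → Space d} (hA : ContDiffOn ℝ 1 A (closure Ω)) {U : Space d → ℂ}
    {G : Space d → CSpace d} (hU : MemMagneticSobolev Ω A p U G) :
    ∃ M : ℝ≥0, ∀ V : Space d → ℂ, ContDiffOn ℝ 1 V (closure Ω) →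
      eLpNorm (covariantGradient A V (grad V)) (ENNReal.ofReal p) (volume.restrict Ω) ≤
        eLpNorm (fun x ↦ grad V x - G x) (ENNReal.ofReal p) (volume.restrict Ω) +
        M * eLpNorm (fun x ↦ V x - U x) (ENNReal.ofReal p) (volume.restrict Ω) +
        eLpNorm (covariantGradient A U G) (ENNReal.ofReal p) (volume.restrict Ω) := by
  have hp1 : 1 ≤ ENNReal.ofReal p := by simpa using hp.le
  obtain ⟨M, hM⟩ := (Metric.isCompact_of_isClosed_isBounded isClosed_closure
    hΩ.isBounded.closure).exists_bound_of_continuousOn hA.continuousOn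
  refine ⟨M.toNNReal, fun V hV ↦ ?_⟩
  have hVm : AEStronglyMeasurable V (volume.restrict Ω) :=
    (hV.continuousOn.mono subset_closure).aestronglyMeasurable hΩ.isOpen.measurableSet
  have hgm : AEStronglyMeasurable (grad V) (volume.restrict Ω) := by
    refine ContinuousOn.aestronglyMeasurable ?_ hΩ.isOpen.measurableSet
    have h1 := (hV.mono subset_closure).continuousOn_fderiv_of_isOpen hΩ.isOpen le_rfl
    exact (PiLp.continuous_toLp 2 _).comp_continuousOn
      (continuousOn_pi.2 fun j ↦ h1.clm_apply continuousOn_const)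
  have hAm : AEStronglyMeasurable A (volume.restrict Ω) :=
    (hA.continuousOn.mono subset_closure).aestronglyMeasurable hΩ.isOpen.measurableSet
  have hGm : AEStronglyMeasurable G (volume.restrict Ω) :=
    hU.hasWeakGradient.locallyIntegrableOn_grad.aestronglyMeasurable
  have hD : AEStronglyMeasurable (fun x ↦ V x - U x) (volume.restrict Ω) :=
    hVm.sub hU.memLp.aestronglyMeasurable
  have hWm : AEStronglyMeasurable (fun x ↦ potentialMul (A x) (V x - U x))
      (volume.restrict Ω) :=
    aestronglyMeasurable_potentialMul hAm hD
  have hWle : eLpNorm (fun x ↦ potentialMul (A x) (V x - U x)) (ENNReal.ofReal p)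
      (volume.restrict Ω) ≤
      M.toNNReal * eLpNorm (fun x ↦ V x - U x) (ENNReal.ofReal p) (volume.restrict Ω) := by
    refine eLpNorm_le_mul_eLpNorm_of_ae_le_mul (c := M) ?_ _
    filter_upwards [ae_restrict_mem hΩ.isOpen.measurableSet] with x hx
    rw [norm_potentialMul]
    gcongr
    exact hM x (subset_closure hx)
  rw [covariantGradient_eq_add A V U (grad V) G]
  refine (eLpNorm_add_le ((hgm.sub hGm).add hWm)
    hU.memLp_covariantGradient.aestronglyMeasurable hp1).trans ?_
  gcongr
  exact (eLpNorm_add_le (hgm.sub hGm) hWm hp1).trans (add_le_add le_rfl hWle)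

/-- The integrands of an approximating sequence converge. -/
theorem gagliardoIntegrand_le_liminf {p : ℝ} (B : Space d → Space d)
    {V : ℕ → Space d → ℂ} {u : Space d → ℂ} {x y : Space d} (hxy : x ≠ y)
    (hx : Tendsto (fun n ↦ V n x) atTop (𝓝 (u x))) (hy : Tendsto (fun n ↦ V n y) atTop (𝓝 (u y)))
    {N : ℕ → ℝ≥0∞} (hN : ∀ n, gagliardoIntegrand Ω p B (V n) x y ≤ N n) :
    gagliardoIntegrand Ω p B u x y ≤ liminf N atTop := by
  have hne : ‖y - x‖ₑ ^ ((d : ℝ) + p - 1) ≠ 0 :=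
    (ENNReal.rpow_pos (by simpa [sub_eq_zero] using hxy.symm) enorm_ne_top).ne'
  have h1 : Tendsto (fun n ↦ gagliardoIntegrand Ω p B (V n) x y) atTop
      (𝓝 (gagliardoIntegrand Ω p B u x y)) := by
    refine ENNReal.Tendsto.div_const ?_ (Or.inr hne)
    exact ((ENNReal.continuous_rpow_const (y := p)).tendsto _).comp
      (((tendsto_const_nhds.mul hy).sub hx).enorm)
  rw [← h1.liminf_eq]
  exact liminf_le_liminf (Eventually.of_forall hN)

/-- Fatou's lemma for iterated integrals. -/
theorem lintegral_lintegral_liminf_le {X : Type*} [MeasurableSpace X] {σ : Measure X} [SFinite σ]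
    {N : ℕ → X × X → ℝ≥0∞} (hN : ∀ n, Measurable (N n)) :
    ∫⁻ x, ∫⁻ y, liminf (fun n ↦ N n (x, y)) atTop ∂σ ∂σ ≤
      liminf (fun n ↦ ∫⁻ x, ∫⁻ y, N n (x, y) ∂σ ∂σ) atTop := by
  refine (lintegral_mono fun x ↦ lintegral_liminf_le fun n ↦
    (hN n).comp (measurable_const.prodMk measurable_id)).trans ?_
  exact lintegral_liminf_le fun n ↦ (hN n).lintegral_prod_right'

end MagneticTrace

end

theorem mainTheorem7 (d : ℕ) (hd : 1 ≤ d) (p : ℝ) (hp : 1 < p)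
    (Ω : Set (Space d)) (hΩ : IsBoundedC1Domain Ω) :
    ∃ C : ℝ≥0, 0 < C ∧
      ∀ (A : Space d → Space d) (β : ℝ≥0),
        ContDiffOn ℝ 1 A (closure Ω) →
        eLpNorm (magneticField A) ∞ (volume.restrict Ω) ≤ β →
        ∀ (U : Space d → ℂ) (gradU : Space d → CSpace d),
          MemMagneticSobolev Ω A p U gradU →
          ∀ u : Space d → ℂ, IsTrace Ω p U gradU u →
            ∀ ν : Space d → Space d, (∀ z ∈ frontier Ω, IsUnitNormal Ω z (ν z)) →
              boundaryGagliardo Ω p (tangentialPart ν A) u ≤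
                C * ∫⁻ x in Ω, (‖covariantGradient A U gradU x‖ₑ ^ p +
                  (1 + (β : ℝ≥0∞) ^ (p / 2)) * ‖U x‖ₑ ^ p) := by
  have hp0 : 0 < p := by linarith
  have hpo : ENNReal.ofReal p ≠ 0 := by simpa using hp0
  rcases eq_or_ne (injRadius (frontier Ω)) 0 with hinj | hinj
  · exact ⟨1, one_pos, fun A β _ _ U gradU _ u _ ν _ ↦ by
      rw [boundaryGagliardo_eq_zero hd hinj]; exact zero_le⟩
  obtain ⟨C, hC⟩ := exists_gagliardoIntegrand_majorant hd hp hΩ (pos_iff_ne_zero.2 hinj)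
  have := isFiniteMeasure_surfaceMeasure hΩ
  refine ⟨C + 1, by positivity, fun A β hA hβ U G hU u hu ν hν ↦ ?_⟩
  obtain ⟨hum, V, hV, hVU, hVG, hVu⟩ := hu
  -- a subsequence converges almost everywhere on the boundary
  have hVm : ∀ n, AEStronglyMeasurable (V n) (surfaceMeasure Ω) := fun n ↦
    ((hV n).continuousOn.mono frontier_subset_closure).aestronglyMeasurable
      isClosed_frontier.measurableSet
  obtain ⟨ns, hns, hae⟩ := (tendstoInMeasure_of_tendsto_eLpNorm hpo hVm
    hum.aestronglyMeasurable hVu).exists_seq_tendsto_ae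
  choose N hNm hNle hNint using fun n ↦ hC A ν β (V (ns n)) _ _
    (isRegularPair hΩ.isOpen hA hβ (hV (ns n))) hν
  have hfront : ∀ᵐ x ∂surfaceMeasure Ω, x ∈ frontier Ω :=
    ae_restrict_mem isClosed_frontier.measurableSet
  have hle : boundaryGagliardo Ω p (tangentialPart ν A) u ≤
      liminf (fun n ↦ ∫⁻ x, ∫⁻ y, N n (x, y) ∂surfaceMeasure Ω ∂surfaceMeasure Ω) atTop := by
    refine le_trans ?_ (lintegral_lintegral_liminf_le hNm)
    refine lintegral_mono_ae ?_
    filter_upwards [hae, hfront] with x hx hxf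
    refine (setLIntegral_le_lintegral _ _).trans (lintegral_mono_ae ?_)
    have hxne : ∀ᵐ y ∂surfaceMeasure Ω, y ≠ x := by
      rw [ae_iff]
      simpa using surfaceMeasure_singleton hd x
    filter_upwards [hae, hfront, hxne] with y hy hyf hyx
    exact gagliardoIntegrand_le_liminf _ hyx.symm hx hy fun n ↦ hNle n x hxf y hyf hyx.symm
  obtain ⟨M, hM⟩ := exists_eLpNorm_covariantGradient_le hΩ hp hA hU
  set μ := volume.restrict Ω with hμ
  set q := ENNReal.ofReal p with hq
  set b : ℝ≥0∞ := 1 + (β : ℝ≥0∞) ^ (p / 2) with hb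
  have hbtop : b ≠ ⊤ := ENNReal.add_ne_top.2 ⟨ENNReal.one_ne_top,
    ENNReal.rpow_ne_top_of_nonneg (by positivity) ENNReal.coe_ne_top⟩
  -- `R n` bounds the energy of `V n`, and tends to the energy of `U`
  set R : ℕ → ℝ≥0∞ := fun n ↦
    (eLpNorm (fun x ↦ grad (V n) x - G x) q μ + M * eLpNorm (fun x ↦ V n x - U x) q μ +
      eLpNorm (covariantGradient A U G) q μ) ^ p +
    b * (eLpNorm (fun x ↦ V n x - U x) q μ + eLpNorm U q μ) ^ p with hR
  have hq1 : 1 ≤ q := by simpa [hq] using hp.le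
  have hNR : ∀ n, ∫⁻ x, ∫⁻ y, N n (x, y) ∂surfaceMeasure Ω ∂surfaceMeasure Ω ≤
      C * R (ns n) := fun n ↦ by
    refine (hNint n).trans ?_
    rw [magneticEnergy_eq hΩ.isOpen hp]
    refine mul_le_mul_right (add_le_add ?_ (mul_le_mul_right ?_ _)) _
    · exact ENNReal.rpow_le_rpow (hM _ (hV _)) hp0.le
    · refine ENNReal.rpow_le_rpow ?_ hp0.le
      have hVn : AEStronglyMeasurable (V (ns n)) μ :=
        ((hV _).continuousOn.mono subset_closure).aestronglyMeasurable hΩ.isOpen.measurableSet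
      have := eLpNorm_add_le (hVn.sub hU.memLp.aestronglyMeasurable)
        hU.memLp.aestronglyMeasurable hq1
      rw [sub_add_cancel] at this
      exact this
  have hRlim : Tendsto R atTop (𝓝 (eLpNorm (covariantGradient A U G) q μ ^ p +
      b * eLpNorm U q μ ^ p)) := by
    have h1 : Tendsto (fun n ↦ eLpNorm (fun x ↦ grad (V n) x - G x) q μ +
        M * eLpNorm (fun x ↦ V n x - U x) q μ + eLpNorm (covariantGradient A U G) q μ) atTop
        (𝓝 (eLpNorm (covariantGradient A U G) q μ)) := by
      have := (hVG.add (ENNReal.Tendsto.const_mul (a := (M : ℝ≥0∞)) hVU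
        (Or.inr ENNReal.coe_ne_top))).add_const (eLpNorm (covariantGradient A U G) q μ)
      simpa using this
    have h2 : Tendsto (fun n ↦ eLpNorm (fun x ↦ V n x - U x) q μ + eLpNorm U q μ) atTop
        (𝓝 (eLpNorm U q μ)) := by
      simpa using hVU.add_const (eLpNorm U q μ)
    have h3 := ENNReal.continuous_rpow_const (y := p)
    exact ((h3.tendsto _).comp h1).add
      (ENNReal.Tendsto.const_mul ((h3.tendsto _).comp h2) (Or.inr hbtop))
  have hlim : Tendsto (fun n ↦ (C : ℝ≥0∞) * R (ns n)) atTop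
      (𝓝 (C * (eLpNorm (covariantGradient A U G) q μ ^ p + b * eLpNorm U q μ ^ p))) :=
    ENNReal.Tendsto.const_mul (hRlim.comp hns.tendsto_atTop) (Or.inr ENNReal.coe_ne_top)
  have hpow : ∀ a : ℝ≥0∞, (a ^ (1 / p)) ^ p = a := fun a ↦ by
    rw [← ENNReal.rpow_mul, one_div_mul_cancel hp0.ne', ENNReal.rpow_one]
  calc boundaryGagliardo Ω p (tangentialPart ν A) u
      ≤ liminf (fun n ↦ (C : ℝ≥0∞) * R (ns n)) atTop :=
        hle.trans (liminf_le_liminf (Eventually.of_forall hNR))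
    _ = C * (eLpNorm (covariantGradient A U G) q μ ^ p + b * eLpNorm U q μ ^ p) := hlim.liminf_eq
    _ = C * ((∫⁻ x in Ω, ‖covariantGradient A U G x‖ₑ ^ p) + b * ∫⁻ x in Ω, ‖U x‖ₑ ^ p) := by
        rw [eLpNorm_eq_lintegral_rpow_enorm_toReal hpo ENNReal.ofReal_ne_top,
          eLpNorm_eq_lintegral_rpow_enorm_toReal hpo ENNReal.ofReal_ne_top, hq,
          ENNReal.toReal_ofReal hp0.le, hpow, hpow]
    _ ≤ _ := by
        refine mul_le_mul' (by simp) ?_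
        refine le_trans (add_le_add le_rfl (lintegral_const_mul_le _ _)) (le_lintegral_add _ _)
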